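/- Let $M$ be a compact Hermitian manifold (a compact complex manifold with a smooth Hermitian metric, with fundamental form $\omega$), let $\Delta\subset\mathbb C$ be the unit disc and let $\phi:\Delta\to M$ be a holomorphic map with $$\int_\Delta (1-|\zeta|)\,|\phi'(\zeta)|^2\,d\lambda(\zeta)=\infty .$$ For $0<r<1$ let $T_r:=\phi_*\big(\log^+\tfrac{r}{|\zeta|}\,[\Delta]\big)$, i.e. $\langle T_r,\theta\rangle=\int_\Delta \log^+\tfrac r{|\zeta|}\,\phi^*\theta$ for smooth $(1,1)$-forms $\theta$ on $M$; let $\|T_r\|=\langle T_r,\omega\rangle=\int_\Delta\log^+\tfrac r{|\zeta|}|\phi'|^2d\lambda$ be its mass, and put $\tau_r:=T_r/\|T_r\|$ (defined for $r$ close to $1$). Then every cluster point $T$ of $(\tau_r)$ as $r\to1^-$, in the weak topology of currents, is a positive current of bidimension $(1,1)$ which is harmonic, i.e. $i\partial\bar\partial T=0$, and is supported on $\overline{\phi(\Delta)}$. Moreover, let $(X,\mathcal L,E)$ be a lamination with singularities by Riemann surfaces in $M$: $Y=X\setminus E$ is a locally closed subset of $M$ with closure $X$, $E$ is closed, and $Y$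 carries an atlas of flow boxes, that is, of homeomorphisms from relatively open subsets of $Y$ onto $\mathbb D\times\mathcal T$ ($\mathbb D$ the unit disc, $\mathcal T$ a topological space) whose plaques $V_t=\{t=\mathrm{const}\}$ are holomorphically immersed discs in $M$ and whose changes of coordinates are locally of the form $(z,t)\mapsto(h(z,t),t'(t))$ with $h$ continuous, and holomorphic in $z$. A leaf is a minimal nonempty connected subset of $X\setminus E$ that contains every plaque it meets. (a) Suppose that $\mathcal L$ is defined by continuous $(1,0)$-forms $\gamma_1,\dots,\gamma_\ell$ on $M$, which vanish along all plaques and on $E$ and have rank $\dim M-1$ on $X\setminus E$. If $\phi$ is weakly $\mathcal L$-directed, i.e. $\phi(\Delta)\subset X$ and $\langle\gamma_j(\phi(\zeta)),\phi'(\zeta)\rangle=0$ for all $j$ and all $\zeta\in\Delta$, then every cluster point $T$ of $(\tau_r)$ is weakly $\mathcal L$-directed: $T$ is supported on $X$ and $T\wedge\gamma_j=0$ for all $j$. (b) If $\phi$ is $\mathcal L$-directed, i.e. $\phi(\Delta)\subset X$ and every $\zeta\in\Delta$ with $\phi(\zeta)\notin E$ has a neighbourhood that $\phi$ maps into one leaf,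 then every cluster point $T$ of $(\tau_r)$ is $\mathcal L$-directed: $T$ is supported on $X$ and in each flow box of the atlas $$T=\int_{\mathcal T} h_t\,[V_t]\,d\mu(t),$$ with $\mu$ a positive, locally finite Borel measure on $\mathcal T$ and $h_t$ positive harmonic functions on the plaques $V_t$ that depend measurably on $t$. -/

import Mathlib

open Set Filter Topology MeasureTheory Metric
open scoped Manifold ContDiff

noncomputable section

namespace HarmonicCurrents

universe u

section Forms

/-! ### Forms of bidegree (1,1), (1,0), (0,1) on a complex manifold modelled on `E` -/

variable (E : Type*) [NormedAddCommGroup E] [NormedSpace ℂ E]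
variable (M : Type u) [TopologicalSpace M] [ChartedSpace E M]

/-- The fibre at `x` of the bundle of `(1,1)`-covectors, `Λ^{1,0} ⊗ Λ^{0,1}`: forms on the
holomorphic tangent space that are linear in the first and conjugate linear in the second variable.
In coordinates, `H` stands for the `(1,1)`-covector `(i/2) ∑ H_{jk} dz_j ∧ dz̄_k`, where
`H v w = ∑ H_{jk} v_j (conj w_k)`. -/
abbrev Covector11 (x : M) : Type _ :=
  TangentSpace 𝓘(ℂ, E) x →ₗ[ℂ] TangentSpace 𝓘(ℂ, E) x →ₗ⋆[ℂ] ℂ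

/-- The fibre at `x` of the bundle of `(1,0)`-covectors. -/
abbrev Covector10 (x : M) : Type _ := TangentSpace 𝓘(ℂ, E) x →ₗ[ℂ] ℂ

/-- The fibre at `x` of the bundle of `(0,1)`-covectors. -/
abbrev Covector01 (x : M) : Type _ := TangentSpace 𝓘(ℂ, E) x →ₗ⋆[ℂ] ℂ

variable {E M}

/-- The tangent vector of `M` at `e.symm z` whose coordinate vector in the chart `e` is `v`. -/
def coordVec (e : OpenPartialHomeomorph M E) (z v : E) : TangentSpace 𝓘(ℂ, E) (e.symm z) :=
  mfderiv 𝓘(ℂ, E) 𝓘(ℂ, E) e.symm z v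

/-- The coefficient functions of a `(1,1)`-form in the chart `e`. -/
def coeff11 (e : OpenPartialHomeomorph M E) (θ : ∀ x : M, Covector11 E M x) (v w z : E) : ℂ :=
  θ (e.symm z) (coordVec e z v) (coordVec e z w)

/-- The coefficient functions of a `(1,0)`-form in the chart `e`. -/
def coeff10 (e : OpenPartialHomeomorph M E) (γ : ∀ x : M, Covector10 E M x) (v z : E) : ℂ :=
  γ (e.symm z) (coordVec e z v)

/-- The coefficient functions of a `(0,1)`-form in the chart `e`. -/
def coeff01 (e : OpenPartialHomeomorph M E) (β : ∀ x : M, Covector01 E M x) (v z : E) : ℂ :=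
  β (e.symm z) (coordVec e z v)

variable (E M) in
/-- The space of smooth complex-valued `(1,1)`-forms on `M`. When `M` is compact these are the test
forms for currents of bidimension `(1,1)`. -/
def Form11 : Submodule ℂ (∀ x : M, Covector11 E M x) where
  carrier := {θ | ∀ e ∈ atlas E M, ∀ v w : E, ContDiffOn ℝ ∞ (coeff11 e θ v w) e.target}
  add_mem' := fun ha hb e he v w => (ha e he v w).add (hb e he v w)
  zero_mem' := fun _ _ _ _ => contDiffOn_const (c := (0 : ℂ))
  smul_mem' := fun c _ ha e he v w => contDiffOn_const (c := c) |>.mul (ha e he v w)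

/-- A continuous `(1,0)`-form. -/
def IsContinuous10 (γ : ∀ x : M, Covector10 E M x) : Prop :=
  ∀ e ∈ atlas E M, ∀ v : E, ContinuousOn (coeff10 e γ v) e.target

/-- A smooth `(0,1)`-form. -/
def IsSmooth01 (β : ∀ x : M, Covector01 E M x) : Prop :=
  ∀ e ∈ atlas E M, ∀ v : E, ContDiffOn ℝ ∞ (coeff01 e β v) e.target

variable (E) in
/-- A smooth complex-valued function (in the real sense). -/
def IsSmoothFun (f : M → ℂ) : Prop :=
  ∀ e ∈ atlas E M, ContDiffOn ℝ ∞ (fun z => f (e.symm z)) e.target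

/-- For a function `u` on an open subset of `E`, the sesquilinear form
`2 ∑ (∂² u / ∂z_j ∂z̄_k) v_j (conj w_k)`, which represents `i∂∂̄u`
in the convention of `Covector11`.
It is `2 ∂_v ∂̄_w u` with `∂_v = (D_v - i D_{iv}) / 2` and `∂̄_w = (D_w + i D_{iw}) / 2`. -/
def ddbarCoeff (u : E → ℂ) (v w z : E) : ℂ :=
  let D2 : E → E → ℂ := fun a b => fderiv ℝ (fun y => fderiv ℝ u y b) z a
  (1 / 2) * (D2 v w + D2 (Complex.I • v) (Complex.I • w)
    + Complex.I * (D2 v (Complex.I • w) - D2 (Complex.I • v) w))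

/-- `θ = i∂∂̄f`, read in every chart. -/
def IsDDbar (f : M → ℂ) (θ : Form11 E M) : Prop :=
  ∀ e ∈ atlas E M, ∀ z ∈ e.target, ∀ v w : E,
    coeff11 e θ.1 v w z = ddbarCoeff (fun y => f (e.symm y)) v w z

variable (E M) in
/-- A (smooth) Hermitian metric on `M`; its fundamental form is the positive `(1,1)`-form `ω`
represented by `form`. -/
structure HermitianMetric where
  form : Form11 E M
  conj_symm : ∀ (x : M) (v w : TangentSpace 𝓘(ℂ, E) x),
    form.1 x w v = (starRingEnd ℂ) (form.1 x v w)
  pos : ∀ (x : M) (v : TangentSpace 𝓘(ℂ, E) x), v ≠ 0 → 0 < (form.1 x v v).re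

/-- The squared length `|v|²` of a tangent vector. -/
def HermitianMetric.normSq (g : HermitianMetric E M) {x : M} (v : TangentSpace 𝓘(ℂ, E) x) : ℝ :=
  (g.form.1 x v v).re

end Forms

section Currents

/-! ### Currents of bidimension (1,1) on a compact complex manifold -/

variable {E : Type*} [NormedAddCommGroup E] [NormedSpace ℂ E]
variable {M : Type u} [TopologicalSpace M] [ChartedSpace E M]

/-- `T` is a current of bidimension `(1,1)` (on a compact manifold): a linear functional on smooth
`(1,1)`-forms that is continuous for the `C^∞` topology, that is, bounded by finitely many of
the suprema of derivatives of coefficients over compact subsets of charts. -/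
def IsCurrent (T : Form11 E M → ℂ) : Prop :=
  IsLinearMap ℂ T ∧
  ∃ (s : Finset (OpenPartialHomeomorph M E)) (K : OpenPartialHomeomorph M E → Set E) (N : ℕ)
    (C : ℝ),
    (∀ e ∈ s, e ∈ atlas E M ∧ IsCompact (K e) ∧ K e ⊆ e.target) ∧
    ∀ (θ : Form11 E M) (B : ℝ), 0 ≤ B →
      (∀ e ∈ s, ∀ z ∈ K e, ∀ n ≤ N, ∀ v w : E, ‖v‖ ≤ 1 → ‖w‖ ≤ 1 →
        ‖iteratedFDeriv ℝ n (coeff11 e θ.1 v w) z‖ ≤ B) →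
      ‖T θ‖ ≤ C * B

/-- Positivity: `T` is nonnegative on positive `(1,1)`-forms. -/
def IsPositive (T : Form11 E M → ℂ) : Prop :=
  ∀ θ : Form11 E M,
    (∀ (x : M) (v : TangentSpace 𝓘(ℂ, E) x), 0 ≤ (θ.1 x v v).re ∧ (θ.1 x v v).im = 0) →
    0 ≤ (T θ).re ∧ (T θ).im = 0

/-- `i∂∂̄T = 0`, i.e. `⟨T, i∂∂̄f⟩ = 0` for all smooth functions `f`. -/
def IsHarmonic (T : Form11 E M → ℂ) : Prop :=
  ∀ f : M → ℂ, IsSmoothFun E f → ∀ θ : Form11 E M, IsDDbar f θ → T θ = 0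

/-- A positive harmonic current of bidimension `(1,1)`. -/
def IsPositiveHarmonicCurrent (T : Form11 E M → ℂ) : Prop :=
  IsCurrent T ∧ IsPositive T ∧ IsHarmonic T

/-- The support of `T` is contained in the closed set `A`. -/
def IsSupportedOn (T : Form11 E M → ℂ) (A : Set M) : Prop :=
  ∀ (θ : Form11 E M) (U : Set M), IsOpen U → A ⊆ U → (∀ x ∈ U, θ.1 x = 0) → T θ = 0

/-- The mass `∫ T ∧ ω` of a positive current with respect to the Hermitian metric. -/
def mass (g : HermitianMetric E M) (T : Form11 E M → ℂ) : ℝ := (T g.form).re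

/-- The sequence `θ n` of smooth `(1,1)`-forms converges uniformly on `M` to the continuous
`(1,1)`-form `(i/2) γ ∧ β`. -/
def TendstoWedge (g : HermitianMetric E M) (θ : ℕ → Form11 E M)
    (γ : ∀ x : M, Covector10 E M x) (β : ∀ x : M, Covector01 E M x) : Prop :=
  ∀ ε : ℝ, 0 < ε → ∀ᶠ n in atTop, ∀ (x : M) (v w : TangentSpace 𝓘(ℂ, E) x),
    g.normSq v ≤ 1 → g.normSq w ≤ 1 → ‖(θ n).1 x v w - γ x v * β x w‖ ≤ ε

/-- `T ∧ γ = 0` for a positive current `T` and a continuous `(1,0)`-form `γ`. A positive current has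
order zero, so that it extends to continuous forms by uniform approximation; the condition is that
this extension vanishes on `γ ∧ β` for every smooth `(0,1)`-form `β`. -/
def WedgeEqZero (g : HermitianMetric E M) (T : Form11 E M → ℂ)
    (γ : ∀ x : M, Covector10 E M x) : Prop :=
  ∀ β : ∀ x : M, Covector01 E M x, IsSmooth01 β →
    ∀ θ : ℕ → Form11 E M, TendstoWedge g θ γ β → Tendsto (fun n => T (θ n)) atTop (𝓝 0)

/-- The derivative `φ'(ζ)` of a holomorphic map from an open subset of `ℂ` to `M`. -/
def velocity (φ : ℂ → M) (ζ : ℂ) : TangentSpace 𝓘(ℂ, E) (φ ζ) :=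
  mfderiv 𝓘(ℂ) 𝓘(ℂ, E) φ ζ (1 : ℂ)

/-- The value of `φ^* θ` on the disc, as a density with respect to Lebesgue measure:
`φ^* θ = (pullback φ θ) dλ`, because `(i/2) dζ ∧ dζ̄ = dλ`. -/
def pullback (φ : ℂ → M) (θ : Form11 E M) (ζ : ℂ) : ℂ :=
  θ.1 (φ ζ) (velocity φ ζ) (velocity φ ζ)

/-- The current `T_r = φ_*(log⁺(r/|ζ|) [Δ])`, for a map `φ` of the unit disc `Δ`. -/
def discCurrent (φ : ℂ → M) (r : ℝ) (θ : Form11 E M) : ℂ :=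
  ∫ ζ in ball (0 : ℂ) 1, (Real.posLog (r / ‖ζ‖) : ℂ) * pullback φ θ ζ

/-- The normalized current `τ_r = T_r / ‖T_r‖`. -/
def normalizedDiscCurrent (g : HermitianMetric E M) (φ : ℂ → M) (r : ℝ) (θ : Form11 E M) : ℂ :=
  discCurrent φ r θ / (mass g (discCurrent φ r) : ℂ)

end Currents

section Laminations

/-! ### Laminations with singularities by Riemann surfaces in a complex manifold -/

variable (E : Type*) [NormedAddCommGroup E] [NormedSpace ℂ E]
variable {M : Type u} [TopologicalSpace M] [ChartedSpace E M]

/-- A flow box of a set `Y ⊆ M`: a chart from a relatively open subset of `Y` onto `Δ × T`, with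
`T` a topological space, whose plaques `{t = const}` are holomorphically immersed discs of `M`. -/
structure FlowBox (Y : Set M) where
  T : Type u
  [topology : TopologicalSpace T]
  chart : OpenPartialHomeomorph Y (ℂ × T)
  target_eq : chart.target = ball (0 : ℂ) 1 ×ˢ (univ : Set T)
  holomorphic : ∀ t : T,
    MDifferentiableOn 𝓘(ℂ) 𝓘(ℂ, E) (fun z : ℂ => (chart.symm (z, t) : M)) (ball 0 1)
  immersive : ∀ t : T, ∀ z ∈ ball (0 : ℂ) 1,
    velocity (E := E) (fun z : ℂ => (chart.symm (z, t) : M)) z ≠ 0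

attribute [instance] FlowBox.topology

namespace FlowBox

variable {E} {Y : Set M}

/-- The open subset of `Y` on which the flow box is defined, as a subset of `M`. -/
def domain (B : FlowBox E Y) : Set M := Subtype.val '' B.chart.source

/-- The holomorphic parametrization of the plaque `t = const` by the unit disc. -/
def plaqueMap (B : FlowBox E Y) (t : B.T) (z : ℂ) : M := (B.chart.symm (z, t) : M)

/-- The plaques of the flow box. -/
def plaque (B : FlowBox E Y) (t : B.T) : Set M := B.plaqueMap t '' ball 0 1

/-- Compatibility of two flow boxes: locally on the overlap the change of coordinates has the form
`(z, t) ↦ (h(z, t), t'(t))`, with `h` holomorphic in `z`. (Continuity is part of `chart`.) -/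
def Compatible (B B' : FlowBox E Y) : Prop :=
  ∀ p ∈ B.chart.source ∩ B'.chart.source,
    DifferentiableAt ℂ (fun z : ℂ => (B'.chart (B.chart.symm (z, (B.chart p).2))).1)
      (B.chart p).1 ∧
    ∃ τ : B.T → B'.T, ∀ᶠ q in 𝓝 p, (B'.chart q).2 = τ (B.chart q).2

end FlowBox

variable (M) in
/-- A lamination with singularities `(X, ℒ, E)` by Riemann surfaces in `M`: the laminated set
`Y = X \ E` is locally closed with an atlas of flow boxes, `X` is its closure and the singular set
`E = X \ Y` is closed. -/
structure SingularLamination where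
  Y : Set M
  isClosed_sing : IsClosed (closure Y \ Y)
  boxes : Set (FlowBox E Y)
  cover : ∀ y : Y, ∃ B ∈ boxes, y ∈ B.chart.source
  compatible : ∀ B ∈ boxes, ∀ B' ∈ boxes, B.Compatible B'

namespace SingularLamination

variable {E}

/-- The closed set `X`. -/
def X (L : SingularLamination E M) : Set M := closure L.Y

/-- The singular set. -/
def sing (L : SingularLamination E M) : Set M := L.X \ L.Y

/-- A set is saturated if it contains every plaque that it meets. -/
def IsSaturated (L : SingularLamination E M) (S : Set M) : Prop :=
  ∀ B ∈ L.boxes, ∀ t : B.T, (S ∩ B.plaque t).Nonempty → B.plaque t ⊆ S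

/-- A leaf: a minimal (nonempty) connected subset of `X \ E` that contains each plaque it meets. -/
def IsLeaf (L : SingularLamination E M) (S : Set M) : Prop :=
  Minimal (fun S : Set M => S ⊆ L.Y ∧ IsConnected S ∧ L.IsSaturated S) S

/-- The lamination is defined by the continuous `(1,0)`-forms `γ_1, …, γ_ℓ`: they vanish along the
plaques (`γ_j ∧ [V] = 0` for each plaque `V`) and on the singular set, and they have rank
`dim M - 1` on `X \ E`. -/
structure DefinedBy (L : SingularLamination E M) {ℓ : ℕ}
    (γ : Fin ℓ → ∀ x : M, Covector10 E M x) : Prop where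
  continuous : ∀ j, IsContinuous10 (γ j)
  plaque : ∀ j, ∀ B ∈ L.boxes, ∀ t : B.T, ∀ z ∈ ball (0 : ℂ) 1,
    γ j (B.plaqueMap t z) (velocity (B.plaqueMap t) z) = 0
  sing : ∀ j, ∀ x ∈ L.sing, γ j x = 0
  rank : ∀ x ∈ L.Y,
    Module.finrank ℂ (Submodule.span ℂ (range fun j => γ j x)) + 1 = Module.finrank ℂ E

/-- A map `φ` of the unit disc is weakly directed: it takes values in `X` and its derivative is
annihilated by the forms `γ_j`. -/
def IsWeaklyDirectedMap (L : SingularLamination E M) {ℓ : ℕ}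
    (γ : Fin ℓ → ∀ x : M, Covector10 E M x) (φ : ℂ → M) : Prop :=
  MapsTo φ (ball 0 1) L.X ∧ ∀ j, ∀ ζ ∈ ball (0 : ℂ) 1, γ j (φ ζ) (velocity φ ζ) = 0

/-- A map `φ` of the unit disc is directed: it takes values in `X` and, away from the singular set,
it is locally contained in leaves. -/
def IsDirectedMap (L : SingularLamination E M) (φ : ℂ → M) : Prop :=
  MapsTo φ (ball 0 1) L.X ∧
  ∀ ζ ∈ ball (0 : ℂ) 1, φ ζ ∉ L.sing → ∃ S : Set M, L.IsLeaf S ∧ ∀ᶠ ξ in 𝓝 ζ, φ ξ ∈ S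

/-- A positive current `T` of bidimension `(1,1)` is weakly directed: it is supported on `X` and
`T ∧ γ_j = 0` for all `j`. -/
def IsWeaklyDirected (L : SingularLamination E M) (g : HermitianMetric E M) {ℓ : ℕ}
    (γ : Fin ℓ → ∀ x : M, Covector10 E M x) (T : Form11 E M → ℂ) : Prop :=
  IsCurrent T ∧ IsPositive T ∧ IsSupportedOn T L.X ∧ ∀ j, WedgeEqZero g T (γ j)

/-- In the flow box `B` the current `T` is `∫ h_t [V_t] dμ(t)`, where `μ` is a positive (locally
finite) Borel measure on the transversal and `h_t` is a positive harmonic function on the plaque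
`V_t` depending measurably on `t`. The forms tested are those with support in an open subset of
`M` that meets `X` in the flow box. -/
def HasLaminarForm (L : SingularLamination E M) (T : Form11 E M → ℂ) (B : FlowBox E L.Y) : Prop :=
  ∃ (_ : MeasurableSpace B.T) (_ : BorelSpace B.T) (μ : Measure B.T) (h : B.T → ℂ → ℝ),
    IsLocallyFiniteMeasure μ ∧
    (∀ t, InnerProductSpace.HarmonicOnNhd (h t) (ball 0 1)) ∧
    (∀ t, ∀ z ∈ ball (0 : ℂ) 1, 0 < h t z) ∧
    (∀ z ∈ ball (0 : ℂ) 1, Measurable fun t => h t z) ∧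
    ∀ θ : Form11 E M, closure {x | θ.1 x ≠ 0} ∩ L.X ⊆ B.domain →
      (∀ t, IntegrableOn (fun z => (h t z : ℂ) * pullback (B.plaqueMap t) θ z) (ball 0 1)) ∧
      Integrable (fun t => ∫ z in ball (0 : ℂ) 1, (h t z : ℂ) * pullback (B.plaqueMap t) θ z) μ ∧
      T θ = ∫ t, ∫ z in ball (0 : ℂ) 1, (h t z : ℂ) * pullback (B.plaqueMap t) θ z ∂volume ∂μ

/-- A positive harmonic current `T` of bidimension `(1,1)` is directed: it is supported on `X` and
has the form `∫ h_t [V_t] dμ(t)` in the flow boxes. -/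
def IsDirected (L : SingularLamination E M) (T : Form11 E M → ℂ) : Prop :=
  IsPositiveHarmonicCurrent T ∧ IsSupportedOn T L.X ∧ ∀ B ∈ L.boxes, L.HasLaminarForm T B

end SingularLamination

end Laminations

end HarmonicCurrents

end

open Set Filter Topology MeasureTheory Metric
open scoped Manifold ContDiff

noncomputable section

namespace HarmonicCurrents

-- Everything rests on Jensen's formula. If u is bounded and C² on the disc, the integral of
-- log⁺(r/|ζ|) Δu is 2π times the difference between the mean of u on the circle of radius r and
-- u(0). It is therefore at most 4π sup|u|, uniformly in r (`norm_integral_posLog_lap_le`). The mass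
-- of T_r, on the other hand, tends to infinity, because log(1/|ζ|) ≥ 1 - |ζ|
-- (`tendsto_mass_discCurrent`). The pullback of i∂∂̄f by φ is half the Laplacian of f ∘ φ, so after
-- division by the mass nothing is left in the limit: T is harmonic.
--
-- Order zero, the support and T ∧ γ_j = 0 come from one estimate, `IsDiscLimit.norm_le`: if |φ^*θ|
-- ≤ A|φ'|² on the disc, then |T(θ)| ≤ A. Positivity passes directly to the limit.
--
-- For the laminar form, a leaf is a union of plaques joined by finite chains, so it meets only
-- countably many plaques of a box (`IsLeaf.countable_plaques`). A continuous map from a connected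
-- set into a countable subset of a metrizable space is constant. Hence a directed map stays locally
-- in one plaque, and its plaque coordinate is holomorphic (`directed_coord`). The normalized trace
-- measures log⁺(r/|ζ|)|φ'|²dλ, pushed forward to X, converge along an ultrafilter by the Riesz
-- theorem. Read in a box, the limit is a finite measure ρ on the product of the transversal and the
-- disc, and T is vρ with v the inverse squared speed of the plaques.
--
-- A product of a continuous α(t) and a mollifier in z pulls back to a bounded C² function on the
-- disc, since t is locally constant along φ. Jensen's formula applies again and shows that vρ
-- annihilates α(t) times the Laplacian of the mollifier. After disintegration over the transversal,
-- almost every conditional measure is weakly harmonic, and Weyl's lemma (`weyl`) turns it into a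
-- harmonic density h_t. A density with a zero vanishes identically and is discarded, which leaves
-- h_t > 0 (`exists_harmonic_disintegration`).

universe u

/-! ### Jensen's formula and Laplacians under holomorphic maps. -/

section PlaneAnalysis

open Complex
open Real (posLog)

/-- The Laplacian of a function on the complex plane. -/
def lap {F : Type*} [NormedAddCommGroup F] [NormedSpace ℝ F] (u : ℂ → F) (z : ℂ) : F :=
  fderiv ℝ (fderiv ℝ u) z 1 1 + fderiv ℝ (fderiv ℝ u) z I I

/-- The cross terms of the two squares cancel against each other, so no symmetry of `B` is needed.
-/
lemma bilin_rotate (B : ℂ →L[ℝ] ℂ →L[ℝ] ℂ) (θ : ℝ) :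
    B (exp (θ * I)) (exp (θ * I)) + B (I * exp (θ * I)) (I * exp (θ * I)) = B 1 1 + B I I := by
  have h1 : exp (θ * I) = (Real.cos θ) • (1 : ℂ) + (Real.sin θ) • I := by
    rw [exp_mul_I]; simp
  have h2 : I * exp (θ * I) = (Real.cos θ) • I - (Real.sin θ) • (1 : ℂ) := by
    rw [h1]; simp [mul_add]; ring_nf; simp; ring
  rw [h2, h1]
  simp only [map_add, map_sub, map_smul, add_apply, sub_apply, smul_apply]
  have := Real.cos_sq_add_sin_sq θ
  have h3 : ((Real.cos θ : ℝ) : ℂ) ^ 2 + ((Real.sin θ : ℝ) : ℂ) ^ 2 = 1 := by exact_mod_cast this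
  simp only [real_smul]
  linear_combination (B 1 1 + B I I) * h3

lemma hasDerivAt_exp_mul_I (θ : ℝ) :
    HasDerivAt (fun t : ℝ => exp (t * I)) (I * exp (θ * I)) θ := by
  have h : HasDerivAt (fun t : ℂ => exp (t * I)) (exp (θ * I) * (1 * I)) (θ : ℂ) :=
    ((hasDerivAt_id (θ : ℂ)).mul_const I).cexp
  convert h.comp_ofReal using 1
  ring

/-- The angular integral of the Laplacian. -/
lemma integral_angle_lap {u : ℂ → ℂ} (hu : ContDiff ℝ 2 u) (ρ : ℝ) :
    ∫ θ in (-Real.pi)..Real.pi, (ρ : ℂ) * lap u (ρ * exp (θ * I)) =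
      ∫ θ in (-Real.pi)..Real.pi,
        (fderiv ℝ u (ρ * exp (θ * I)) (exp (θ * I)) +
          ρ * fderiv ℝ (fderiv ℝ u) (ρ * exp (θ * I)) (exp (θ * I)) (exp (θ * I))) := by
  have hd1 : ContDiff ℝ 1 (fderiv ℝ u) := hu.fderiv_right (by norm_num)
  have hc1 : Continuous (fderiv ℝ u) := hd1.continuous
  have hc2 : Continuous (fderiv ℝ (fderiv ℝ u)) := hd1.continuous_fderiv (by norm_num)
  have he : Continuous fun θ : ℝ => exp (θ * I) := by fun_prop
  -- The tangential derivative is periodic in θ, so `V'` has integral zero over a full turn. On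
  -- average this exchanges the second tangential derivative for the first radial one.
  set V : ℝ → ℂ := fun θ => fderiv ℝ u (ρ * exp (θ * I)) (I * exp (θ * I))
  set V' : ℝ → ℂ := fun θ =>
    ρ * fderiv ℝ (fderiv ℝ u) (ρ * exp (θ * I)) (I * exp (θ * I)) (I * exp (θ * I))
      - fderiv ℝ u (ρ * exp (θ * I)) (exp (θ * I))
  have hV : ∀ θ, HasDerivAt V (V' θ) θ := by
    intro θ
    have h1 : HasDerivAt (fun t : ℝ => (ρ : ℂ) * exp (t * I)) (ρ * (I * exp (θ * I))) θ :=
      (hasDerivAt_exp_mul_I θ).const_mul _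
    have h2 : HasDerivAt (fun t : ℝ => fderiv ℝ u (ρ * exp (t * I)))
        (fderiv ℝ (fderiv ℝ u) (ρ * exp (θ * I)) (ρ * (I * exp (θ * I)))) θ :=
      ((hd1.differentiable (by norm_num)) _).hasFDerivAt.comp_hasDerivAt θ h1
    have h3 : HasDerivAt (fun t : ℝ => I * exp (t * I)) (I * (I * exp (θ * I))) θ :=
      (hasDerivAt_exp_mul_I θ).const_mul _
    have h4 := h2.clm_apply h3
    refine h4.congr_deriv ?_
    have e1 : (ρ : ℂ) * (I * exp (θ * I)) = ρ • (I * exp (θ * I)) := by simp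
    have e2 : I * (I * exp (θ * I)) = - exp (θ * I) := by
      rw [← mul_assoc, I_mul_I]; ring
    rw [e2, e1, map_smul, smul_apply, map_neg, real_smul]
    rfl
  have hV'c : Continuous V' := by
    have : Continuous fun θ : ℝ => (ρ : ℂ) * exp (θ * I) := by fun_prop
    exact ((continuous_const.mul (((hc2.comp this).clm_apply (continuous_const.mul he)).clm_apply
      (continuous_const.mul he)))).sub ((hc1.comp this).clm_apply he)
  have hint : ∫ θ in (-Real.pi)..Real.pi, V' θ = 0 := by
    rw [intervalIntegral.integral_eq_sub_of_hasDerivAt (fun θ _ => hV θ)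
      (hV'c.intervalIntegrable _ _)]
    simp only [V]
    have : exp (((Real.pi : ℝ) : ℂ) * I) = exp (((-Real.pi : ℝ) : ℂ) * I) := by
      rw [ofReal_neg, neg_mul, Complex.exp_neg, exp_pi_mul_I]; norm_num
    rw [this, sub_self]
  rw [← sub_eq_zero, ← intervalIntegral.integral_sub, ← hint]
  · refine intervalIntegral.integral_congr fun θ _ => ?_
    simp only [V', lap]
    rw [← bilin_rotate (fderiv ℝ (fderiv ℝ u) (ρ * exp (θ * I))) θ]
    ring
  · have : Continuous fun θ : ℝ => (ρ : ℂ) * exp (θ * I) := by fun_prop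
    unfold lap
    exact (continuous_const.mul ((((hc2.comp this).clm_apply continuous_const).clm_apply
      continuous_const).add (((hc2.comp this).clm_apply continuous_const).clm_apply
      continuous_const))).intervalIntegrable _ _
  · have : Continuous fun θ : ℝ => (ρ : ℂ) * exp (θ * I) := by fun_prop
    exact (((hc1.comp this).clm_apply he).add (continuous_const.mul
      (((hc2.comp this).clm_apply he).clm_apply he))).intervalIntegrable _ _

lemma intervalIntegrable_log_div (r : ℝ) (hr : 0 < r) :
    IntegrableOn (fun ρ : ℝ => Real.log (r / ρ)) (Ioc 0 r) := by
  have h : IntervalIntegrable (fun ρ : ℝ => Real.log r - Real.log ρ) volume 0 r :=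
    intervalIntegrable_const.sub intervalIntegral.intervalIntegrable_log'
  rw [intervalIntegrable_iff_integrableOn_Ioc_of_le hr.le] at h
  refine h.congr_fun (fun ρ hρ => ?_) measurableSet_Ioc
  rw [Real.log_div hr.ne' hρ.1.ne']

/-- The weight is unbounded at ρ = 0; this integrability licenses Fubini in Jensen's formula. -/
lemma integrable_log_mul (r : ℝ) (hr : 0 < r) {B : ℝ × ℝ → ℂ} (hB : Continuous B) :
    Integrable (fun p : ℝ × ℝ => (Real.log (r / p.1) : ℂ) * B p)
      ((volume.restrict (Ioc 0 r)).prod (volume.restrict (Ioc (-Real.pi) Real.pi))) := by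
  obtain ⟨C, hC⟩ := (isCompact_Icc (a := (0 : ℝ)) (b := r)).prod
    (isCompact_Icc (a := -Real.pi) (b := Real.pi)) |>.exists_bound_of_continuousOn hB.continuousOn
  have h1 : Integrable (fun p : ℝ × ℝ => (Real.log (r / p.1) : ℂ))
      ((volume.restrict (Ioc 0 r)).prod (volume.restrict (Ioc (-Real.pi) Real.pi))) :=
    ((intervalIntegrable_log_div r hr).ofReal (𝕜 := ℂ)).comp_fst _
  refine h1.mul_bdd (c := C) hB.aestronglyMeasurable ?_
  rw [Measure.prod_restrict]
  refine (ae_restrict_iff' (measurableSet_Ioc.prod measurableSet_Ioc)).2 (ae_of_all _ ?_)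
  intro p hp
  exact hC p ⟨Ioc_subset_Icc_self hp.1, Ioc_subset_Icc_self hp.2⟩

/-- The radial integration by parts. -/
lemma integral_radius_log {u : ℂ → ℂ} (hu : ContDiff ℝ 2 u) {r : ℝ} (hr : 0 < r) (e : ℂ) :
    ∫ ρ in (0 : ℝ)..r, (Real.log (r / ρ) : ℂ) *
        (fderiv ℝ u (ρ * e) e + ρ * fderiv ℝ (fderiv ℝ u) (ρ * e) e e) = u (r * e) - u 0 := by
  have hd1 : ContDiff ℝ 1 (fderiv ℝ u) := hu.fderiv_right (by norm_num)
  have hc1 : Continuous (fderiv ℝ u) := hd1.continuous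
  have hc2 : Continuous (fderiv ℝ (fderiv ℝ u)) := hd1.continuous_fderiv (by norm_num)
  -- The bracket in the integrand is the ρ-derivative of ρ times the radial derivative of u, and `P`
  -- is what integration by parts produces. Written with ρ log ρ it is continuous at ρ = 0, where
  -- only u(0) remains; at ρ = r the logarithmic factor vanishes.
  set P : ℝ → ℂ := fun ρ => ((ρ * Real.log r - ρ * Real.log ρ : ℝ) : ℂ) * fderiv ℝ u (ρ * e) e
    + u (ρ * e) with hP
  have hmul : Continuous fun ρ : ℝ => (ρ : ℂ) * e := by fun_prop
  have hPc : Continuous P := by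
    have := Real.continuous_mul_log
    have h2 : Continuous fun ρ : ℝ => ((ρ * Real.log r - ρ * Real.log ρ : ℝ) : ℂ) :=
      continuous_ofReal.comp ((continuous_id.mul continuous_const).sub this)
    exact (h2.mul ((hc1.comp hmul).clm_apply continuous_const)).add (hu.continuous.comp hmul)
  have hder : ∀ ρ ∈ Ioo 0 r, HasDerivAt P ((Real.log (r / ρ) : ℂ) *
        (fderiv ℝ u (ρ * e) e + ρ * fderiv ℝ (fderiv ℝ u) (ρ * e) e e)) ρ := by
    intro ρ hρ
    have h1 : HasDerivAt (fun t : ℝ => (t : ℂ) * e) e ρ := by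
      simpa using ((hasDerivAt_id (ρ : ℂ)).mul_const e).comp_ofReal
    have h2 : HasDerivAt (fun t : ℝ => fderiv ℝ u (t * e) e)
        (fderiv ℝ (fderiv ℝ u) (ρ * e) e e) ρ := by
      have := ((hd1.differentiable (by norm_num)) _).hasFDerivAt.comp_hasDerivAt ρ h1
      simpa using this.clm_apply (hasDerivAt_const ρ e)
    have h3 : HasDerivAt (fun t : ℝ => u (t * e)) (fderiv ℝ u (ρ * e) e) ρ :=
      ((hu.differentiable (by norm_num)) _).hasFDerivAt.comp_hasDerivAt ρ h1
    have h4 : HasDerivAt (fun t : ℝ => ((t * Real.log r - t * Real.log t : ℝ) : ℂ))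
        ((Real.log r - (Real.log ρ + 1) : ℝ) : ℂ) ρ := by
      refine HasDerivAt.ofReal_comp ?_
      have := ((hasDerivAt_id ρ).mul_const (Real.log r)).sub (Real.hasDerivAt_mul_log hρ.1.ne')
      exact this.congr_deriv (by simp)
    refine ((h4.mul h2).add h3).congr_deriv ?_
    rw [Real.log_div hr.ne' hρ.1.ne']
    push_cast
    ring
  rw [intervalIntegral.integral_eq_sub_of_hasDerivAt_of_le hr.le hPc.continuousOn hder]
  · simp [hP]
  · rw [intervalIntegrable_iff_integrableOn_Ioc_of_le hr.le]
    have hB : Continuous fun ρ : ℝ =>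
        (fderiv ℝ u (ρ * e) e + ρ * fderiv ℝ (fderiv ℝ u) (ρ * e) e e) :=
      ((hc1.comp hmul).clm_apply continuous_const).add (continuous_ofReal.mul
        (((hc2.comp hmul).clm_apply continuous_const).clm_apply continuous_const))
    obtain ⟨C, hC⟩ := (isCompact_Icc (a := (0 : ℝ)) (b := r)).exists_bound_of_continuousOn
      hB.continuousOn
    refine Integrable.mul_bdd (c := C) ((intervalIntegrable_log_div r hr).ofReal (𝕜 := ℂ))
      hB.aestronglyMeasurable ?_
    exact (ae_restrict_iff' measurableSet_Ioc).2
      (ae_of_all _ fun p hp => hC p (Ioc_subset_Icc_self hp))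

lemma integral_eq_polar {F : Type*} [NormedAddCommGroup F] [NormedSpace ℝ F] (f : ℂ → F) :
    ∫ z, f z = ∫ p in Ioi (0 : ℝ) ×ˢ Ioc (-Real.pi) Real.pi,
      p.1 • f (p.1 * exp (p.2 * I)) := by
  rw [← Complex.integral_comp_polarCoord_symm]
  have h : (Ioi (0 : ℝ) ×ˢ Ioc (-Real.pi) Real.pi : Set (ℝ × ℝ)) =ᵐ[volume] polarCoord.target := by
    rw [Measure.volume_eq_prod]
    exact Measure.set_prod_ae_eq (ae_eq_refl _) Ioo_ae_eq_Ioc.symm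
  rw [setIntegral_congr_set h]
  refine integral_congr_ae (ae_of_all _ fun p => ?_)
  simp [exp_mul_I]

/-- The Jensen formula. -/
lemma integral_posLog_lap {u : ℂ → ℂ} (hu : ContDiff ℝ 2 u) {r : ℝ} (hr : 0 < r) (hr1 : r ≤ 1) :
    ∫ ζ in ball (0 : ℂ) 1, (posLog (r / ‖ζ‖) : ℂ) * lap u ζ =
      ∫ θ in (-Real.pi)..Real.pi, (u (r * exp (θ * I)) - u 0) := by
  have hd1 : ContDiff ℝ 1 (fderiv ℝ u) := hu.fderiv_right (by norm_num)
  have hc1 : Continuous (fderiv ℝ u) := hd1.continuous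
  have hc2 : Continuous (fderiv ℝ (fderiv ℝ u)) := hd1.continuous_fderiv (by norm_num)
  have hpp : -Real.pi ≤ Real.pi := by linarith [Real.pi_pos]
  have hlog : ∀ ρ : ℝ, r ≤ ρ → posLog (r / ρ) = 0 := by
    intro ρ hρ
    rw [Real.posLog_eq_zero_iff, abs_of_nonneg (by have := hr.trans_le hρ; positivity)]
    exact (div_le_one (hr.trans_le hρ)).2 hρ
  have hlog' : ∀ ρ : ℝ, 0 < ρ → ρ ≤ r → posLog (r / ρ) = Real.log (r / ρ) := by
    intro ρ h0 hρ
    rw [Real.posLog_eq_log]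
    rw [abs_of_nonneg (by positivity)]
    exact (one_le_div h0).2 hρ
  have hexp : ∀ ρ θ : ℝ, 0 < ρ → ‖(ρ : ℂ) * exp (θ * I)‖ = ρ := by
    intro ρ θ h; simp [norm_exp_ofReal_mul_I, abs_of_pos h]
  rw [setIntegral_eq_integral_of_forall_compl_eq_zero, integral_eq_polar]
  swap
  · intro z hz
    rw [hlog _ (hr1.trans (by simpa using hz))]; simp
  simp only [real_smul]
  have hcl : Continuous fun p : ℝ × ℝ => (p.1 : ℂ) * lap u (p.1 * exp (p.2 * I)) := by
    have : Continuous fun p : ℝ × ℝ => (p.1 : ℂ) * exp (p.2 * I) := by fun_prop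
    unfold lap
    exact (by fun_prop : Continuous fun p : ℝ × ℝ => (p.1 : ℂ)).mul
      ((((hc2.comp this).clm_apply continuous_const).clm_apply
      continuous_const).add (((hc2.comp this).clm_apply continuous_const).clm_apply
      continuous_const))
  have hcA : Continuous fun p : ℝ × ℝ => (fderiv ℝ u (p.1 * exp (p.2 * I)) (exp (p.2 * I)) +
          p.1 * fderiv ℝ (fderiv ℝ u) (p.1 * exp (p.2 * I)) (exp (p.2 * I)) (exp (p.2 * I))) := by
    have : Continuous fun p : ℝ × ℝ => (p.1 : ℂ) * exp (p.2 * I) := by fun_prop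
    have he : Continuous fun p : ℝ × ℝ => exp (p.2 * I) := by fun_prop
    exact ((hc1.comp this).clm_apply he).add
      ((by fun_prop : Continuous fun p : ℝ × ℝ => (p.1 : ℂ)).mul
      (((hc2.comp this).clm_apply he).clm_apply he))
  calc ∫ p in Ioi (0 : ℝ) ×ˢ Ioc (-Real.pi) Real.pi, (p.1 : ℂ) *
        ((posLog (r / ‖(p.1 : ℂ) * exp (p.2 * I)‖) : ℂ) * lap u (p.1 * exp (p.2 * I)))
      = ∫ p in Ioc (0 : ℝ) r ×ˢ Ioc (-Real.pi) Real.pi, (p.1 : ℂ) *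
        ((posLog (r / ‖(p.1 : ℂ) * exp (p.2 * I)‖) : ℂ) * lap u (p.1 * exp (p.2 * I))) := by
        refine setIntegral_eq_of_subset_of_forall_sdiff_eq_zero (measurableSet_Ioi.prod
          measurableSet_Ioc) (prod_mono Ioc_subset_Ioi_self le_rfl) ?_
        rintro p ⟨⟨hp1, hp2⟩, hp3⟩
        have : r ≤ p.1 := by
          by_contra h
          exact hp3 ⟨⟨hp1, (not_le.1 h).le⟩, hp2⟩
        rw [hexp _ _ hp1, hlog _ this]; simp
    _ = ∫ p in Ioc (0 : ℝ) r ×ˢ Ioc (-Real.pi) Real.pi, (Real.log (r / p.1) : ℂ) *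
          ((p.1 : ℂ) * lap u (p.1 * exp (p.2 * I))) := by
        refine setIntegral_congr_fun (measurableSet_Ioc.prod measurableSet_Ioc) ?_
        rintro p ⟨hp1, hp2⟩
        simp only
        rw [hexp _ _ hp1.1, hlog' _ hp1.1 hp1.2]
        ring
    _ = ∫ ρ in Ioc (0 : ℝ) r, ∫ θ in Ioc (-Real.pi) Real.pi, (Real.log (r / ρ) : ℂ) *
          ((ρ : ℂ) * lap u (ρ * exp (θ * I))) := by
        rw [Measure.volume_eq_prod, ← Measure.prod_restrict]
        exact integral_prod _ (integrable_log_mul r hr hcl)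
    _ = ∫ ρ in Ioc (0 : ℝ) r, ∫ θ in Ioc (-Real.pi) Real.pi, (Real.log (r / ρ) : ℂ) *
          (fderiv ℝ u (ρ * exp (θ * I)) (exp (θ * I)) +
          ρ * fderiv ℝ (fderiv ℝ u) (ρ * exp (θ * I)) (exp (θ * I)) (exp (θ * I))) := by
        refine setIntegral_congr_fun measurableSet_Ioc fun ρ _ => ?_
        have := integral_angle_lap hu ρ
        rw [intervalIntegral.integral_of_le hpp, intervalIntegral.integral_of_le hpp] at this
        exact (integral_const_mul _ _).trans
          ((congrArg _ this).trans (integral_const_mul _ _).symm)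
    _ = ∫ θ in Ioc (-Real.pi) Real.pi, ∫ ρ in Ioc (0 : ℝ) r, (Real.log (r / ρ) : ℂ) *
          (fderiv ℝ u (ρ * exp (θ * I)) (exp (θ * I)) +
          ρ * fderiv ℝ (fderiv ℝ u) (ρ * exp (θ * I)) (exp (θ * I)) (exp (θ * I))) :=
        integral_integral_swap (integrable_log_mul r hr hcA)
    _ = _ := by
        rw [intervalIntegral.integral_of_le hpp]
        refine setIntegral_congr_fun measurableSet_Ioc fun θ _ => ?_
        rw [← intervalIntegral.integral_of_le hr.le, integral_radius_log hu hr]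

lemma lap_congr {F : Type*} [NormedAddCommGroup F] [NormedSpace ℝ F] {u v : ℂ → F} {z : ℂ}
    (h : u =ᶠ[𝓝 z] v) : lap u z = lap v z := by
  unfold lap
  rw [(h.fderiv (𝕜 := ℝ)).fderiv_eq]

/-- Jensen's formula above is for functions on the whole plane; a cutoff equal to one near the
closed disc of radius r changes nothing where the weight is nonzero. The bound, 2π times 2C, does
not depend on r, so these integrals are negligible against a mass tending to infinity. -/
lemma norm_integral_posLog_lap_le {u : ℂ → ℂ} (hu : ContDiffOn ℝ 2 u (ball 0 1)) {C : ℝ}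
    (hC : ∀ z ∈ ball (0 : ℂ) 1, ‖u z‖ ≤ C) {r : ℝ} (hr : 0 < r) (hr1 : r < 1) :
    ‖∫ ζ in ball (0 : ℂ) 1, (posLog (r / ‖ζ‖) : ℂ) * lap u ζ‖ ≤ 4 * Real.pi * C := by
  -- The two radii are chosen so that r < (1 + r)/2 < (3 + r)/4 < 1.
  set b : ContDiffBump (0 : ℂ) := ⟨(1 + r) / 2, (3 + r) / 4, by linarith, by linarith⟩ with hb
  set v : ℂ → ℂ := fun z => (b z : ℂ) * u z with hv
  have hvs : ContDiff ℝ 2 v := by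
    rw [contDiff_iff_contDiffAt]
    intro z
    by_cases hz : z ∈ ball (0 : ℂ) 1
    · have h1 : ContDiffAt ℝ 2 (fun z => (b z : ℂ)) z :=
        ofRealCLM.contDiff.contDiffAt.comp z b.contDiffAt
      exact h1.mul (hu.contDiffAt (isOpen_ball.mem_nhds hz))
    · have : v =ᶠ[𝓝 z] fun _ => 0 := by
        have : z ∉ closure (ball (0 : ℂ) ((3 + r) / 4)) := fun h => by
          have := closure_ball_subset_closedBall h
          simp at this hz
          linarith
        filter_upwards [isClosed_closure.isOpen_compl.mem_nhds this] with y hy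
        have : b y = 0 := by
          apply b.zero_of_le_dist
          by_contra h
          exact hy (subset_closure (by simpa [hb] using h))
        simp [hv, this]
      exact contDiffAt_const.congr_of_eventuallyEq this
  have heq : ∀ z ∈ closedBall (0 : ℂ) r, v =ᶠ[𝓝 z] u := by
    intro z hz
    have : z ∈ ball (0 : ℂ) ((1 + r) / 2) := by
      simp at hz ⊢; linarith
    filter_upwards [isOpen_ball.mem_nhds this] with y hy
    have : b y = 1 := b.one_of_mem_closedBall (ball_subset_closedBall hy)
    simp [hv, this]
  have hI : ∫ ζ in ball (0 : ℂ) 1, (posLog (r / ‖ζ‖) : ℂ) * lap u ζ =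
      ∫ ζ in ball (0 : ℂ) 1, (posLog (r / ‖ζ‖) : ℂ) * lap v ζ := by
    refine setIntegral_congr_fun measurableSet_ball fun z _ => ?_
    by_cases hz : z ∈ closedBall (0 : ℂ) r
    · simp only [lap_congr (heq z hz)]
    · have hz' : r < ‖z‖ := by simpa using hz
      have : posLog (r / ‖z‖) = 0 := by
        rw [Real.posLog_eq_zero_iff, abs_of_nonneg (by positivity)]
        exact (div_le_one (hr.trans hz')).2 hz'.le
      simp [this]
  rw [hI, integral_posLog_lap hvs hr hr1.le]
  have := intervalIntegral.norm_integral_le_of_norm_le_const (C := C + C) (a := -Real.pi)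
    (b := Real.pi) (f := fun θ : ℝ => v (r * exp (θ * I)) - v 0) (fun θ _ => by
      have h1 : (r : ℂ) * exp (θ * I) ∈ closedBall (0 : ℂ) r := by
        simp [norm_exp_ofReal_mul_I, abs_of_pos hr]
      have h0 : (0 : ℂ) ∈ closedBall (0 : ℂ) r := by simp [hr.le]
      rw [(heq _ h1).eq_of_nhds, (heq _ h0).eq_of_nhds]
      have hs : closedBall (0 : ℂ) r ⊆ ball 0 1 := closedBall_subset_ball hr1
      exact (norm_sub_le _ _).trans (add_le_add (hC _ (hs h1)) (hC _ (hs h0))))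
  refine this.trans (le_of_eq ?_)
  rw [abs_of_nonneg (by linarith [Real.pi_pos])]
  ring

/-- The Laplacian of the composition of a `C²` function with a holomorphic map. -/
lemma lap_comp_holomorphic {V : Type*} [NormedAddCommGroup V] [NormedSpace ℂ V] [CompleteSpace V]
    {F : Type*} [NormedAddCommGroup F] [NormedSpace ℝ F]
    {w : V → F} {ψ : ℂ → V} {s : Set V} {U : Set ℂ} (hs : IsOpen s) (hU : IsOpen U)
    (hw : ContDiffOn ℝ 2 w s) (hψ : DifferentiableOn ℂ ψ U) (hm : MapsTo ψ U s) {z : ℂ}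
    (hz : z ∈ U) :
    lap (fun y => w (ψ y)) z =
      fderiv ℝ (fderiv ℝ w) (ψ z) (deriv ψ z) (deriv ψ z) +
      fderiv ℝ (fderiv ℝ w) (ψ z) (I • deriv ψ z) (I • deriv ψ z) := by
  have hψ1 : ∀ y ∈ U, HasDerivAt ψ (deriv ψ y) y := fun y hy =>
    (hψ.differentiableAt (hU.mem_nhds hy)).hasDerivAt
  have hψ2 : ∀ y ∈ U, HasDerivAt (deriv ψ) (deriv (deriv ψ) y) y := fun y hy =>
    ((hψ.deriv hU).differentiableAt (hU.mem_nhds hy)).hasDerivAt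
  have hreal : ∀ {f : ℂ → V} {f' : V} {y : ℂ}, HasDerivAt f f' y →
      HasFDerivAt f ((ContinuousLinearMap.toSpanSingleton ℂ f').restrictScalars ℝ) y :=
    fun h => h.hasFDerivAt.restrictScalars ℝ
  have hw1 : ∀ x ∈ s, HasFDerivAt w (fderiv ℝ w x) x := fun x hx =>
    ((hw.differentiableOn (by norm_num)).differentiableAt (hs.mem_nhds hx)).hasFDerivAt
  have hw2 : ∀ x ∈ s, HasFDerivAt (fderiv ℝ w) (fderiv ℝ (fderiv ℝ w) x) x := fun x hx => by
    have : ContDiffAt ℝ 1 (fderiv ℝ w) x :=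
      (hw.contDiffAt (hs.mem_nhds hx)).fderiv_right (by norm_num)
    exact (this.differentiableAt (by norm_num)).hasFDerivAt
  have h1 : ∀ y ∈ U, ∀ v : ℂ, fderiv ℝ (fun y => w (ψ y)) y v =
      fderiv ℝ w (ψ y) (v • deriv ψ y) := by
    intro y hy v
    have := ((hw1 _ (hm hy)).comp y (hreal (hψ1 y hy))).fderiv
    rw [show (fun y => w (ψ y)) = w ∘ ψ from rfl, this]
    simp
  have hC : ContDiffAt ℝ 2 (fun y => w (ψ y)) z := by
    have hψa : ContDiffAt ℝ 2 ψ z :=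
      ((hψ.analyticOnNhd hU z hz).contDiffAt (n := 2)).restrict_scalars ℝ
    exact (hw.contDiffAt (hs.mem_nhds (hm hz))).comp z hψa
  -- The term with the second derivative of ψ carries the factor v². It changes sign between v = 1
  -- and v = I and drops out of the Laplacian.
  have h2 : ∀ v : ℂ, fderiv ℝ (fderiv ℝ (fun y => w (ψ y))) z v v =
      fderiv ℝ (fderiv ℝ w) (ψ z) (v • deriv ψ z) (v • deriv ψ z) +
        fderiv ℝ w (ψ z) (v • v • deriv (deriv ψ) z) := by
    intro v
    have hd : DifferentiableAt ℝ (fderiv ℝ (fun y => w (ψ y))) z :=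
      (hC.fderiv_right (m := 1) (by norm_num)).differentiableAt (by norm_num)
    have e1 : fderiv ℝ (fderiv ℝ (fun y => w (ψ y))) z v v =
        fderiv ℝ (fun y => fderiv ℝ (fun y => w (ψ y)) y v) z v := by
      rw [fderiv_clm_apply hd (differentiableAt_const v)]
      simp
    rw [e1]
    have e2 : (fun y => fderiv ℝ (fun y => w (ψ y)) y v) =ᶠ[𝓝 z]
        fun y => fderiv ℝ w (ψ y) (v • deriv ψ y) := by
      filter_upwards [hU.mem_nhds hz] with y hy using h1 y hy v
    rw [e2.fderiv_eq]
    have a1 : HasFDerivAt (fun y => fderiv ℝ w (ψ y)) _ z :=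
      (hw2 _ (hm hz)).comp z (hreal (hψ1 z hz))
    have a2 := hreal ((hψ2 z hz).const_smul v)
    have := (a1.clm_apply a2).fderiv
    erw [this]
    simp [add_comm]
  have hII : (I • I • deriv (deriv ψ) z) = - deriv (deriv ψ) z := by
    rw [smul_smul, I_mul_I, neg_smul, one_smul]
  unfold lap
  rw [h2, h2, hII]
  simp only [one_smul, map_neg]
  abel

/-- A complex derivative is a rotation scaled by its modulus, and the trace in the Laplacian is
invariant under rotations (`bilin_rotate`). -/
lemma lap_comp_holomorphic_plane {w : ℂ → ℂ} {f : ℂ → ℂ} {U : Set ℂ} (hU : IsOpen U)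
    (hw : ContDiff ℝ 2 w) (hf : DifferentiableOn ℂ f U) {z : ℂ} (hz : z ∈ U) :
    lap (fun y => w (f y)) z = (‖deriv f z‖ ^ 2 : ℝ) * lap w (f z) := by
  rw [lap_comp_holomorphic isOpen_univ hU hw.contDiffOn hf (mapsTo_univ _ _) hz]
  set B := fderiv ℝ (fderiv ℝ w) (f z)
  set d := deriv f z
  have hd : d = ‖d‖ • exp (arg d * I) := by
    rw [real_smul]; exact (norm_mul_exp_arg_mul_I d).symm
  have hId : I • d = ‖d‖ • (I * exp (arg d * I)) := by
    conv_lhs => rw [hd]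
    simp only [real_smul, smul_eq_mul]; ring
  have : B d d + B (I • d) (I • d) = (‖d‖ ^ 2 : ℝ) * (B 1 1 + B I I) := by
    rw [hId]
    conv_lhs => enter [1]; rw [hd]
    rw [← bilin_rotate B (arg d)]
    have hB : ∀ (c : ℝ) (e : ℂ), B (c • e) (c • e) = (c ^ 2 : ℝ) * B e e := by
      intro c e
      rw [map_smul, map_smul, smul_apply, smul_smul, real_smul, pow_two]
    rw [hB, hB, ← mul_add]
  exact this

end PlaneAnalysis

/-! ### Radial mollifiers and Weyl's lemma for measures on the disc. -/

section Weyl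

open Complex InnerProductSpace

/-- A radial smooth function supported in the disc of radius `ε`. -/
def radialBump (ε : ℝ) (w : ℂ) : ℝ := Real.smoothTransition (1 - ‖w‖ ^ 2 / ε ^ 2)

/-- The radial mollifier of radius `ε`. -/
def moll (ε : ℝ) (w : ℂ) : ℝ := (∫ y, radialBump ε y)⁻¹ * radialBump ε w

lemma contDiff_radialBump (ε : ℝ) : ContDiff ℝ ∞ (radialBump ε) :=
  Real.smoothTransition.contDiff.comp
    (contDiff_const.sub ((contDiff_norm_sq ℝ).div_const _))

lemma radialBump_eq_zero {ε : ℝ} (hε : 0 < ε) {w : ℂ} (hw : ε ≤ ‖w‖) : radialBump ε w = 0 := by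
  refine Real.smoothTransition.zero_of_nonpos ?_
  have : 1 ≤ ‖w‖ ^ 2 / ε ^ 2 := by
    rw [one_le_div (by positivity)]
    gcongr
  linarith

lemma hasCompactSupport_radialBump {ε : ℝ} (hε : 0 < ε) : HasCompactSupport (radialBump ε) :=
  HasCompactSupport.intro (isCompact_closedBall (0 : ℂ) ε) fun w hw =>
    radialBump_eq_zero hε (by simpa using (not_le.1 (by simpa using hw)).le)

lemma integral_radialBump_pos {ε : ℝ} (hε : 0 < ε) : 0 < ∫ y, radialBump ε y := by
  refine (contDiff_radialBump ε).continuous.integral_pos_of_hasCompactSupport_nonneg_nonzero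
    (hasCompactSupport_radialBump hε) (fun w => Real.smoothTransition.nonneg _) (x := 0) ?_
  simp [radialBump]

lemma contDiff_moll (ε : ℝ) : ContDiff ℝ ∞ (moll ε) := contDiff_const.mul (contDiff_radialBump ε)

lemma continuous_moll (ε : ℝ) : Continuous (moll ε) := (contDiff_moll ε).continuous

lemma moll_eq_zero {ε : ℝ} (hε : 0 < ε) {w : ℂ} (hw : ε ≤ ‖w‖) : moll ε w = 0 := by
  simp [moll, radialBump_eq_zero hε hw]

lemma hasCompactSupport_moll {ε : ℝ} (hε : 0 < ε) : HasCompactSupport (moll ε) :=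
  (hasCompactSupport_radialBump hε).mul_left

lemma moll_nonneg {ε : ℝ} (hε : 0 < ε) (w : ℂ) : 0 ≤ moll ε w :=
  mul_nonneg (inv_nonneg.2 (integral_radialBump_pos hε).le) (Real.smoothTransition.nonneg _)

lemma integral_moll {ε : ℝ} (hε : 0 < ε) : ∫ w, moll ε w = 1 := by
  unfold moll
  rw [integral_const_mul, inv_mul_cancel₀ (integral_radialBump_pos hε).ne']

lemma moll_congr (ε : ℝ) {w w' : ℂ} (h : ‖w‖ = ‖w'‖) : moll ε w = moll ε w' := by
  simp [moll, radialBump, h]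

lemma integrable_moll {ε : ℝ} (hε : 0 < ε) : Integrable (moll ε) :=
  (continuous_moll ε).integrable_of_hasCompactSupport (hasCompactSupport_moll hε)

/-- The mean value property with respect to a radial mollifier. -/
lemma integral_moll_mul_of_harmonic {ε : ℝ} (hε : 0 < ε) {g : ℂ → ℝ} {z : ℂ}
    (hg : HarmonicOnNhd g (closedBall z ε)) : ∫ w, moll ε (z - w) * g w = g z := by
  have hgc : ContinuousOn g (closedBall z ε) := hg.continuousOn
  have e0 : ∫ w, moll ε (z - w) * g w = ∫ w, moll ε w * g (z + w) := by
    rw [← integral_add_left_eq_self (fun w => moll ε (z - w) * g w) z]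
    refine integral_congr_ae (ae_of_all _ fun w => ?_)
    simp only
    rw [moll_congr ε (w := z - (z + w)) (w' := w) (by simp)]
  have hmem : ∀ p : ℝ × ℝ, p ∈ Icc 0 ε ×ˢ (univ : Set ℝ) →
      z + p.1 * exp (p.2 * I) ∈ closedBall z ε := by
    rintro p ⟨hp, -⟩
    simp [norm_exp_ofReal_mul_I, abs_of_nonneg hp.1, hp.2]
  have hcont : ContinuousOn (fun p : ℝ × ℝ => p.1 • (moll ε (p.1 * exp (p.2 * I)) *
      (g (z + p.1 * exp (p.2 * I)) - g z))) (Icc 0 ε ×ˢ univ) := by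
    have h1 : Continuous fun p : ℝ × ℝ => (p.1 : ℂ) * exp (p.2 * I) := by fun_prop
    have h2 : ContinuousOn (fun p : ℝ × ℝ => g (z + p.1 * exp (p.2 * I))) (Icc 0 ε ×ˢ univ) :=
      hgc.comp (by fun_prop) hmem
    exact continuousOn_fst.smul (((continuous_moll ε).comp h1).continuousOn.mul
      (h2.sub continuousOn_const))
  -- The mollifier is constant on circles about the origin. In polar coordinates each circle
  -- contributes the mean of g - g(z), which is zero.
  have key : ∫ w, moll ε w * (g (z + w) - g z) = 0 := by
    rw [integral_eq_polar]
    calc ∫ p in Ioi (0 : ℝ) ×ˢ Ioc (-Real.pi) Real.pi, p.1 • (moll ε (p.1 * exp (p.2 * I)) *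
            (g (z + p.1 * exp (p.2 * I)) - g z))
        = ∫ p in Ioc (0 : ℝ) ε ×ˢ Ioc (-Real.pi) Real.pi, p.1 • (moll ε (p.1 * exp (p.2 * I)) *
            (g (z + p.1 * exp (p.2 * I)) - g z)) := by
          symm
          refine (setIntegral_eq_of_subset_of_forall_sdiff_eq_zero (measurableSet_Ioi.prod
            measurableSet_Ioc) (Set.prod_mono Ioc_subset_Ioi_self le_rfl) ?_).symm
          rintro p ⟨⟨hp1, hp2⟩, hp3⟩
          have : ε ≤ p.1 := by
            by_contra h
            exact hp3 ⟨⟨hp1, (not_le.1 h).le⟩, hp2⟩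
          rw [moll_eq_zero hε]
          · simp
          · simpa [norm_exp_ofReal_mul_I, abs_of_pos (show (0 : ℝ) < p.1 from hp1)] using this
      _ = ∫ ρ in Ioc (0 : ℝ) ε, ∫ θ in Ioc (-Real.pi) Real.pi, ρ • (moll ε (ρ * exp (θ * I)) *
            (g (z + ρ * exp (θ * I)) - g z)) := by
          rw [Measure.volume_eq_prod]
          refine setIntegral_prod _ ?_
          refine IntegrableOn.mono_set (ContinuousOn.integrableOn_compact
            (isCompact_Icc.prod isCompact_Icc) (hcont.mono (Set.prod_mono le_rfl (subset_univ _))))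
            (Set.prod_mono Ioc_subset_Icc_self Ioc_subset_Icc_self)
      _ = ∫ ρ in Ioc (0 : ℝ) ε, (0 : ℝ) := by
          refine setIntegral_congr_fun measurableSet_Ioc fun ρ hρ => ?_
          have hm : ∀ θ : ℝ, moll ε (ρ * exp (θ * I)) = moll ε ρ := fun θ =>
            moll_congr ε (by simp [norm_exp_ofReal_mul_I])
          have hav := InnerProductSpace.HarmonicOnNhd.circleAverage_eq (f := g) (c := z) (R := ρ)
            (hg.mono (closedBall_subset_closedBall (by rw [abs_of_pos hρ.1]; exact hρ.2)))
          have hper : ∫ θ in (-Real.pi)..Real.pi, g (circleMap z ρ θ) = 2 * Real.pi * g z := by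
            have h := ((periodic_circleMap z ρ).comp g).intervalIntegral_add_eq (-Real.pi) 0
            simp only [Function.comp_apply, zero_add] at h
            rw [show -Real.pi + 2 * Real.pi = Real.pi by ring] at h
            rw [h, ← hav, Real.circleAverage_def]
            simp only [smul_eq_mul]
            field_simp
          simp only [hm, circleMap] at hper ⊢
          have hci : IntervalIntegrable (fun θ : ℝ => g (z + ρ * exp (θ * I))) volume
              (-Real.pi) Real.pi := by
            refine Continuous.intervalIntegrable ?_ _ _
            have := hgc.comp_continuous (f := fun θ : ℝ => z + ρ * exp (θ * I)) (by fun_prop)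
              (fun θ => hmem (ρ, θ) ⟨⟨hρ.1.le, hρ.2⟩, mem_univ _⟩)
            exact this
          have hpp : -Real.pi ≤ Real.pi := by linarith [Real.pi_pos]
          rw [← intervalIntegral.integral_of_le hpp]
          simp only [smul_eq_mul]
          rw [intervalIntegral.integral_const_mul, intervalIntegral.integral_const_mul,
            intervalIntegral.integral_sub hci intervalIntegrable_const, hper,
            intervalIntegral.integral_const]
          simp only [smul_eq_mul]
          ring
      _ = 0 := by simp
  have hFi : Integrable fun w => moll ε w * g (z + w) := by
    rw [← integrableOn_iff_integrable_of_support_subset (s := closedBall 0 ε)]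
    · refine ContinuousOn.integrableOn_compact (isCompact_closedBall _ _)
        ((continuous_moll ε).continuousOn.mul (hgc.comp (by fun_prop) fun w hw => ?_))
      simpa using hw
    · intro w hw
      by_contra h
      refine hw ?_
      simp only
      rw [moll_eq_zero hε (by simpa using (not_le.1 (by simpa using h)).le), zero_mul]
  rw [e0]
  have h3 : ∫ w, moll ε w * (g (z + w) - g z) =
      (∫ w, moll ε w * g (z + w)) - ∫ w, moll ε w * g z := by
    rw [← integral_sub hFi
      ((integrable_moll hε).mul_const _)]
    simp only [mul_sub]
  rw [key, integral_mul_const, integral_moll hε, one_mul] at h3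
  linarith

lemma integrable_comp_sub {F : Type*} [NormedAddCommGroup F]
    (ν : Measure ℂ) [IsFiniteMeasure ν] {k : ℂ → F} (hk : Continuous k)
    (hs : HasCompactSupport k) (z : ℂ) : Integrable (fun w => k (z - w)) ν := by
  obtain ⟨D, hD⟩ := hk.bounded_above_of_compact_support hs
  exact Integrable.of_bound (hk.comp (by fun_prop : Continuous fun w : ℂ => z - w)
    ).aestronglyMeasurable D (ae_of_all _ fun w => hD _)

/-- Differentiation of a smoothed measure. -/
lemma hasFDerivAt_integral_comp_sub {F : Type*} [NormedAddCommGroup F] [NormedSpace ℝ F]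
    (ν : Measure ℂ) [IsFiniteMeasure ν] {k : ℂ → F} (hk : ContDiff ℝ 1 k)
    (hs : HasCompactSupport k) (z : ℂ) :
    HasFDerivAt (fun z => ∫ w, k (z - w) ∂ν) (∫ w, fderiv ℝ k (z - w) ∂ν) z := by
  have hc : Continuous (fderiv ℝ k) := hk.continuous_fderiv (by norm_num)
  obtain ⟨C, hC⟩ := hc.bounded_above_of_compact_support (hs.fderiv (𝕜 := ℝ))
  have hm : ∀ y : ℂ, Continuous fun w : ℂ => y - w := fun y => by fun_prop
  refine hasFDerivAt_integral_of_dominated_of_fderiv_le (bound := fun _ => C)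
    (F' := fun y w => fderiv ℝ k (y - w)) univ_mem
    (Eventually.of_forall fun y => (hk.continuous.comp (hm y)).aestronglyMeasurable)
    (integrable_comp_sub ν hk.continuous hs z)
    (hc.comp (hm z)).aestronglyMeasurable
    (ae_of_all _ fun w y _ => hC _) (integrable_const _) (ae_of_all _ fun w y _ => ?_)
  have := ((hk.differentiable (by norm_num)) (y - w)).hasFDerivAt.comp y
    ((hasFDerivAt_id y).sub_const w)
  simpa [Function.comp_def] using this

lemma contDiff_two_integral_comp_sub (ν : Measure ℂ) [IsFiniteMeasure ν] {k : ℂ → ℝ}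
    (hk : ContDiff ℝ ∞ k) (hs : HasCompactSupport k) :
    ContDiff ℝ 2 (fun z => ∫ w, k (z - w) ∂ν) ∧
      ∀ z, lap (fun z => ∫ w, k (z - w) ∂ν) z = ∫ w, lap k (z - w) ∂ν := by
  have hk1 : ContDiff ℝ ∞ (fderiv ℝ k) := hk.fderiv_right (by simp)
  have hk2 : ContDiff ℝ ∞ (fderiv ℝ (fderiv ℝ k)) := hk1.fderiv_right (by simp)
  have hs1 : HasCompactSupport (fderiv ℝ k) := hs.fderiv (𝕜 := ℝ)
  have hs2 : HasCompactSupport (fderiv ℝ (fderiv ℝ k)) := hs1.fderiv (𝕜 := ℝ)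
  have h1 := hasFDerivAt_integral_comp_sub ν (hk.of_le (by simp)) hs
  have h2 := hasFDerivAt_integral_comp_sub ν (hk1.of_le (by simp)) hs1
  have h3 := hasFDerivAt_integral_comp_sub ν (hk2.of_le (by simp)) hs2
  have e1 : fderiv ℝ (fun z => ∫ w, k (z - w) ∂ν) = fun z => ∫ w, fderiv ℝ k (z - w) ∂ν :=
    funext fun z => (h1 z).fderiv
  have e2 : fderiv ℝ (fun z => ∫ w, fderiv ℝ k (z - w) ∂ν) =
      fun z => ∫ w, fderiv ℝ (fderiv ℝ k) (z - w) ∂ν := funext fun z => (h2 z).fderiv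
  constructor
  · rw [show (2 : WithTop ℕ∞) = 1 + 1 by norm_num, contDiff_succ_iff_fderiv]
    refine ⟨fun z => (h1 z).differentiableAt, by simp, ?_⟩
    rw [e1, contDiff_one_iff_fderiv]
    refine ⟨fun z => (h2 z).differentiableAt, ?_⟩
    rw [e2]
    exact continuous_iff_continuousAt.2 fun z => (h3 z).continuousAt
  · intro z
    unfold lap
    rw [e1, e2]
    have hI := integrable_comp_sub ν hk2.continuous hs2 z
    have ha : ∀ v : ℂ, (∫ w, fderiv ℝ (fderiv ℝ k) (z - w) ∂ν) v v =
        ∫ w, fderiv ℝ (fderiv ℝ k) (z - w) v v ∂ν := by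
      intro v
      rw [ContinuousLinearMap.integral_apply hI,
        ContinuousLinearMap.integral_apply (hI.apply_continuousLinearMap v)]
    rw [ha, ha, integral_add]
    · exact (hI.apply_continuousLinearMap _).apply_continuousLinearMap _
    · exact (hI.apply_continuousLinearMap _).apply_continuousLinearMap _

lemma laplacian_eq_lap (u : ℂ → ℝ) : Laplacian.laplacian u = lap u := by
  rw [laplacian_eq_iteratedFDeriv_complexPlane]
  ext x
  simp [lap, iteratedFDeriv_two_apply]

lemma lap_eq_zero_of_eventuallyEq_zero {u : ℂ → ℝ} {z : ℂ} (h : u =ᶠ[𝓝 z] 0) : lap u z = 0 := by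
  rw [lap_congr h]
  simp [lap]

lemma lap_moll_eq_zero {ε : ℝ} (hε : 0 < ε) {w : ℂ} (hw : ε < ‖w‖) : lap (moll ε) w = 0 := by
  refine lap_eq_zero_of_eventuallyEq_zero ?_
  filter_upwards [(isOpen_lt continuous_const continuous_norm).mem_nhds hw] with y hy
  exact moll_eq_zero hε (le_of_lt hy)

/-- The smoothing of a measure on the disc. -/
def smooth (ε : ℝ) (ν : Measure ℂ) (z : ℂ) : ℝ := ∫ w, moll ε (z - w) ∂ν

/-- The measures in question are finite only on smaller closed discs, so they must be cut off before
differentiating under the integral. The smoothing near a given point does not see the cut. -/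
lemma smooth_restrict {ε : ℝ} (hε : 0 < ε) (ν : Measure ℂ) {s : ℝ} {z : ℂ} (hz : ‖z‖ + ε ≤ s) :
    smooth ε ν z = smooth ε (ν.restrict (closedBall 0 s)) z := by
  refine (setIntegral_eq_integral_of_forall_compl_eq_zero fun w hw => ?_).symm
  refine moll_eq_zero hε ?_
  have h1 : s < ‖w‖ := by simpa using hw
  have := norm_sub_norm_le w z
  rw [norm_sub_rev] at this
  linarith

lemma smooth_nonneg {ε : ℝ} (hε : 0 < ε) (ν : Measure ℂ) (z : ℂ) : 0 ≤ smooth ε ν z :=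
  integral_nonneg fun _ => moll_nonneg hε _

section

variable {ν : Measure ℂ} (hfin : ∀ s : ℝ, s < 1 → ν (closedBall 0 s) < ⊤)

include hfin

/-- Differentiation under the integral moves the Laplacian onto the mollifier. Weak harmonicity
tested on translated mollifiers is then exactly what is needed. -/
lemma harmonicAt_smooth {ε : ℝ} (hε : 0 < ε)
    (hν : ∀ z : ℂ, ‖z‖ + ε < 1 → ∫ w, lap (moll ε) (z - w) ∂ν = 0) {z : ℂ} (hz : ‖z‖ + ε < 1) :
    HarmonicAt (smooth ε ν) z := by
  obtain ⟨s, hs1, hs2⟩ := exists_between hz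
  have : IsFiniteMeasure (ν.restrict (closedBall 0 s)) := ⟨by simpa using hfin s hs2⟩
  have hev : ∀ᶠ y : ℂ in 𝓝 z, ‖y‖ + ε < s :=
    (isOpen_lt (by fun_prop : Continuous fun y : ℂ => ‖y‖ + ε) continuous_const).mem_nhds hs1
  have heq : smooth ε ν =ᶠ[𝓝 z] smooth ε (ν.restrict (closedBall 0 s)) :=
    hev.mono fun y hy => smooth_restrict hε ν hy.le
  obtain ⟨hc, hl⟩ := contDiff_two_integral_comp_sub (ν.restrict (closedBall 0 s))
    (contDiff_moll ε) (hasCompactSupport_moll hε)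
  refine (harmonicAt_congr_nhds heq).2 ⟨hc.contDiffAt, ?_⟩
  rw [laplacian_eq_lap]
  filter_upwards [hev] with y hy
  refine (hl y).trans ?_
  rw [setIntegral_eq_integral_of_forall_compl_eq_zero, hν y (hy.trans hs2)]
  · rfl
  intro w hw
  refine lap_moll_eq_zero hε ?_
  have h1 : s < ‖w‖ := by simpa using hw
  have := norm_sub_norm_le w y
  rw [norm_sub_rev] at this
  linarith

omit hfin in
lemma norm_integral_moll_sub_le {F : Type*} [NormedAddCommGroup F] [NormedSpace ℝ F]
    [CompleteSpace F] {ε : ℝ} (hε : 0 < ε) {χ : ℂ → F} (hχ : Continuous χ) {η : ℝ} {w : ℂ}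
    (h : ∀ z, dist z w < ε → dist (χ z) (χ w) ≤ η) :
    ‖(∫ z, moll ε (z - w) • χ z) - χ w‖ ≤ η := by
  have hI : Integrable fun z => moll ε (z - w) := (integrable_moll hε).comp_sub_right w
  have hcs : HasCompactSupport fun z => moll ε (z - w) :=
    (hasCompactSupport_moll hε).comp_homeomorph (Homeomorph.subRight w)
  have hc : Continuous fun z => moll ε (z - w) := (continuous_moll ε).comp (by fun_prop)
  have h1 : ∫ z, moll ε (z - w) = 1 := by
    rw [integral_sub_right_eq_self (moll ε) w, integral_moll hε]
  have h2 : χ w = ∫ z, moll ε (z - w) • χ w := by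
    rw [integral_smul_const, h1, one_smul]
  conv_lhs => rw [h2]
  have hI' : Integrable fun z => moll ε (z - w) • χ z :=
    (hc.smul hχ).integrable_of_hasCompactSupport hcs.smul_right
  rw [← integral_sub hI' (hI.smul_const _)]
  calc _ ≤ ∫ z, moll ε (z - w) * η := by
        refine norm_integral_le_of_norm_le (hI.mul_const _) (ae_of_all _ fun z => ?_)
        rw [← smul_sub, norm_smul, Real.norm_of_nonneg (moll_nonneg hε _)]
        by_cases hz : dist z w < ε
        · exact mul_le_mul_of_nonneg_left (by simpa [dist_eq_norm] using h z hz)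
            (moll_nonneg hε _)
        · rw [moll_eq_zero hε (by simpa [dist_eq_norm] using hz)]; simp
    _ = η := by rw [integral_mul_const, h1, one_mul]

/-- The smoothings of `ν` converge weakly to `ν`. -/
lemma tendsto_integral_smooth {F : Type*} [NormedAddCommGroup F] [NormedSpace ℝ F]
    [CompleteSpace F] {ε : ℕ → ℝ} (hε : ∀ n, 0 < ε n) (hε0 : Tendsto ε atTop (𝓝 0)) {χ : ℂ → F}
    (hχ : Continuous χ) {s : ℝ} (hs : s < 1) (hχs : ∀ z, s < ‖z‖ → χ z = 0) :
    Tendsto (fun n => ∫ z, smooth (ε n) ν z • χ z) atTop (𝓝 (∫ w, χ w ∂ν)) := by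
  obtain ⟨s', hs1, hs2⟩ := exists_between hs
  set ν' := ν.restrict (closedBall 0 s') with hν'
  have : IsFiniteMeasure ν' := ⟨by simpa [hν'] using hfin s' hs2⟩
  have hcs : HasCompactSupport χ := HasCompactSupport.intro (isCompact_closedBall (0 : ℂ) s)
    fun z hz => hχs z (by simpa using hz)
  have huc : UniformContinuous χ := hcs.uniformContinuous_of_continuous hχ
  have hχint : ∫ w, χ w ∂ν = ∫ w, χ w ∂ν' :=
    (setIntegral_eq_integral_of_forall_compl_eq_zero fun w hw =>
      hχs w (hs1.trans (by simpa using hw))).symm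
  rw [hχint, Metric.tendsto_nhds]
  intro η hη
  obtain ⟨m, hm0, hm⟩ : ∃ m > 0, m * (ν'.real univ + 1) < η :=
    ⟨η / 2 / (ν'.real univ + 1), by positivity, by
      rw [div_mul_cancel₀ _ (by positivity)]; linarith⟩
  obtain ⟨δ, hδ, hδ'⟩ := Metric.uniformContinuous_iff.1 huc m hm0
  filter_upwards [hε0.eventually (gt_mem_nhds hδ),
    hε0.eventually (gt_mem_nhds (show 0 < s' - s by linarith))] with n hn1 hn2
  obtain ⟨C, hC⟩ := (continuous_moll (ε n)).bounded_above_of_compact_support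
    (hasCompactSupport_moll (hε n))
  have hprod : Integrable (Function.uncurry fun (z w : ℂ) => moll (ε n) (z - w) • χ z)
      (volume.prod ν') := by
    have h1 : Integrable (fun p : ℂ × ℂ => χ p.1) (volume.prod ν') :=
      (hχ.integrable_of_hasCompactSupport hcs).comp_fst ν'
    exact h1.bdd_smul C ((continuous_moll (ε n)).comp
      (by fun_prop : Continuous fun p : ℂ × ℂ => p.1 - p.2)).aestronglyMeasurable
      (ae_of_all _ fun p => hC _)
  have e1 : ∫ z, smooth (ε n) ν z • χ z = ∫ w, (∫ z, moll (ε n) (z - w) • χ z) ∂ν' := by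
    rw [← integral_integral_swap hprod]
    refine integral_congr_ae (ae_of_all _ fun z => ?_)
    simp only
    rw [integral_smul_const]
    by_cases hz : s < ‖z‖
    · simp [hχs z hz]
    · rw [smooth_restrict (hε n) ν (s := s') (by linarith)]
      rfl
  have hi1 : Integrable (fun w => ∫ z, moll (ε n) (z - w) • χ z) ν' := hprod.integral_prod_right
  have hi2 : Integrable χ ν' := by
    obtain ⟨D, hD⟩ := hχ.bounded_above_of_compact_support hcs
    exact Integrable.of_bound hχ.aestronglyMeasurable D (ae_of_all _ hD)
  rw [e1, dist_eq_norm, ← integral_sub hi1 hi2]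
  refine lt_of_le_of_lt (norm_integral_le_of_norm_le_const (C := m) (ae_of_all _ fun w => ?_)) ?_
  · exact norm_integral_moll_sub_le (hε n) hχ fun z hz => (hδ' (hz.trans hn1)).le
  · refine lt_of_le_of_lt ?_ hm
    gcongr
    linarith

variable {ε : ℕ → ℝ} (hε : ∀ n, 0 < ε n) (hε0 : Tendsto ε atTop (𝓝 0))
  (hν : ∀ n, ∀ z : ℂ, ‖z‖ + ε n < 1 → ∫ w, lap (moll (ε n)) (z - w) ∂ν = 0)

include hε hε0 hν

/-- Each `smooth (ε n) ν` with n large is harmonic near z, so its value at z equals its average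
against the mollifier of fixed radius `ε m`. Weak convergence of the smoothings to ν gives the limit
of these averages. As the left side does not involve m, all admissible smoothings agree at z. -/
lemma tendsto_smooth {m : ℕ} {z : ℂ} (hz : ‖z‖ + ε m < 1) :
    Tendsto (fun n => smooth (ε n) ν z) atTop (𝓝 (smooth (ε m) ν z)) := by
  have h := tendsto_integral_smooth hfin hε hε0 (χ := fun y => moll (ε m) (z - y))
    ((continuous_moll _).comp (by fun_prop)) hz (fun y hy => by
      refine moll_eq_zero (hε m) ?_
      have := norm_sub_norm_le y z
      rw [norm_sub_rev] at this
      linarith)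
  refine h.congr' ?_
  filter_upwards [hε0.eventually (gt_mem_nhds (show 0 < 1 - (‖z‖ + ε m) by linarith))] with n hn
  rw [← integral_moll_mul_of_harmonic (hε m) (g := smooth (ε n) ν) (z := z)]
  · simp only [smul_eq_mul, mul_comm]
  · intro y hy
    refine harmonicAt_smooth hfin (hε n) (hν n) ?_
    have h1 : dist y z ≤ ε m := hy
    rw [dist_eq_norm] at h1
    have := norm_sub_norm_le y z
    linarith

/-- Weyl's lemma for measures on the disc. -/
theorem weyl {h : ℂ → ℝ} (hh : ∀ z ∈ ball (0 : ℂ) 1, ∃ n, ‖z‖ + ε n < 1 ∧ h z = smooth (ε n) ν z) :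
    HarmonicOnNhd h (ball 0 1) ∧ (∀ z ∈ ball (0 : ℂ) 1, 0 ≤ h z) ∧
      ∀ (χ : ℂ → ℂ) (s : ℝ), Continuous χ → s < 1 → (∀ z, s < ‖z‖ → χ z = 0) →
        ∫ w, χ w ∂ν = ∫ z in ball (0 : ℂ) 1, (h z : ℂ) * χ z := by
  -- Uniqueness of the limit in `tendsto_smooth` makes the choice of radius irrelevant. Hence `h`,
  -- whose radius may vary wildly with the point, is locally a single smoothing.
  have key : ∀ z : ℂ, ∀ n, ‖z‖ + ε n < 1 → h z = smooth (ε n) ν z := by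
    intro z n hz
    obtain ⟨m, hm, e⟩ := hh z (by simpa using lt_of_le_of_lt (by linarith [hε n]) hz)
    rw [e]
    exact tendsto_nhds_unique (tendsto_smooth hfin hε hε0 hν hm)
      (tendsto_smooth hfin hε hε0 hν hz)
  refine ⟨fun z hz => ?_, fun z hz => ?_, ?_⟩
  · obtain ⟨n, hn, -⟩ := hh z hz
    have hev : ∀ᶠ y : ℂ in 𝓝 z, ‖y‖ + ε n < 1 :=
      (isOpen_lt (by fun_prop : Continuous fun y : ℂ => ‖y‖ + ε n) continuous_const).mem_nhds hn
    exact (harmonicAt_congr_nhds (hev.mono fun y hy => key y n hy)).2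
      (harmonicAt_smooth hfin (hε n) (hν n) hn)
  · obtain ⟨n, hn, e⟩ := hh z hz
    rw [e]; exact smooth_nonneg (hε n) _ _
  · intro χ s hχ hs hχs
    refine tendsto_nhds_unique (tendsto_integral_smooth hfin hε hε0 hχ hs hχs) ?_
    refine tendsto_const_nhds.congr' ?_
    filter_upwards [hε0.eventually (gt_mem_nhds (show 0 < 1 - s by linarith))] with n hn
    rw [setIntegral_eq_integral_of_forall_compl_eq_zero]
    · refine integral_congr_ae (ae_of_all _ fun z => ?_)
      by_cases hz : s < ‖z‖
      · simp [hχs z hz]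
      · simp only
        rw [key z n (by linarith), real_smul]
    · intro z hz
      have : 1 ≤ ‖z‖ := by simpa using hz
      rw [hχs z (by linarith), mul_zero]

end

/-- A nonnegative harmonic function on the disc with a zero vanishes identically. -/
lemma eq_zero_of_harmonic_nonneg {h : ℂ → ℝ} (hh : HarmonicOnNhd h (ball 0 1))
    (h0 : ∀ z ∈ ball (0 : ℂ) 1, 0 ≤ h z) {z₀ : ℂ} (hz₀ : z₀ ∈ ball (0 : ℂ) 1) (hzero : h z₀ = 0) :
    ∀ z ∈ ball (0 : ℂ) 1, h z = 0 := by
  obtain ⟨F, hF, hre⟩ := hh.exists_analyticOnNhd_ball_re_eq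
  -- With h = Re F, the modulus of exp(-F) is exp(-h), which attains its maximal value 1 at z₀. The
  -- maximum modulus principle makes it constant.
  have hd : DifferentiableOn ℂ (fun z => exp (-F z)) (ball 0 1) :=
    (hF.differentiableOn.neg).cexp
  have hn : ∀ z ∈ ball (0 : ℂ) 1, ‖exp (-F z)‖ = Real.exp (-h z) := by
    intro z hz
    rw [norm_exp, neg_re, ← hre hz]
  have hmax : IsMaxOn (norm ∘ fun z => exp (-F z)) (ball 0 1) z₀ := by
    intro z hz
    simp only [Function.comp_apply, mem_ofPred_eq]
    rw [hn z hz, hn z₀ hz₀, hzero]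
    exact Real.exp_le_exp.2 (by linarith [h0 z hz])
  have heq := Complex.norm_eqOn_of_isPreconnected_of_isMaxOn
    (convex_ball (0 : ℂ) 1).isPreconnected isOpen_ball hd hz₀ hmax
  intro z hz
  have h1 := heq hz
  simp only [Function.comp_apply, Function.const_apply] at h1
  rw [hn z hz, hn z₀ hz₀, Real.exp_eq_exp] at h1
  linarith

end Weyl

/-! ### Forms, metrics and velocities in charts. -/

section Coordinates

variable {E : Type*} [NormedAddCommGroup E] [NormedSpace ℂ E]
variable {M : Type u} [TopologicalSpace M] [ChartedSpace E M]

lemma sesquilinear_smul {V : Type*} [AddCommGroup V] [Module ℂ V] (B : V →ₗ[ℂ] V →ₗ⋆[ℂ] ℂ) (a : ℂ)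
    (v : V) : B (a • v) (a • v) = (‖a‖ ^ 2 : ℝ) * B v v := by
  rw [LinearMap.map_smul₂, LinearMap.map_smulₛₗ]
  simp only [smul_eq_mul]
  rw [← mul_assoc, Complex.mul_conj, Complex.normSq_eq_norm_sq]

lemma coeff11_smul (e : OpenPartialHomeomorph M E) (θ : ∀ x : M, Covector11 E M x) (a : ℂ)
    (v z : E) : coeff11 e θ (a • v) (a • v) z = (‖a‖ ^ 2 : ℝ) * coeff11 e θ v v z := by
  have h : coordVec e z (a • v) = a • coordVec e z v := map_smul _ _ _
  unfold coeff11
  rw [h]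
  exact sesquilinear_smul _ _ _

lemma coeff11_sum (e : OpenPartialHomeomorph M E) (θ : ∀ x : M, Covector11 E M x) {ι : Type*}
    [Fintype ι] (b : ι → E) (a : ι → ℂ) (z : E) :
    coeff11 e θ (∑ i, a i • b i) (∑ i, a i • b i) z =
      ∑ i, ∑ j, a i * ((starRingEnd ℂ) (a j) * coeff11 e θ (b i) (b j) z) := by
  have h : coordVec e z (∑ i, a i • b i) = ∑ i, a i • coordVec e z (b i) := by
    have key : ∀ L : E →L[ℂ] E, L (∑ i, a i • b i) = ∑ i, a i • L (b i) := by simp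
    exact key (mfderiv 𝓘(ℂ, E) 𝓘(ℂ, E) e.symm z)
  unfold coeff11
  rw [h]
  simp only [map_sum, LinearMap.sum_apply, map_smul, LinearMap.smul_apply, LinearMap.map_smulₛₗ,
    smul_eq_mul, Finset.mul_sum]
  rw [Finset.sum_comm]
  exact Finset.sum_congr rfl fun i _ => Finset.sum_congr rfl fun j _ => by ring

/-- Membership in `Form11` gives regularity in the point for fixed vectors only; expansion in a
finite basis yields joint continuity in point and vector. -/
lemma continuousOn_coeff11 [FiniteDimensional ℂ E] {e : OpenPartialHomeomorph M E}
    (he : e ∈ atlas E M) (θ : Form11 E M) :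
    ContinuousOn (fun p : E × E => coeff11 e θ.1 p.2 p.2 p.1) (e.target ×ˢ univ) := by
  set b := Module.finBasis ℂ E
  have h : (fun p : E × E => coeff11 e θ.1 p.2 p.2 p.1) = fun p : E × E =>
      ∑ i, ∑ j, b.coord i p.2 * ((starRingEnd ℂ) (b.coord j p.2) *
        coeff11 e θ.1 (b i) (b j) p.1) := by
    funext p
    rw [← coeff11_sum e θ.1 b (fun i => b.coord i p.2) p.1]
    simp only [Module.Basis.coord_apply, b.sum_repr]
  rw [h]
  have hc : ∀ i, Continuous fun p : E × E => b.coord i p.2 := fun i =>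
    (LinearMap.continuous_of_finiteDimensional (b.coord i)).comp continuous_snd
  refine continuousOn_finsetSum _ fun i _ => continuousOn_finsetSum _ fun j _ => ?_
  refine (hc i).continuousOn.mul ((Complex.continuous_conj.comp (hc j)).continuousOn.mul ?_)
  exact (θ.2 e he (b i) (b j)).continuousOn.comp continuousOn_fst fun p hp => hp.1

variable [IsManifold 𝓘(ℂ, E) ω M]

lemma coordVec_bijective {e : OpenPartialHomeomorph M E} (he : e ∈ atlas E M) {z : E}
    (hz : z ∈ e.target) : Function.Bijective (coordVec (M := M) e z) := by
  have h : e.MDifferentiable 𝓘(ℂ, E) 𝓘(ℂ, E) := mdifferentiable_of_mem_atlas he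
  exact h.symm.mfderiv_bijective (x := z) hz

lemma coordVec_ne_zero {e : OpenPartialHomeomorph M E} (he : e ∈ atlas E M) {z : E}
    (hz : z ∈ e.target) {v : E} (hv : v ≠ 0) : coordVec (M := M) e z v ≠ 0 := by
  intro h
  refine hv ((coordVec_bijective he hz).1 (h.trans ?_))
  exact (map_zero (mfderiv 𝓘(ℂ, E) 𝓘(ℂ, E) e.symm z)).symm

lemma differentiableAt_chart_comp {e : OpenPartialHomeomorph M E} (he : e ∈ atlas E M)
    {φ : ℂ → M} {ζ : ℂ} (hφ : MDifferentiableAt 𝓘(ℂ) 𝓘(ℂ, E) φ ζ) (hx : φ ζ ∈ e.source) :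
    DifferentiableAt ℂ (fun ξ => e (φ ξ)) ζ :=
  mdifferentiableAt_iff_differentiableAt.1 ((mdifferentiableAt_atlas he hx).comp ζ hφ)

/-- The velocity of a holomorphic map, read in a chart. -/
lemma apply_velocity {α : Type*} (P : ∀ x : M, TangentSpace 𝓘(ℂ, E) x → α)
    {e : OpenPartialHomeomorph M E} (he : e ∈ atlas E M)
    {φ : ℂ → M} {ζ : ℂ} (hφ : MDifferentiableAt 𝓘(ℂ) 𝓘(ℂ, E) φ ζ) (hx : φ ζ ∈ e.source) :
    P (φ ζ) (velocity φ ζ) =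
      P (e.symm (e (φ ζ))) (coordVec e (e (φ ζ)) (deriv (fun ξ => e (φ ξ)) ζ)) := by
  have hev : φ =ᶠ[𝓝 ζ] e.symm ∘ fun ξ => e (φ ξ) := by
    filter_upwards [hφ.continuousAt.preimage_mem_nhds (e.open_source.mem_nhds hx)] with ξ hξ
    exact (e.left_inv hξ).symm
  have h1 : mfderiv 𝓘(ℂ) 𝓘(ℂ, E) φ ζ = mfderiv 𝓘(ℂ) 𝓘(ℂ, E) (e.symm ∘ fun ξ => e (φ ξ)) ζ :=
    hev.mfderiv_eq
  have hd := differentiableAt_chart_comp he hφ hx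
  have h2 := mfderiv_comp_apply ζ (g := e.symm) (f := fun ξ => e (φ ξ))
    (mdifferentiableAt_atlas_symm he (e.map_source hx))
    (mdifferentiableAt_iff_differentiableAt.2 hd) (1 : ℂ)
  have h3 : (velocity φ ζ : E) = coordVec e (e (φ ζ)) (deriv (fun ξ => e (φ ξ)) ζ) := by
    unfold velocity coordVec
    rw [mfderiv_eq_fderiv] at h2
    exact (congrArg (fun L : ℂ →L[ℂ] E => L 1) h1).trans h2
  -- The base point enters the type of the argument of `P`, so the equality of points is substituted
  -- for free variables.
  have aux : ∀ (x y : M) (_ : x = y) (v : E), P x v = P y v := by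
    intro x y h v; subst h; rfl
  exact (congrArg (fun v : E => P (φ ζ) v) h3).trans (aux _ _ (e.left_inv hx).symm _)

lemma pullback_eq_coeff11 (θ : Form11 E M) {e : OpenPartialHomeomorph M E} (he : e ∈ atlas E M)
    {φ : ℂ → M} {ζ : ℂ} (hφ : MDifferentiableAt 𝓘(ℂ) 𝓘(ℂ, E) φ ζ) (hx : φ ζ ∈ e.source) :
    pullback φ θ ζ = coeff11 e θ.1 (deriv (fun ξ => e (φ ξ)) ζ)
      (deriv (fun ξ => e (φ ξ)) ζ) (e (φ ζ)) :=
  apply_velocity (fun x v => θ.1 x v v) he hφ hx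

lemma continuousOn_pullback [FiniteDimensional ℂ E] (θ : Form11 E M) {φ : ℂ → M} {U : Set ℂ}
    (hU : IsOpen U) (hφ : MDifferentiableOn 𝓘(ℂ) 𝓘(ℂ, E) φ U) :
    ContinuousOn (pullback φ θ) U := by
  intro ζ hζ
  have hd : ∀ ξ ∈ U, MDifferentiableAt 𝓘(ℂ) 𝓘(ℂ, E) φ ξ := fun ξ hξ =>
    hφ.mdifferentiableAt (hU.mem_nhds hξ)
  set e := chartAt E (φ ζ)
  have he : e ∈ atlas E M := chart_mem_atlas E _
  set V := U ∩ φ ⁻¹' e.source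
  have hV : IsOpen V := hφ.continuousOn.isOpen_inter_preimage hU e.open_source
  have hζV : ζ ∈ V := ⟨hζ, mem_chart_source E _⟩
  have hψ : DifferentiableOn ℂ (fun ξ => e (φ ξ)) V := fun ξ hξ =>
    (differentiableAt_chart_comp he (hd ξ hξ.1) hξ.2).differentiableWithinAt
  have h : ContinuousOn (fun ξ => coeff11 e θ.1 (deriv (fun ξ => e (φ ξ)) ξ)
      (deriv (fun ξ => e (φ ξ)) ξ) (e (φ ξ))) V :=
    (continuousOn_coeff11 he θ).comp (hψ.continuousOn.prodMk (hψ.deriv hV).continuousOn)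
      fun ξ hξ => ⟨e.map_source hξ.2, mem_univ _⟩
  refine ContinuousAt.continuousWithinAt ?_
  refine (h.continuousAt (hV.mem_nhds hζV)).congr ?_
  filter_upwards [hV.mem_nhds hζV] with ξ hξ
  exact (pullback_eq_coeff11 θ he (hd ξ hξ.1) hξ.2).symm

omit [IsManifold 𝓘(ℂ, E) ω M]

lemma HermitianMetric.form_apply (g : HermitianMetric E M) (x : M)
    (v : TangentSpace 𝓘(ℂ, E) x) : g.form.1 x v v = (g.normSq v : ℂ) := by
  have := g.conj_symm x v v
  exact (Complex.conj_eq_iff_re.1 this.symm).symm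

lemma HermitianMetric.normSq_nonneg (g : HermitianMetric E M) {x : M}
    (v : TangentSpace 𝓘(ℂ, E) x) : 0 ≤ g.normSq v := by
  by_cases hv : v = 0
  · subst hv; simp [HermitianMetric.normSq]
  · exact (g.pos x v hv).le

lemma HermitianMetric.normSq_smul (g : HermitianMetric E M) {x : M}
    (a : ℂ) (v : TangentSpace 𝓘(ℂ, E) x) : g.normSq (a • v) = ‖a‖ ^ 2 * g.normSq v := by
  have : g.form.1 x (a • v) (a • v) = (‖a‖ ^ 2 : ℝ) * g.form.1 x v v := by
    exact sesquilinear_smul _ _ _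
  unfold HermitianMetric.normSq
  rw [this, Complex.re_ofReal_mul]

variable [IsManifold 𝓘(ℂ, E) ω M]

/-- Positivity on the compact product of `K` and the unit sphere gives a positive constant; both
sides are homogeneous of degree two in the vector. -/
lemma HermitianMetric.exists_lower_bound [FiniteDimensional ℂ E] (g : HermitianMetric E M)
    {e : OpenPartialHomeomorph M E} (he : e ∈ atlas E M) {K : Set E} (hK : IsCompact K)
    (hKt : K ⊆ e.target) :
    ∃ c > 0, ∀ z ∈ K, ∀ v : E, c * ‖v‖ ^ 2 ≤ g.normSq (coordVec e z v) := by
  have : ProperSpace E := FiniteDimensional.proper ℂ E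
  have hcont : ContinuousOn (fun p : E × E => (coeff11 e g.form.1 p.2 p.2 p.1).re)
      (K ×ˢ sphere (0 : E) 1) :=
    Complex.continuous_re.comp_continuousOn
      ((continuousOn_coeff11 he g.form).mono (Set.prod_mono hKt (subset_univ _)))
  have hpos : ∀ p ∈ K ×ˢ sphere (0 : E) 1, 0 < (coeff11 e g.form.1 p.2 p.2 p.1).re := by
    rintro p ⟨hp1, hp2⟩
    refine g.pos _ _ (coordVec_ne_zero he (hKt hp1) ?_)
    intro h
    simp [h] at hp2
  obtain ⟨c, hc, hc'⟩ : ∃ c > 0, ∀ p ∈ K ×ˢ sphere (0 : E) 1,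
      c ≤ (coeff11 e g.form.1 p.2 p.2 p.1).re := by
    rcases (K ×ˢ sphere (0 : E) 1).eq_empty_or_nonempty with h | h
    · exact ⟨1, one_pos, by simp [h]⟩
    · obtain ⟨p, hp, hmin⟩ := (hK.prod (isCompact_sphere _ _)).exists_isMinOn h hcont
      exact ⟨_, hpos p hp, fun q hq => hmin hq⟩
  refine ⟨c, hc, fun z hz v => ?_⟩
  by_cases hv : v = 0
  · subst hv
    simpa using g.normSq_nonneg _
  · have hn : ‖v‖ ≠ 0 := norm_ne_zero_iff.2 hv
    have h1 := hc' (z, ((‖v‖⁻¹ : ℝ) : ℂ) • v) ⟨hz, by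
      simp [norm_smul, hn]⟩
    simp only at h1
    rw [coeff11_smul, Complex.re_ofReal_mul, Complex.norm_real, norm_inv, norm_norm] at h1
    have h2 : ‖v‖ ^ 2 * c ≤ ‖v‖ ^ 2 * (‖v‖⁻¹ ^ 2 * (coeff11 e g.form.1 v v z).re) := by gcongr
    rw [← mul_assoc, ← mul_pow, mul_inv_cancel₀ hn, one_pow, one_mul, mul_comm] at h2
    exact h2

/-- A smooth form is dominated by the metric, in terms of the coefficients in finitely many
charts. -/
lemma HermitianMetric.exists_domination [FiniteDimensional ℂ E] [CompactSpace M]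
    (g : HermitianMetric E M) :
    ∃ (s : Finset (OpenPartialHomeomorph M E)) (K : OpenPartialHomeomorph M E → Set E) (C : ℝ),
      0 ≤ C ∧ (∀ e ∈ s, e ∈ atlas E M ∧ IsCompact (K e) ∧ K e ⊆ e.target) ∧
      ∀ (θ : Form11 E M) (B : ℝ), 0 ≤ B →
        (∀ e ∈ s, ∀ z ∈ K e, ∀ v w : E, ‖v‖ ≤ 1 → ‖w‖ ≤ 1 → ‖coeff11 e θ.1 v w z‖ ≤ B) →
        ∀ (x : M) (v : TangentSpace 𝓘(ℂ, E) x), ‖θ.1 x v v‖ ≤ C * B * g.normSq v := by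
  classical
  have : ProperSpace E := FiniteDimensional.proper ℂ E
  have hloc : ∀ x : M, ∃ r > 0, closedBall (chartAt E x x) r ⊆ (chartAt E x).target := fun x =>
    nhds_basis_closedBall.mem_iff.1 ((chartAt E x).open_target.mem_nhds (mem_chart_target E x))
  choose r hr hrt using hloc
  set W : M → Set M := fun x => (chartAt E x).source ∩
    chartAt E x ⁻¹' ball (chartAt E x x) (r x) with hW
  have hWn : ∀ x, W x ∈ 𝓝 x := fun x =>
    inter_mem ((chartAt E x).open_source.mem_nhds (mem_chart_source E x))
      (((chartAt E x).continuousAt (mem_chart_source E x)).preimage_mem_nhds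
        (ball_mem_nhds _ (hr x)))
  obtain ⟨t, -, ht⟩ := isCompact_univ.elim_nhds_subcover W fun x _ => hWn x
  set s : Finset (OpenPartialHomeomorph M E) := t.image (chartAt E) with hs
  -- One chart may serve several centres of the cover, so its compact set collects all the
  -- corresponding balls.
  set K : OpenPartialHomeomorph M E → Set E := fun e =>
    ⋃ x ∈ t.filter (fun x => chartAt E x = e), closedBall (chartAt E x x) (r x) with hK
  have hsK : ∀ e ∈ s, e ∈ atlas E M ∧ IsCompact (K e) ∧ K e ⊆ e.target := by
    intro e he
    obtain ⟨x, hx, rfl⟩ := Finset.mem_image.1 he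
    refine ⟨chart_mem_atlas E x, ?_, ?_⟩
    · exact Finset.isCompact_biUnion _ fun y _ => isCompact_closedBall _ _
    · refine iUnion₂_subset fun y hy => ?_
      rw [← (Finset.mem_filter.1 hy).2]
      exact hrt y
  have hlow : ∀ e : OpenPartialHomeomorph M E, ∃ c > 0, e ∈ s → ∀ z ∈ K e, ∀ v : E,
      c * ‖v‖ ^ 2 ≤ g.normSq (coordVec e z v) := by
    intro e
    by_cases he : e ∈ s
    · obtain ⟨h1, h2, h3⟩ := hsK e he
      obtain ⟨c, hc, h⟩ := g.exists_lower_bound h1 h2 h3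
      exact ⟨c, hc, fun _ => h⟩
    · exact ⟨1, one_pos, fun h => absurd h he⟩
  choose c hc hc' using hlow
  -- The sum of the inverse constants dominates each of them, so it serves all charts at once.
  refine ⟨s, K, ∑ e ∈ s, (c e)⁻¹, Finset.sum_nonneg fun e _ => (inv_pos.2 (hc e)).le, hsK,
    fun θ B hB hθ x v => ?_⟩
  obtain ⟨y, hy, hxy⟩ := mem_iUnion₂.1 (ht (mem_univ x))
  have hes : chartAt E y ∈ s := Finset.mem_image_of_mem _ hy
  set e := chartAt E y with he
  have hz : e x ∈ K e := mem_iUnion₂.2 ⟨y, Finset.mem_filter.2 ⟨hy, rfl⟩,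
    ball_subset_closedBall hxy.2⟩
  have hcoord : ∀ (a : E), ‖coeff11 e θ.1 a a (e x)‖ ≤
      (∑ e ∈ s, (c e)⁻¹) * B * g.normSq (coordVec e (e x) a) := by
    intro a
    have h1 : ‖coeff11 e θ.1 a a (e x)‖ ≤ B * ‖a‖ ^ 2 := by
      by_cases ha : a = 0
      · subst ha
        have : coordVec e (e x) 0 = 0 := map_zero (mfderiv 𝓘(ℂ, E) 𝓘(ℂ, E) e.symm (e x))
        simp [coeff11, this]
      · have hn : ‖a‖ ≠ 0 := norm_ne_zero_iff.2 ha
        have h2 := hθ e hes (e x) hz (((‖a‖⁻¹ : ℝ) : ℂ) • a) (((‖a‖⁻¹ : ℝ) : ℂ) • a)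
          (by simp [norm_smul, hn]) (by simp [norm_smul, hn])
        rw [coeff11_smul, norm_mul, Complex.norm_real, Complex.norm_real, norm_inv, norm_norm,
          norm_pow, norm_inv, norm_norm] at h2
        have h3 : ‖a‖ ^ 2 * (‖a‖⁻¹ ^ 2 * ‖coeff11 e θ.1 a a (e x)‖) ≤ ‖a‖ ^ 2 * B := by gcongr
        rw [← mul_assoc, ← mul_pow, mul_inv_cancel₀ hn, one_pow, one_mul] at h3
        linarith
    have h2 := hc' e hes (e x) hz a
    have h3 : ‖a‖ ^ 2 ≤ (c e)⁻¹ * g.normSq (coordVec e (e x) a) := by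
      rw [inv_mul_eq_div, le_div_iff₀ (hc e)]; linarith
    have h4 : (c e)⁻¹ ≤ ∑ e ∈ s, (c e)⁻¹ :=
      Finset.single_le_sum (f := fun e => (c e)⁻¹) (fun e _ => (inv_pos.2 (hc e)).le) hes
    calc _ ≤ B * ((c e)⁻¹ * g.normSq (coordVec e (e x) a)) := h1.trans (by gcongr)
      _ ≤ B * ((∑ e ∈ s, (c e)⁻¹) * g.normSq (coordVec e (e x) a)) := by
        have := g.normSq_nonneg (coordVec e (e x) a)
        gcongr
      _ = _ := by ring
  have hgen : ∀ x' : M, x' = e.symm (e x) → ∀ v : TangentSpace 𝓘(ℂ, E) x',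
      ‖θ.1 x' v v‖ ≤ (∑ e ∈ s, (c e)⁻¹) * B * g.normSq v := by
    rintro x' rfl v
    obtain ⟨a, rfl⟩ := (coordVec_bijective (hsK e hes).1 (e.map_source hxy.1)).2 v
    exact hcoord a
  exact hgen x (e.left_inv hxy.1).symm v

omit [IsManifold 𝓘(ℂ, E) ω M] in
lemma IsSmoothFun.continuous {f : M → ℂ} (hf : IsSmoothFun E f) : Continuous f := by
  refine continuous_iff_continuousAt.2 fun x => ?_
  have h := (hf _ (chart_mem_atlas E x)).continuousOn.continuousAt
    ((chartAt E x).open_target.mem_nhds (mem_chart_target E x))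
  have h2 : ContinuousAt (fun y => f ((chartAt E x).symm (chartAt E x y))) x :=
    ContinuousAt.comp (f := chartAt E x) h ((chartAt E x).continuousAt (mem_chart_source E x))
  refine h2.congr ?_
  filter_upwards [(chartAt E x).open_source.mem_nhds (mem_chart_source E x)] with y hy
  rw [(chartAt E x).left_inv hy]

/-- The pullback of `i∂∂̄f` under a holomorphic map, and the regularity of `f ∘ φ`. -/
lemma IsSmoothFun.comp_holomorphic [FiniteDimensional ℂ E] {f : M → ℂ} (hf : IsSmoothFun E f)
    {φ : ℂ → M} {U : Set ℂ} (hU : IsOpen U) (hφ : MDifferentiableOn 𝓘(ℂ) 𝓘(ℂ, E) φ U) {ζ : ℂ}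
    (hζ : ζ ∈ U) : ContDiffAt ℝ 2 (fun ξ => f (φ ξ)) ζ ∧
      ∀ θ : Form11 E M, IsDDbar f θ → pullback φ θ ζ = (1 / 2) * lap (fun ξ => f (φ ξ)) ζ := by
  have : CompleteSpace E := FiniteDimensional.complete ℂ E
  have hd : ∀ ξ ∈ U, MDifferentiableAt 𝓘(ℂ) 𝓘(ℂ, E) φ ξ := fun ξ hξ =>
    hφ.mdifferentiableAt (hU.mem_nhds hξ)
  set e := chartAt E (φ ζ)
  have he : e ∈ atlas E M := chart_mem_atlas E _
  set V := U ∩ φ ⁻¹' e.source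
  have hV : IsOpen V := hφ.continuousOn.isOpen_inter_preimage hU e.open_source
  have hζV : ζ ∈ V := ⟨hζ, mem_chart_source E _⟩
  have hψ : DifferentiableOn ℂ (fun ξ => e (φ ξ)) V := fun ξ hξ =>
    (differentiableAt_chart_comp he (hd ξ hξ.1) hξ.2).differentiableWithinAt
  have hm : MapsTo (fun ξ => e (φ ξ)) V e.target := fun ξ hξ => e.map_source hξ.2
  have hu : ContDiffOn ℝ 2 (fun z => f (e.symm z)) e.target :=
    (hf e he).of_le ENat.LEInfty.out
  have heq : (fun ξ => f (φ ξ)) =ᶠ[𝓝 ζ] fun ξ => f (e.symm (e (φ ξ))) := by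
    filter_upwards [hV.mem_nhds hζV] with ξ hξ
    rw [e.left_inv hξ.2]
  refine ⟨?_, fun θ hθ => ?_⟩
  · refine ContDiffAt.congr_of_eventuallyEq ?_ heq
    have hψa : ContDiffAt ℝ 2 (fun ξ => e (φ ξ)) ζ :=
      ((hψ.analyticOnNhd hV ζ hζV).contDiffAt (n := 2)).restrict_scalars ℝ
    exact ContDiffAt.comp (g := fun z => f (e.symm z)) (f := fun ξ => e (φ ξ)) ζ
      (hu.contDiffAt (e.open_target.mem_nhds (hm hζV))) hψa
  · rw [pullback_eq_coeff11 θ he (hd ζ hζ) hζV.2, hθ e he _ (hm hζV), lap_congr heq,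
      lap_comp_holomorphic (w := fun z => f (e.symm z)) e.open_target hV hu hψ hm hζV]
    set d := deriv (fun ξ => e (φ ξ)) ζ
    set z := e (φ ζ)
    set w : E → ℂ := fun z => f (e.symm z)
    have hz : ContDiffAt ℝ 2 w z := hu.contDiffAt (e.open_target.mem_nhds (hm hζV))
    have hdw : DifferentiableAt ℝ (fderiv ℝ w) z :=
      (hz.fderiv_right (m := 1) (by norm_num)).differentiableAt (by norm_num)
    have hD : ∀ a b : E, fderiv ℝ (fun y => fderiv ℝ w y b) z a = fderiv ℝ (fderiv ℝ w) z a b := by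
      intro a b
      rw [fderiv_clm_apply hdw (differentiableAt_const b)]
      simp
    -- On equal arguments the term with factor I in `ddbarCoeff` is an antisymmetrization of the
    -- second derivative. Symmetry removes it, and half of the trace over d and I • d is left.
    have hsymm : IsSymmSndFDerivAt ℝ w z :=
      hz.isSymmSndFDerivAt (by simp)
    change ddbarCoeff w d d z = _
    unfold ddbarCoeff
    simp only [hD]
    rw [hsymm.eq d (Complex.I • d)]
    ring

end Coordinates

/-! ### The disc currents, their growing mass, and the limit as a positive harmonic current. -/

section DiscCurrents

open Real (posLog)

lemma posLog_div_eq_zero {r x : ℝ} (hr : 0 < r) (hx : r ≤ x) : posLog (r / x) = 0 := by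
  have hx0 : 0 < x := hr.trans_le hx
  rw [Real.posLog_eq_zero_iff, abs_of_nonneg (by positivity)]
  exact (div_le_one hx0).2 hx

lemma posLog_le_self {x : ℝ} (hx : 0 ≤ x) : posLog x ≤ x :=
  max_le hx (Real.log_le_self hx)

lemma posLog_div_mono {x r r' : ℝ} (hr : 0 ≤ r) (h : r ≤ r') (hx : 0 ≤ x) :
    posLog (r / x) ≤ posLog (r' / x) :=
  Real.posLog_le_posLog (by positivity) (by gcongr)

lemma measurable_posLog_div (r : ℝ) : Measurable fun ζ : ℂ => posLog (r / ‖ζ‖) := by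
  unfold Real.posLog
  fun_prop

lemma integrable_posLog_div {r : ℝ} (hr : 0 < r) : Integrable fun ζ : ℂ => posLog (r / ‖ζ‖) := by
  refine ⟨(measurable_posLog_div r).aestronglyMeasurable, ?_⟩
  rw [hasFiniteIntegral_iff_ofReal (ae_of_all _ fun _ => Real.posLog_nonneg),
    ← Complex.lintegral_comp_polarCoord_symm]
  have hbound : ∀ p ∈ polarCoord.target, ENNReal.ofReal p.1 •
      ENNReal.ofReal (posLog (r / ‖Complex.polarCoord.symm p‖)) ≤
      (Ioc (0 : ℝ) r ×ˢ Ioc (-Real.pi) Real.pi).indicator (fun _ => ENNReal.ofReal r) p := by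
    rintro p ⟨hp1, hp2⟩
    have hp0 : 0 < p.1 := hp1
    rw [Complex.norm_polarCoord_symm, abs_of_pos hp0, smul_eq_mul,
      ← ENNReal.ofReal_mul hp0.le]
    by_cases h : p.1 ≤ r
    · rw [indicator_of_mem (show p ∈ Ioc (0 : ℝ) r ×ˢ Ioc (-Real.pi) Real.pi from
        ⟨⟨hp0, h⟩, Ioo_subset_Ioc_self hp2⟩)]
      refine ENNReal.ofReal_le_ofReal ?_
      -- Because log⁺ x ≤ x, the Jacobian of polar coordinates absorbs the singularity.
      calc p.1 * posLog (r / p.1) ≤ p.1 * (r / p.1) := by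
            gcongr; exact posLog_le_self (by positivity)
        _ = r := by field_simp
    · rw [posLog_div_eq_zero hr (not_le.1 h).le]
      simp
  refine lt_of_le_of_lt (setLIntegral_mono' polarCoord.open_target.measurableSet hbound) ?_
  refine lt_of_le_of_lt (setLIntegral_le_lintegral _ _) ?_
  rw [lintegral_indicator (measurableSet_Ioc.prod measurableSet_Ioc), setLIntegral_const,
    Measure.volume_eq_prod, Measure.prod_prod]
  simp only [Real.volume_Ioc]
  exact ENNReal.mul_lt_top ENNReal.ofReal_lt_top
    (ENNReal.mul_lt_top ENNReal.ofReal_lt_top ENNReal.ofReal_lt_top)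

lemma integrableOn_posLog_mul {r : ℝ} (hr : 0 < r) (hr1 : r < 1) {F : ℂ → ℂ}
    (hF : ContinuousOn F (ball 0 1)) :
    IntegrableOn (fun ζ : ℂ => (posLog (r / ‖ζ‖) : ℂ) * F ζ) (ball 0 1) := by
  have hsub : closedBall (0 : ℂ) r ⊆ ball 0 1 := closedBall_subset_ball hr1
  have h1 : IntegrableOn (fun ζ : ℂ => (posLog (r / ‖ζ‖) : ℂ) * F ζ) (closedBall 0 r) := by
    obtain ⟨C, hC⟩ := (isCompact_closedBall (0 : ℂ) r).exists_bound_of_continuousOn (hF.mono hsub)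
    refine Integrable.mul_bdd (c := C) ((integrable_posLog_div hr).ofReal.restrict)
      ((hF.mono hsub).aestronglyMeasurable measurableSet_closedBall) ?_
    exact (ae_restrict_iff' measurableSet_closedBall).2 (ae_of_all _ hC)
  refine h1.of_forall_sdiff_eq_zero measurableSet_ball fun ζ hζ => ?_
  have : r ≤ ‖ζ‖ := by
    have := hζ.2
    simp at this
    exact this.le
  rw [posLog_div_eq_zero hr this]
  simp

variable {E : Type*} [NormedAddCommGroup E] [NormedSpace ℂ E]
variable {M : Type u} [TopologicalSpace M] [ChartedSpace E M]

lemma HermitianMetric.pullback_form (g : HermitianMetric E M) (φ : ℂ → M) (ζ : ℂ) :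
    pullback φ g.form ζ = (g.normSq (velocity φ ζ) : ℂ) := g.form_apply _ _

/-- The mass of the disc current. -/
lemma discCurrent_form (g : HermitianMetric E M) (φ : ℂ → M) (r : ℝ) :
    discCurrent φ r g.form =
      ((∫ ζ in ball (0 : ℂ) 1, posLog (r / ‖ζ‖) * g.normSq (velocity φ ζ) : ℝ) : ℂ) := by
  unfold discCurrent
  rw [← integral_complex_ofReal]
  refine integral_congr_ae (ae_of_all _ fun ζ => ?_)
  simp only [g.pullback_form]
  push_cast
  rfl

lemma mass_discCurrent (g : HermitianMetric E M) (φ : ℂ → M) (r : ℝ) :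
    mass g (discCurrent φ r) =
      ∫ ζ in ball (0 : ℂ) 1, posLog (r / ‖ζ‖) * g.normSq (velocity φ ζ) := by
  unfold mass
  rw [discCurrent_form, Complex.ofReal_re]

variable [FiniteDimensional ℂ E] [IsManifold 𝓘(ℂ, E) ω M]

section

variable (g : HermitianMetric E M) {φ : ℂ → M}
  (hφ : MDifferentiableOn 𝓘(ℂ) 𝓘(ℂ, E) φ (ball 0 1))

include hφ

lemma integrableOn_discCurrent {r : ℝ} (hr : 0 < r) (hr1 : r < 1) (θ : Form11 E M) :
    IntegrableOn (fun ζ : ℂ => (posLog (r / ‖ζ‖) : ℂ) * pullback φ θ ζ) (ball 0 1) :=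
  integrableOn_posLog_mul hr hr1 (continuousOn_pullback θ isOpen_ball hφ)

lemma integrableOn_mass {r : ℝ} (hr : 0 < r) (hr1 : r < 1) :
    IntegrableOn (fun ζ : ℂ => posLog (r / ‖ζ‖) * g.normSq (velocity φ ζ)) (ball 0 1) := by
  have := (integrableOn_discCurrent hφ hr hr1 g.form).re
  refine this.congr (ae_of_all _ fun ζ => ?_)
  simp [g.pullback_form]

lemma norm_discCurrent_le {r : ℝ} (hr : 0 < r) (hr1 : r < 1) (θ : Form11 E M) {A : ℝ}
    (hA : ∀ ζ ∈ ball (0 : ℂ) 1, ‖pullback φ θ ζ‖ ≤ A * g.normSq (velocity φ ζ)) :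
    ‖discCurrent φ r θ‖ ≤ A * mass g (discCurrent φ r) := by
  rw [mass_discCurrent, ← integral_const_mul]
  refine norm_integral_le_of_norm_le ((integrableOn_mass g hφ hr hr1).const_mul _) ?_
  refine (ae_restrict_iff' measurableSet_ball).2 (ae_of_all _ fun ζ hζ => ?_)
  rw [norm_mul, Complex.norm_real, Real.norm_of_nonneg Real.posLog_nonneg]
  calc _ ≤ posLog (r / ‖ζ‖) * (A * g.normSq (velocity φ ζ)) :=
        mul_le_mul_of_nonneg_left (hA ζ hζ) Real.posLog_nonneg
    _ = _ := by ring

omit hφ [FiniteDimensional ℂ E] [IsManifold 𝓘(ℂ, E) ω M] in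
lemma mass_discCurrent_nonneg (r : ℝ) : 0 ≤ mass g (discCurrent φ r) := by
  rw [mass_discCurrent]
  exact integral_nonneg fun ζ => mul_nonneg Real.posLog_nonneg (g.normSq_nonneg _)

lemma norm_normalizedDiscCurrent_le {r : ℝ} (hr : 0 < r) (hr1 : r < 1) (θ : Form11 E M) {A : ℝ}
    (hA0 : 0 ≤ A)
    (hA : ∀ ζ ∈ ball (0 : ℂ) 1, ‖pullback φ θ ζ‖ ≤ A * g.normSq (velocity φ ζ)) :
    ‖normalizedDiscCurrent g φ r θ‖ ≤ A := by
  unfold normalizedDiscCurrent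
  rw [norm_div, Complex.norm_real, Real.norm_of_nonneg (mass_discCurrent_nonneg g r)]
  -- When the mass is zero the quotient is zero by convention, and the bound survives because A ≥ 0.
  exact div_le_of_le_mul₀ (mass_discCurrent_nonneg g r) hA0
    (norm_discCurrent_le g hφ hr hr1 θ hA)

lemma mass_discCurrent_mono {r r' : ℝ} (hr : 0 < r) (hrr : r ≤ r') (hr1 : r' < 1) :
    mass g (discCurrent φ r) ≤ mass g (discCurrent φ r') := by
  rw [mass_discCurrent, mass_discCurrent]
  refine integral_mono (integrableOn_mass g hφ hr (hrr.trans_lt hr1))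
    (integrableOn_mass g hφ (hr.trans_le hrr) hr1) fun ζ => ?_
  exact mul_le_mul_of_nonneg_right (posLog_div_mono hr.le hrr (norm_nonneg _)) (g.normSq_nonneg _)

/-- Monotone convergence along a sequence of radii increasing to 1 replaces the weight by
log(1/|ζ|), which is at least 1 - |ζ|. Monotonicity of the mass in r carries divergence from the
sequence to the whole filter. -/
lemma tendsto_mass_discCurrent (hinf : ∫⁻ ζ in ball (0 : ℂ) 1,
      ENNReal.ofReal ((1 - ‖ζ‖) * g.normSq (velocity φ ζ)) = ⊤) :
    Tendsto (fun r => mass g (discCurrent φ r)) (𝓝[<] (1 : ℝ)) atTop := by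
  set s : ℕ → ℝ := fun n => 1 - 1 / ((n : ℝ) + 2) with hs
  have hs0 : ∀ n, 0 < s n := fun n => by
    have : (1 : ℝ) / ((n : ℝ) + 2) < 1 := by
      rw [div_lt_one (by positivity)]; have := n.cast_nonneg (α := ℝ); linarith
    simp only [hs]; linarith
  have hs1 : ∀ n, s n < 1 := fun n => by
    have : (0 : ℝ) < 1 / ((n : ℝ) + 2) := by positivity
    simp only [hs]; linarith
  have hsm : Monotone s := fun m n hmn => by
    have : (1 : ℝ) / ((n : ℝ) + 2) ≤ 1 / ((m : ℝ) + 2) := by gcongr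
    simp only [hs]; linarith
  have hst : Tendsto s atTop (𝓝 1) := by
    have : Tendsto (fun n : ℕ => (1 : ℝ) / ((n : ℝ) + 2)) atTop (𝓝 0) :=
      tendsto_const_nhds.div_atTop (tendsto_atTop_add_const_right _ _ tendsto_natCast_atTop_atTop)
    simpa [hs] using this.const_sub 1
  have hlim := lintegral_tendsto_of_tendsto_of_monotone (μ := volume.restrict (ball (0 : ℂ) 1))
    (f := fun n ζ => ENNReal.ofReal (posLog (s n / ‖ζ‖) * g.normSq (velocity φ ζ)))
    (F := fun ζ => ENNReal.ofReal (posLog (1 / ‖ζ‖) * g.normSq (velocity φ ζ)))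
    (fun n => (integrableOn_mass g hφ (hs0 n) (hs1 n)).aemeasurable.ennreal_ofReal)
    (ae_of_all _ fun ζ m n hmn => ENNReal.ofReal_le_ofReal (mul_le_mul_of_nonneg_right
      (posLog_div_mono (hs0 m).le (hsm hmn) (norm_nonneg _)) (g.normSq_nonneg _)))
    (ae_of_all _ fun ζ => by
      refine ENNReal.tendsto_ofReal (Tendsto.mul_const _ ?_)
      exact (Real.continuous_posLog.tendsto _).comp (hst.div_const _))
  have htop : ∫⁻ ζ in ball (0 : ℂ) 1,
      ENNReal.ofReal (posLog (1 / ‖ζ‖) * g.normSq (velocity φ ζ)) = ⊤ := by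
    rw [eq_top_iff, ← hinf]
    refine lintegral_mono_ae ?_
    -- The origin must be left out: there 1/‖ζ‖ is zero by convention, so the logarithmic weight
    -- vanishes while 1 - ‖ζ‖ is 1.
    have h0 : ∀ᵐ ζ : ℂ ∂(volume.restrict (ball (0 : ℂ) 1)), ζ ≠ 0 :=
      ae_restrict_of_ae (by simp [ae_iff])
    filter_upwards [h0] with ζ hζ
    refine ENNReal.ofReal_le_ofReal (mul_le_mul_of_nonneg_right ?_ (g.normSq_nonneg _))
    have hn : 0 < ‖ζ‖ := norm_pos_iff.2 hζ
    have := Real.log_le_sub_one_of_pos hn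
    calc 1 - ‖ζ‖ ≤ Real.log (1 / ‖ζ‖) := by rw [one_div, Real.log_inv]; linarith
      _ ≤ _ := le_max_right _ _
  rw [htop] at hlim
  have hm : ∀ n, ∫⁻ ζ in ball (0 : ℂ) 1,
      ENNReal.ofReal (posLog (s n / ‖ζ‖) * g.normSq (velocity φ ζ)) =
      ENNReal.ofReal (mass g (discCurrent φ (s n))) := fun n => by
    rw [mass_discCurrent, ofReal_integral_eq_lintegral_ofReal
      (integrableOn_mass g hφ (hs0 n) (hs1 n))
      (ae_of_all _ fun ζ => mul_nonneg Real.posLog_nonneg (g.normSq_nonneg _))]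
  simp only [hm] at hlim
  rw [Filter.tendsto_atTop]
  intro A
  have hev : ∀ᶠ n in atTop, ENNReal.ofReal A < ENNReal.ofReal (mass g (discCurrent φ (s n))) :=
    hlim.eventually (lt_mem_nhds ENNReal.ofReal_lt_top)
  obtain ⟨n, hn⟩ := hev.exists
  have hn' : A ≤ mass g (discCurrent φ (s n)) :=
    (ENNReal.lt_ofReal_iff_toReal_lt (by simp)).1 hn |>.le.trans' (by
      rw [ENNReal.toReal_ofReal']; exact le_max_left _ _)
  filter_upwards [Ioo_mem_nhdsLT (hs1 n)] with r hr
  exact hn'.trans (mass_discCurrent_mono g hφ (hs0 n) hr.1.le hr.2)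

end

/-- A positive current obtained as the limit of the normalized disc currents along a filter. -/
structure IsDiscLimit (g : HermitianMetric E M) (φ : ℂ → M) (l : Filter ℝ)
    (T : Form11 E M → ℂ) : Prop where
  mdifferentiableOn : MDifferentiableOn 𝓘(ℂ) 𝓘(ℂ, E) φ (ball 0 1)
  tendsto_mass : Tendsto (fun r => mass g (discCurrent φ r)) l atTop
  eventually_mem : ∀ᶠ r in l, 0 < r ∧ r < 1
  tendsto : ∀ θ, Tendsto (fun r => normalizedDiscCurrent g φ r θ) l (𝓝 (T θ))

namespace IsDiscLimit

variable {g : HermitianMetric E M} {φ : ℂ → M} {l : Filter ℝ} [NeBot l] {T : Form11 E M → ℂ}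
  (h : IsDiscLimit g φ l T)

include h

/-- Only the values of θ on velocities of φ matter, compared with the metric. No derivatives of θ
occur, so T has order zero; the support statement and the wedge condition follow from the same
bound. -/
lemma norm_le (θ : Form11 E M) {A : ℝ} (hA0 : 0 ≤ A)
    (hA : ∀ ζ ∈ ball (0 : ℂ) 1, ‖pullback φ θ ζ‖ ≤ A * g.normSq (velocity φ ζ)) : ‖T θ‖ ≤ A := by
  refine le_of_tendsto (h.tendsto θ).norm ?_
  filter_upwards [h.eventually_mem] with r hr
  exact norm_normalizedDiscCurrent_le g h.mdifferentiableOn hr.1 hr.2 θ hA0 hA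

lemma isLinearMap : IsLinearMap ℂ T where
  map_add a b := by
    refine tendsto_nhds_unique (h.tendsto (a + b)) (((h.tendsto a).add (h.tendsto b)).congr' ?_)
    filter_upwards [h.eventually_mem] with r hr
    unfold normalizedDiscCurrent
    rw [← add_div]
    congr 1
    unfold discCurrent
    rw [← integral_add (integrableOn_discCurrent h.mdifferentiableOn hr.1 hr.2 a)
      (integrableOn_discCurrent h.mdifferentiableOn hr.1 hr.2 b)]
    simp [pullback, mul_add]
  map_smul c a := by
    refine tendsto_nhds_unique (h.tendsto (c • a)) (((h.tendsto a).const_smul c).congr fun r => ?_)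
    unfold normalizedDiscCurrent
    rw [smul_eq_mul, ← mul_div_assoc]
    congr 1
    unfold discCurrent
    rw [← integral_const_mul]
    refine integral_congr_ae (ae_of_all _ fun ζ => ?_)
    simp only [pullback, Submodule.coe_smul, Pi.smul_apply, LinearMap.smul_apply, smul_eq_mul]
    ring

lemma isCurrent [CompactSpace M] : IsCurrent T := by
  refine ⟨h.isLinearMap, ?_⟩
  obtain ⟨s, K, C, hC, hK, hdom⟩ := g.exists_domination
  refine ⟨s, K, 0, C, hK, fun θ B hB hθ => ?_⟩
  refine h.norm_le θ (mul_nonneg hC hB) fun ζ _ => hdom θ B hB (fun e he z hz v w hv hw => ?_) _ _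
  simpa using hθ e he z hz 0 le_rfl v w hv hw

omit [FiniteDimensional ℂ E] [IsManifold 𝓘(ℂ, E) ω M] in
lemma isPositive : IsPositive T := by
  intro θ hθ
  have hcl : IsClosed {z : ℂ | 0 ≤ z.re ∧ z.im = 0} :=
    (isClosed_le continuous_const Complex.continuous_re).inter
      (isClosed_eq Complex.continuous_im continuous_const)
  refine hcl.mem_of_tendsto (h.tendsto θ) (Eventually.of_forall fun r => ?_)
  have hp : ∀ ζ, pullback φ θ ζ = ((pullback φ θ ζ).re : ℂ) := fun ζ =>
    Complex.ext (by simp) (by simpa using! (hθ (φ ζ) (velocity φ ζ)).2)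
  have hr : normalizedDiscCurrent g φ r θ = (((∫ ζ in ball (0 : ℂ) 1,
      posLog (r / ‖ζ‖) * (pullback φ θ ζ).re) / mass g (discCurrent φ r) : ℝ) : ℂ) := by
    unfold normalizedDiscCurrent
    rw [Complex.ofReal_div]
    congr 1
    unfold discCurrent
    rw [← integral_complex_ofReal]
    refine integral_congr_ae (ae_of_all _ fun ζ => ?_)
    simp only
    rw [hp ζ]
    push_cast
    simp
  simp only [mem_ofPred_eq]
  rw [hr]
  refine ⟨?_, Complex.ofReal_im _⟩
  rw [Complex.ofReal_re]
  exact div_nonneg (integral_nonneg fun ζ => mul_nonneg Real.posLog_nonneg (hθ _ _).1)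
    (mass_discCurrent_nonneg g r)

omit [NeBot l] [FiniteDimensional ℂ E] [IsManifold 𝓘(ℂ, E) ω M] in
/-- Integrals of Laplacians of bounded functions become negligible after normalization. -/
lemma tendsto_integral_lap {u : ℂ → ℂ} (hu : ContDiffOn ℝ 2 u (ball 0 1)) {C : ℝ}
    (hC : ∀ z ∈ ball (0 : ℂ) 1, ‖u z‖ ≤ C) :
    Tendsto (fun r => (∫ ζ in ball (0 : ℂ) 1, (posLog (r / ‖ζ‖) : ℂ) * lap u ζ) /
      (mass g (discCurrent φ r) : ℂ)) l (𝓝 0) := by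
  rw [tendsto_zero_iff_norm_tendsto_zero]
  refine squeeze_zero' (Eventually.of_forall fun r => norm_nonneg _) ?_
    (h.tendsto_mass.const_div_atTop (4 * Real.pi * C))
  filter_upwards [h.eventually_mem] with r hr
  rw [norm_div, Complex.norm_real, Real.norm_of_nonneg (mass_discCurrent_nonneg g r)]
  exact div_le_div_of_nonneg_right (norm_integral_posLog_lap_le hu hC hr.1 hr.2)
    (mass_discCurrent_nonneg g r)

/-- The pulled back form is half the Laplacian of f ∘ φ, and f is bounded since M is compact. The
numerators therefore stay bounded while the mass diverges. -/
lemma isHarmonic [CompactSpace M] : IsHarmonic T := by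
  intro f hf θ hθ
  have hsm : ∀ ζ ∈ ball (0 : ℂ) 1, _ := fun ζ hζ =>
    hf.comp_holomorphic isOpen_ball h.mdifferentiableOn hζ
  obtain ⟨C, hC⟩ := isCompact_univ.exists_bound_of_continuousOn hf.continuous.continuousOn
  have h1 := h.tendsto_integral_lap (u := fun ξ => f (φ ξ))
    (fun ζ hζ => (hsm ζ hζ).1.contDiffWithinAt) (C := C) (fun z _ => hC _ (mem_univ _))
  have h2 := h1.const_mul (1 / 2)
  rw [mul_zero] at h2
  refine tendsto_nhds_unique (h.tendsto θ) (h2.congr fun r => ?_)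
  unfold normalizedDiscCurrent
  rw [← mul_div_assoc]
  congr 1
  unfold discCurrent
  rw [← integral_const_mul]
  refine setIntegral_congr_fun measurableSet_ball fun ζ hζ => ?_
  rw [(hsm ζ hζ).2 θ hθ]
  ring

lemma isPositiveHarmonicCurrent [CompactSpace M] : IsPositiveHarmonicCurrent T :=
  ⟨h.isCurrent, h.isPositive, h.isHarmonic⟩

lemma isSupportedOn {A : Set M} (hA : MapsTo φ (ball 0 1) A) : IsSupportedOn T A := by
  intro θ U _ hAU hθ
  have := h.norm_le θ le_rfl fun ζ hζ => by
    rw [pullback, hθ _ (hAU (hA hζ))]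
    simp
  exact norm_le_zero_iff.1 this

/-- Since γ kills the velocity, any form uniformly close to γ ∧ β is small on it. The closeness is
stated for vectors of length at most 1, so the velocity is normalized first and the factor |φ'|²
restored afterwards. -/
lemma wedgeEqZero {γ : ∀ x : M, Covector10 E M x}
    (hγ : ∀ ζ ∈ ball (0 : ℂ) 1, γ (φ ζ) (velocity φ ζ) = 0) : WedgeEqZero g T γ := by
  intro β _ θ hθ
  rw [Metric.tendsto_nhds]
  intro ε hε
  filter_upwards [hθ (ε / 2) (half_pos hε)] with n hn
  rw [dist_zero_right]
  refine lt_of_le_of_lt (h.norm_le (θ n) (half_pos hε).le fun ζ hζ => ?_) (half_lt_self hε)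
  set v := velocity (E := E) φ ζ with hv
  by_cases hv0 : v = 0
  · rw [pullback, ← hv, hv0]
    simp [HermitianMetric.normSq]
  · have hpos : 0 < g.normSq v := g.pos _ _ hv0
    set a : ℝ := (Real.sqrt (g.normSq v))⁻¹ with ha
    have ha2 : a ^ 2 = (g.normSq v)⁻¹ := by
      rw [ha, inv_pow, Real.sq_sqrt hpos.le]
    have hle : g.normSq ((a : ℂ) • v) ≤ 1 := by
      rw [g.normSq_smul, Complex.norm_real, Real.norm_eq_abs, sq_abs, ha2, inv_mul_cancel₀ hpos.ne']
    have h1 := hn (φ ζ) ((a : ℂ) • v) ((a : ℂ) • v) hle hle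
    rw [map_smul (γ (φ ζ)), hγ ζ hζ, smul_zero, zero_mul, sub_zero, sesquilinear_smul, norm_mul,
      Complex.norm_real, Complex.norm_real, Real.norm_eq_abs, Real.norm_eq_abs, sq_abs, ha2,
      abs_of_pos (inv_pos.2 hpos), inv_mul_le_iff₀ hpos] at h1
    rw [pullback, ← hv]
    linarith

end IsDiscLimit

/-- A cluster point is a limit along an ultrafilter. -/
lemma exists_isDiscLimit {g : HermitianMetric E M} {φ : ℂ → M}
    (hφ : MDifferentiableOn 𝓘(ℂ) 𝓘(ℂ, E) φ (ball 0 1))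
    (hinf : ∫⁻ ζ in ball (0 : ℂ) 1,
      ENNReal.ofReal ((1 - ‖ζ‖) * g.normSq (velocity φ ζ)) = ⊤) {T : Form11 E M → ℂ}
    (hT : MapClusterPt T (𝓝[<] (1 : ℝ)) (fun r => normalizedDiscCurrent g φ r)) :
    ∃ l : Ultrafilter ℝ, IsDiscLimit g φ l T := by
  obtain ⟨l, hl, hT⟩ := mapClusterPt_iff_ultrafilter.1 hT
  -- The weak topology is here the product topology on functionals, so convergence is convergence on
  -- each test form.
  refine ⟨l, hφ, (tendsto_mass_discCurrent g hφ hinf).mono_left hl, hl ?_, tendsto_pi_nhds.1 hT⟩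
  exact Ioo_mem_nhdsLT zero_lt_one

end DiscCurrents

/-! ### Transversals, and the countability of plaques in a leaf. -/

section FlowBoxes

variable {E : Type*} [NormedAddCommGroup E] [NormedSpace ℂ E]
variable {M : Type u} [TopologicalSpace M] [ChartedSpace E M]

namespace FlowBox

variable {Y : Set M} (B : FlowBox E Y)

lemma mem_target (t : B.T) {z : ℂ} (hz : z ∈ ball (0 : ℂ) 1) : (z, t) ∈ B.chart.target := by
  rw [B.target_eq]; exact ⟨hz, mem_univ _⟩

lemma symm_mem_source (t : B.T) {z : ℂ} (hz : z ∈ ball (0 : ℂ) 1) :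
    B.chart.symm (z, t) ∈ B.chart.source := B.chart.map_target (B.mem_target t hz)

lemma chart_symm (t : B.T) {z : ℂ} (hz : z ∈ ball (0 : ℂ) 1) :
    B.chart (B.chart.symm (z, t)) = (z, t) := B.chart.right_inv (B.mem_target t hz)

lemma chart_fst_mem {y : Y} (hy : y ∈ B.chart.source) : (B.chart y).1 ∈ ball (0 : ℂ) 1 := by
  have := B.chart.map_source hy
  rw [B.target_eq] at this
  exact this.1

lemma mem_plaque {y : Y} (hy : y ∈ B.chart.source) : (y : M) ∈ B.plaque (B.chart y).2 :=
  ⟨(B.chart y).1, B.chart_fst_mem hy, by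
    change ((B.chart.symm ((B.chart y).1, (B.chart y).2) : Y) : M) = y
    rw [Prod.mk.eta, B.chart.left_inv hy]⟩

lemma continuousOn_symm_slice (t : B.T) :
    ContinuousOn (fun z => B.chart.symm (z, t)) (ball (0 : ℂ) 1) :=
  B.chart.continuousOn_symm.comp (by fun_prop) fun z hz => B.mem_target t hz

lemma continuousOn_plaqueMap (t : B.T) : ContinuousOn (B.plaqueMap t) (ball 0 1) :=
  continuous_subtype_val.comp_continuousOn (B.continuousOn_symm_slice t)

lemma isPreconnected_plaque (t : B.T) : IsPreconnected (B.plaque t) :=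
  (convex_ball (0 : ℂ) 1).isPreconnected.image _ (B.continuousOn_plaqueMap t)

/-- The transversal embeds into the flow box. -/
lemma exists_isEmbedding_transversal : ∃ c : B.T → M, IsEmbedding c := by
  set c : B.T → B.chart.source := fun t => ⟨B.chart.symm (0, t), B.symm_mem_source t (by simp)⟩
  set r : B.chart.source → B.T := fun y => (B.chart y).2
  have hrc : Function.LeftInverse r c := fun t => by
    change (B.chart (B.chart.symm (0, t))).2 = t
    rw [B.chart_symm t (by simp)]
  have hr : Continuous r :=
    continuous_snd.comp (continuousOn_iff_continuous_domRestrict.1 B.chart.continuousOn)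
  have hc : Continuous c := by
    refine Continuous.subtype_mk ?_ _
    exact B.chart.continuousOn_symm.comp_continuous (f := fun t : B.T => ((0 : ℂ), t))
      (by fun_prop) fun t => B.mem_target t (by simp)
  exact ⟨_, IsEmbedding.subtypeVal.comp (IsEmbedding.subtypeVal.comp (hrc.isEmbedding hr hc))⟩

lemma metrizableSpace_transversal [TopologicalSpace.MetrizableSpace M] :
    TopologicalSpace.MetrizableSpace B.T := by
  obtain ⟨c, hc⟩ := B.exists_isEmbedding_transversal
  exact hc.metrizableSpace

lemma secondCountable_transversal [SecondCountableTopology M] : SecondCountableTopology B.T := by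
  obtain ⟨c, hc⟩ := B.exists_isEmbedding_transversal
  exact hc.secondCountableTopology

variable {B} {B' : FlowBox E Y}

/-- Along a plaque, the transversal coordinate of a compatible flow box is locally constant. -/
lemma Compatible.eventually_transversal_eq (h : B.Compatible B') (t : B.T) {z : ℂ}
    (hz : z ∈ ball (0 : ℂ) 1) (hz' : B.chart.symm (z, t) ∈ B'.chart.source) :
    ∀ᶠ w in 𝓝 z, w ∈ ball (0 : ℂ) 1 ∧ B.chart.symm (w, t) ∈ B'.chart.source ∧
      (B'.chart (B.chart.symm (w, t))).2 = (B'.chart (B.chart.symm (z, t))).2 := by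
  obtain ⟨τ, hτ⟩ := (h _ ⟨B.symm_mem_source t hz, hz'⟩).2
  have hc : ContinuousAt (fun z => B.chart.symm (z, t)) z :=
    (B.continuousOn_symm_slice t).continuousAt (isOpen_ball.mem_nhds hz)
  have h0 := hτ.self_of_nhds
  filter_upwards [isOpen_ball.mem_nhds hz, hc.eventually hτ,
    hc.preimage_mem_nhds (B'.chart.open_source.mem_nhds hz')] with w hw hw2 hw3
  refine ⟨hw, hw3, ?_⟩
  rw [hw2, h0, B.chart_symm t hw, B.chart_symm t hz]

/-- A plaque meets only countably many plaques of a compatible flow box. -/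
lemma Compatible.countable_plaques (h : B.Compatible B') (t : B.T) :
    {t' : B'.T | (B.plaque t ∩ B'.plaque t').Nonempty}.Countable := by
  set O : Set ℂ := {z | z ∈ ball (0 : ℂ) 1 ∧ B.chart.symm (z, t) ∈ B'.chart.source}
  set τ : ℂ → B'.T := fun z => (B'.chart (B.chart.symm (z, t))).2
  -- The transversal coordinate of the second box is locally constant on `O`; the Lindelöf property
  -- of subsets of the plane leaves only countably many values.
  obtain ⟨s, -, hs, hcov⟩ := TopologicalSpace.countable_cover_nhdsWithin (s := O)
    (f := fun z => {w | τ w = τ z}) fun z hz => mem_nhdsWithin_of_mem_nhds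
      ((h.eventually_transversal_eq t hz.1 hz.2).mono fun w hw => hw.2.2)
  refine (hs.image τ).mono ?_
  rintro t' ⟨_, ⟨z, hz, rfl⟩, ⟨w, hw, hwz⟩⟩
  have e : B'.chart.symm (w, t') = B.chart.symm (z, t) := Subtype.ext hwz
  have hzO : z ∈ O := ⟨hz, e ▸ B'.symm_mem_source t' hw⟩
  obtain ⟨x, hx, hxz⟩ := mem_iUnion₂.1 (hcov hzO)
  refine ⟨x, hx, ?_⟩
  have h1 : τ z = τ x := hxz
  rw [← h1]
  change (B'.chart (B.chart.symm (z, t))).2 = t'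
  rw [← e, B'.chart_symm t' hw]

end FlowBox

namespace SingularLamination

variable (L : SingularLamination E M)

/-- The plaques through a point in two compatible boxes agree locally. -/
lemma eventually_mem_plaque {B B' : FlowBox E L.Y} (hB : B ∈ L.boxes) (hB' : B' ∈ L.boxes)
    (t : B.T) {z : ℂ} (hz : z ∈ ball (0 : ℂ) 1) (hz' : B.chart.symm (z, t) ∈ B'.chart.source) :
    ∀ᶠ w in 𝓝 z, w ∈ ball (0 : ℂ) 1 ∧
      B.plaqueMap t w ∈ B'.plaque (B'.chart (B.chart.symm (z, t))).2 := by
  filter_upwards [(L.compatible B hB B' hB').eventually_transversal_eq t hz hz'] with w hw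
  refine ⟨hw.1, ?_⟩
  rw [← hw.2.2]
  exact B'.mem_plaque hw.2.1

/-- A leaf meets only countably many plaques of each flow box. -/
lemma IsLeaf.countable_plaques [SecondCountableTopology M] {S : Set M} (hS : L.IsLeaf S)
    {B : FlowBox E L.Y} (hB : B ∈ L.boxes) : {t : B.T | (S ∩ B.plaque t).Nonempty}.Countable := by
  choose box hbox hmem using L.cover
  obtain ⟨s, hs, hcov⟩ := TopologicalSpace.countable_cover_nhds
    (f := fun y : L.Y => (box y).chart.source)
    fun y => (box y).chart.open_source.mem_nhds (hmem y)
  have hcover : ∀ y : L.Y, ∃ i : s, y ∈ (box i).chart.source := fun y => by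
    obtain ⟨i, hi, hy⟩ := mem_iUnion₂.1 (hcov ▸ mem_univ y : y ∈ ⋃ x ∈ s, (box x).chart.source)
    exact ⟨⟨i, hi⟩, hy⟩
  have : Countable s := hs.to_subtype
  let P := Σ i : s, (box i).T
  let pl : P → Set M := fun p => (box p.1).plaque p.2
  let Adj : P → P → Prop := fun p q => (pl p ∩ pl q).Nonempty
  obtain ⟨⟨hSY, hSc, hSs⟩, hmin⟩ := hS
  obtain ⟨x₀, hx₀⟩ := hSc.nonempty
  obtain ⟨i₀, hi₀⟩ := hcover ⟨x₀, hSY hx₀⟩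
  let p₀ : P := ⟨i₀, ((box i₀).chart ⟨x₀, hSY hx₀⟩).2⟩
  have hxp₀ : x₀ ∈ pl p₀ := (box i₀).mem_plaque hi₀
  -- `R` consists of the plaques reached from one plaque of the leaf by finite chains of
  -- intersecting plaques of countably many boxes. A plaque has countably many neighbours, so `R` is
  -- countable. It remains to see that the union `F` of these plaques is the whole leaf.
  let R : Set P := {p | Relation.ReflTransGen Adj p₀ p}
  let F : Set M := ⋃ p ∈ R, pl p
  have hF : ∀ {x}, x ∈ F ↔ ∃ p ∈ R, x ∈ pl p := by simp [F]
  have hstep : ∀ p : P, {q | Adj p q}.Countable := fun p => by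
    have : {q | Adj p q} ⊆ ⋃ i : s, (fun t => (⟨i, t⟩ : P)) ''
        {t | ((box p.1).plaque p.2 ∩ (box i).plaque t).Nonempty} := by
      rintro ⟨i, t⟩ hq
      exact mem_iUnion.2 ⟨i, t, hq, rfl⟩
    exact (countable_iUnion fun i => ((L.compatible _ (hbox _) _ (hbox _)).countable_plaques
      p.2).image _).mono this
  have hR : R.Countable := by
    let Rn : ℕ → Set P := fun n => Nat.rec {p₀} (fun _ A => ⋃ p ∈ A, {q | Adj p q}) n
    have hRn : ∀ n, (Rn n).Countable := fun n => by
      induction n with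
      | zero => exact countable_singleton _
      | succ n ih => exact ih.biUnion fun p _ => hstep p
    refine (countable_iUnion hRn).mono fun p hp => ?_
    induction hp with
    | refl => exact mem_iUnion.2 ⟨0, rfl⟩
    | tail _ hbc ih =>
      obtain ⟨n, hn⟩ := mem_iUnion.1 ih
      exact mem_iUnion.2 ⟨n + 1, mem_iUnion₂.2 ⟨_, hn, hbc⟩⟩
  have hFS : F ⊆ S := by
    have : ∀ p ∈ R, pl p ⊆ S := by
      intro p hp
      induction hp with
      | refl => exact hSs _ (hbox _) _ ⟨x₀, hx₀, hxp₀⟩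
      | tail _ hbc ih =>
        obtain ⟨y, hy1, hy2⟩ := hbc
        exact hSs _ (hbox _) _ ⟨y, ih hy1, hy2⟩
    exact iUnion₂_subset this
  have hFpre : IsPreconnected F := by
    refine isPreconnected_of_forall x₀ fun y hy => ?_
    obtain ⟨p, hp, hyp⟩ := hF.1 hy
    have : ∃ C ⊆ F, x₀ ∈ C ∧ pl p ⊆ C ∧ IsPreconnected C := by
      clear hyp
      induction hp with
      | refl => exact ⟨pl p₀, fun y hy => hF.2 ⟨p₀, .refl, hy⟩, hxp₀, le_rfl,
          (box i₀).isPreconnected_plaque _⟩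
      | @tail b c hb hbc ih =>
        obtain ⟨C, hCF, hx, hbC, hC⟩ := ih
        obtain ⟨w, hw1, hw2⟩ := hbc
        refine ⟨C ∪ pl c, union_subset hCF fun y hy => hF.2 ⟨c, hb.tail ⟨w, hw1, hw2⟩, hy⟩,
          Or.inl hx, subset_union_right, ?_⟩
        exact hC.union w (hbC hw1) hw2 ((box c.1).isPreconnected_plaque _)
    obtain ⟨C, h1, h2, h3, h4⟩ := this
    exact ⟨C, h1, h2, h3 hyp, h4⟩
  have hFsat : L.IsSaturated F := by
    rintro B₁ hB₁ t ⟨_, hxF, ⟨z₁, hz₁, rfl⟩⟩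
    -- Near each of its points the plaque of `B₁` lies in a plaque of the countable family, and such
    -- a plaque is contained in `F` as soon as it meets `F`. So both `u` and its complement `v` in
    -- the disc are open, and connectedness decides.
    let u : Set ℂ := {z | z ∈ ball (0 : ℂ) 1 ∧ B₁.plaqueMap t z ∈ F}
    let v : Set ℂ := {z | z ∈ ball (0 : ℂ) 1 ∧ B₁.plaqueMap t z ∉ F}
    have hkey : ∀ z ∈ ball (0 : ℂ) 1, ∀ᶠ w in 𝓝 z, w ∈ ball (0 : ℂ) 1 ∧
        (B₁.plaqueMap t w ∈ F ↔ B₁.plaqueMap t z ∈ F) := by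
      intro z hz
      obtain ⟨i, hi⟩ := hcover (B₁.chart.symm (z, t))
      let q : P := ⟨i, ((box i).chart (B₁.chart.symm (z, t))).2⟩
      have hzq : B₁.plaqueMap t z ∈ pl q := (box i).mem_plaque hi
      filter_upwards [L.eventually_mem_plaque hB₁ (hbox i) t hz hi] with w hw
      refine ⟨hw.1, ?_⟩
      have hwq : B₁.plaqueMap t w ∈ pl q := hw.2
      constructor
      · intro h
        obtain ⟨p, hp, hwp⟩ := hF.1 h
        exact hF.2 ⟨q, hp.tail ⟨_, hwp, hwq⟩, hzq⟩
      · intro h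
        obtain ⟨p, hp, hzp⟩ := hF.1 h
        exact hF.2 ⟨q, hp.tail ⟨_, hzp, hzq⟩, hwq⟩
    have hu : IsOpen u := isOpen_iff_mem_nhds.2 fun z hz =>
      (hkey z hz.1).mono fun w hw => ⟨hw.1, hw.2.2 hz.2⟩
    have hv : IsOpen v := isOpen_iff_mem_nhds.2 fun z hz =>
      (hkey z hz.1).mono fun w hw => ⟨hw.1, fun h => hz.2 (hw.2.1 h)⟩
    have hsub := IsPreconnected.subset_left_of_subset_union hu hv
      (disjoint_left.2 fun z hz hz' => hz'.2 hz.2)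
      (fun z hz => (em (B₁.plaqueMap t z ∈ F)).imp (fun h => ⟨hz, h⟩) fun h => ⟨hz, h⟩)
      ⟨z₁, hz₁, hz₁, hxF⟩ (convex_ball (0 : ℂ) 1).isPreconnected
    rintro _ ⟨z, hz, rfl⟩
    exact (hsub hz).2
  -- `F` is a connected saturated subset of the leaf, so minimality of the leaf gives equality.
  have hSF : S ⊆ F := hmin ⟨hFS.trans hSY, ⟨⟨x₀, hF.2 ⟨p₀, .refl, hxp₀⟩⟩, hFpre⟩, hFsat⟩ hFS
  have hsub : {t : B.T | (S ∩ B.plaque t).Nonempty} ⊆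
      ⋃ p ∈ R, {t | ((box p.1).plaque p.2 ∩ B.plaque t).Nonempty} := by
    rintro t ⟨x, hxS, hxt⟩
    obtain ⟨p, hp, hxp⟩ := hF.1 (hSF hxS)
    exact mem_iUnion₂.2 ⟨p, hp, x, hxp, hxt⟩
  exact (hR.biUnion fun p _ => (L.compatible _ (hbox _) B hB).countable_plaques p.2).mono hsub

end SingularLamination

/-! ### Flow box coordinates as functions on the manifold -/

namespace FlowBox

variable {Y : Set M} (B : FlowBox E Y) [Nonempty B.T]

open Classical in
/-- The coordinates of a flow box, as a function on the manifold. -/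
def coord (x : M) : ℂ × B.T :=
  if h : x ∈ Y then B.chart ⟨x, h⟩ else (0, Classical.arbitrary B.T)

lemma coord_coe (y : Y) : B.coord y = B.chart y := by simp [coord]

lemma coord_fst_mem {x : M} (hx : x ∈ B.domain) : (B.coord x).1 ∈ ball (0 : ℂ) 1 := by
  obtain ⟨y, hy, rfl⟩ := hx
  rw [B.coord_coe]
  exact B.chart_fst_mem hy

lemma plaqueMap_coord {x : M} (hx : x ∈ B.domain) :
    B.plaqueMap (B.coord x).2 (B.coord x).1 = x := by
  obtain ⟨y, hy, rfl⟩ := hx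
  rw [B.coord_coe]
  change ((B.chart.symm ((B.chart y).1, (B.chart y).2) : Y) : M) = y
  rw [Prod.mk.eta, B.chart.left_inv hy]

omit [Nonempty B.T] in
lemma plaqueMap_mem_domain (t : B.T) {z : ℂ} (hz : z ∈ ball (0 : ℂ) 1) :
    B.plaqueMap t z ∈ B.domain := ⟨_, B.symm_mem_source t hz, rfl⟩

lemma coord_plaqueMap (t : B.T) {z : ℂ} (hz : z ∈ ball (0 : ℂ) 1) :
    B.coord (B.plaqueMap t z) = (z, t) := by
  rw [plaqueMap, B.coord_coe, B.chart_symm t hz]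

lemma continuousOn_coord : ContinuousOn B.coord B.domain := by
  rintro _ ⟨y, hy, rfl⟩
  unfold ContinuousWithinAt domain
  rw [← IsEmbedding.subtypeVal.map_nhdsWithin_eq, tendsto_map'_iff, coord_coe]
  exact (B.chart.continuousOn y hy).tendsto.congr fun w => (B.coord_coe w).symm

omit [Nonempty B.T] in
lemma continuousOn_uncurry_plaqueMap :
    ContinuousOn (fun p : ℂ × B.T => B.plaqueMap p.2 p.1) (ball 0 1 ×ˢ univ) := by
  rw [← B.target_eq]
  exact continuous_subtype_val.comp_continuousOn B.chart.continuousOn_symm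

omit [Nonempty B.T] in
/-- The domain of a flow box is relatively open. -/
lemma exists_isOpen_domain {L : SingularLamination E M} (B : FlowBox E L.Y) :
    ∃ O : Set M, IsOpen O ∧ B.domain = L.X ∩ O := by
  obtain ⟨O, hO, hOs⟩ := isOpen_induced_iff.1 B.chart.open_source
  -- Removing the closed singular set forces the remaining points of X to lie in Y.
  refine ⟨O ∩ (closure L.Y \ L.Y)ᶜ, hO.inter L.isClosed_sing.isOpen_compl, ?_⟩
  ext x
  constructor
  · rintro ⟨y, hy, rfl⟩
    rw [← hOs] at hy
    exact ⟨subset_closure y.2, hy, fun h => h.2 y.2⟩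
  · rintro ⟨hx, hxO, hxs⟩
    have hxY : x ∈ L.Y := by
      by_contra h
      exact hxs ⟨hx, h⟩
    refine ⟨⟨x, hxY⟩, ?_, rfl⟩
    rw [← hOs]
    exact hxO

end FlowBox

end FlowBoxes

/-! ### Holomorphic functions depending on a parameter, and lifting through immersions. -/

section HolomorphicFamilies

/-- Derivatives of a continuous family of holomorphic functions depend continuously on the
parameter. -/
lemma continuousOn_deriv_family {T E : Type*} [TopologicalSpace T] [NormedAddCommGroup E]
    [NormedSpace ℂ E] [CompleteSpace E] {G : T × ℂ → E} {W : Set (T × ℂ)} (hW : IsOpen W)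
    (hG : ContinuousOn G W)
    (hd : ∀ p ∈ W, DifferentiableAt ℂ (fun z => G (p.1, z)) p.2) :
    ContinuousOn (fun p : T × ℂ => deriv (fun z => G (p.1, z)) p.2) W := by
  rintro ⟨t₀, z₀⟩ h₀
  refine ContinuousAt.continuousWithinAt ?_
  obtain ⟨A, hA, B, hB, hAB⟩ := mem_nhds_prod_iff.1 (hW.mem_nhds h₀)
  obtain ⟨R₀, hR₀, hRB⟩ := nhds_basis_closedBall.mem_iff.1 hB
  set R : ℝ := R₀ / 2 with hR
  have hRpos : 0 < R := half_pos hR₀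
  have hmem : ∀ t ∈ A, ∀ z ∈ closedBall z₀ (2 * R), (t, z) ∈ W := fun t ht z hz =>
    hAB ⟨ht, hRB (by rw [hR] at hz; convert hz using 2; ring)⟩
  have ht₀ : t₀ ∈ A := mem_of_mem_nhds hA
  have hslice : ContinuousAt (fun z => deriv (fun z => G (t₀, z)) z) z₀ := by
    have : DifferentiableOn ℂ (fun z => G (t₀, z)) (ball z₀ (2 * R)) := fun z hz =>
      (hd (t₀, z) (hmem t₀ ht₀ z (ball_subset_closedBall hz))).differentiableWithinAt
    exact (this.deriv isOpen_ball).continuousOn.continuousAt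
      (isOpen_ball.mem_nhds (mem_ball_self (by positivity)))
  rw [Metric.continuousAt_iff'] at hslice ⊢
  intro ε hε
  -- Compactness makes the slices uniformly close on the disc of radius 2R. Cauchy's estimate on
  -- discs of radius R inside it divides the error ε/2 · R by R.
  have hclose : ∀ᶠ t in 𝓝 t₀, ∀ z ∈ closedBall z₀ (2 * R),
      dist (G (t, z)) (G (t₀, z)) < ε / 2 * R := by
    refine (isCompact_closedBall z₀ (2 * R)).eventually_forall_of_forall_eventually fun z hz => ?_
    have hc : ContinuousAt (fun p : T × ℂ => dist (G p) (G (t₀, p.2))) (t₀, z) := by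
      have h1 : ContinuousAt G (t₀, z) := hG.continuousAt (hW.mem_nhds (hmem t₀ ht₀ z hz))
      exact h1.dist (ContinuousAt.comp (x := ((t₀, z) : T × ℂ))
        (f := fun p : T × ℂ => (t₀, p.2)) h1 (by fun_prop))
    exact hc.eventually (gt_mem_nhds (by simp; positivity))
  have key : ∀ᶠ p : T × ℂ in 𝓝 (t₀, z₀), dist (deriv (fun z => G (p.1, z)) p.2)
      (deriv (fun z => G (t₀, z)) p.2) ≤ ε / 2 := by
    rw [nhds_prod_eq]
    filter_upwards [(hclose.and hA).prod_inl (𝓝 z₀),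
      Eventually.prod_inr (ball_mem_nhds z₀ hRpos) (𝓝 t₀)] with p hp1 hp2
    have hsub : closedBall p.2 R ⊆ closedBall z₀ (2 * R) := fun z hz => by
      have h1 : dist z p.2 ≤ R := hz
      have h2 : dist p.2 z₀ < R := hp2
      have := dist_triangle z p.2 z₀
      change dist z z₀ ≤ 2 * R
      linarith
    have hd1 : ∀ t ∈ A, ∀ z ∈ closedBall p.2 R, DifferentiableAt ℂ (fun z => G (t, z)) z :=
      fun t ht z hz => hd (t, z) (hmem t ht z (hsub hz))
    have hc : closure (ball p.2 R) ⊆ closedBall p.2 R := closure_ball_subset_closedBall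
    have := Complex.norm_deriv_le_of_forall_mem_sphere_norm_le (c := p.2) (R := R)
      (C := ε / 2 * R) (f := fun z => G (p.1, z) - G (t₀, z)) hRpos
      ⟨fun z hz => ((hd1 _ hp1.2 z (hc (subset_closure hz))).sub
          (hd1 _ ht₀ z (hc (subset_closure hz)))).differentiableWithinAt,
        fun z hz => ((hd1 _ hp1.2 z (hc hz)).sub
          (hd1 _ ht₀ z (hc hz))).continuousAt.continuousWithinAt⟩
      fun z hz => by
        rw [← dist_eq_norm]
        exact (hp1.1 z (hsub (sphere_subset_closedBall hz))).le
    rw [mul_div_cancel_right₀ _ hRpos.ne',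
      deriv_fun_sub (hd1 _ hp1.2 _ (mem_closedBall_self hRpos.le))
        (hd1 _ ht₀ _ (mem_closedBall_self hRpos.le)), ← dist_eq_norm] at this
    exact this
  have hs : ∀ᶠ p : T × ℂ in 𝓝 (t₀, z₀), dist (deriv (fun z => G (t₀, z)) p.2)
      (deriv (fun z => G (t₀, z)) z₀) < ε / 2 :=
    (continuous_snd.tendsto (t₀, z₀)).eventually (hslice (ε / 2) (half_pos hε))
  filter_upwards [key, hs] with p h1 h2
  have := dist_triangle (deriv (fun z => G (p.1, z)) p.2) (deriv (fun z => G (t₀, z)) p.2)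
    (deriv (fun z => G (t₀, z)) z₀)
  linarith

/-- A continuous function is holomorphic if its composition with an immersion is. -/
lemma differentiableAt_of_comp_immersion {E : Type*} [NormedAddCommGroup E] [NormedSpace ℂ E]
    {G : ℂ → E} {f : ℂ → ℂ} {ζ : ℂ} (hG : ∀ᶠ z in 𝓝 (f ζ), DifferentiableAt ℂ G z)
    (hG' : deriv G (f ζ) ≠ 0) (hf : ContinuousAt f ζ)
    (h : DifferentiableAt ℂ (fun ξ => G (f ξ)) ζ) : DifferentiableAt ℂ f ζ := by
  -- A functional that does not vanish on the derivative reduces the claim to one variable, where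
  -- the holomorphic inverse function theorem recovers f from l ∘ G ∘ f.
  obtain ⟨l, hl⟩ := SeparatingDual.exists_ne_zero (R := ℂ) hG'
  set k : ℂ → ℂ := fun z => l (G z) with hk
  have hkd : ∀ᶠ z in 𝓝 (f ζ), DifferentiableAt ℂ k z :=
    hG.mono fun z hz => l.differentiableAt.comp z hz
  have hk' : deriv k (f ζ) = l (deriv G (f ζ)) :=
    (l.hasFDerivAt.comp_hasDerivAt (f ζ) hG.self_of_nhds.hasDerivAt).deriv
  have han : AnalyticAt ℂ k (f ζ) := Complex.analyticAt_iff_eventually_differentiableAt.2 hkd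
  have hs : HasStrictDerivAt k (deriv k (f ζ)) (f ζ) := han.hasStrictDerivAt
  have hne : deriv k (f ζ) ≠ 0 := hk' ▸ hl
  have hleft := hs.eventually_left_inverse hne
  have hinv := (hs.to_localInverse hne).hasDerivAt.differentiableAt
  have hkf : DifferentiableAt ℂ (fun ξ => k (f ξ)) ζ := l.differentiableAt.comp ζ h
  refine (hinv.comp ζ hkf).congr_of_eventuallyEq ?_
  filter_upwards [hf.eventually hleft] with ξ hξ
  exact hξ.symm

end HolomorphicFamilies

/-! ### Directed maps in flow box coordinates. -/

section PlaqueCoordinates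

variable {E : Type*} [NormedAddCommGroup E] [NormedSpace ℂ E]
variable {M : Type u} [TopologicalSpace M] [ChartedSpace E M]

namespace FlowBox

variable {Y : Set M} (B : FlowBox E Y)

lemma mdifferentiableAt_plaqueMap (t : B.T) {z : ℂ} (hz : z ∈ ball (0 : ℂ) 1) :
    MDifferentiableAt 𝓘(ℂ) 𝓘(ℂ, E) (B.plaqueMap t) z :=
  (B.holomorphic t).mdifferentiableAt (isOpen_ball.mem_nhds hz)

lemma normSq_velocity_plaqueMap_pos (g : HermitianMetric E M) (t : B.T) {z : ℂ}
    (hz : z ∈ ball (0 : ℂ) 1) : 0 < g.normSq (velocity (B.plaqueMap t) z) :=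
  g.pos _ _ (B.immersive t z hz)

variable [FiniteDimensional ℂ E] [IsManifold 𝓘(ℂ, E) ω M]

/-- The pullbacks of a smooth form to the plaques depend continuously on the plaque. -/
lemma continuousOn_pullback_plaqueMap (θ : Form11 E M) :
    ContinuousOn (fun p : B.T × ℂ => pullback (B.plaqueMap p.1) θ p.2) (univ ×ˢ ball 0 1) := by
  have : CompleteSpace E := FiniteDimensional.complete ℂ E
  rintro ⟨t₀, z₀⟩ ⟨-, hz₀⟩
  set e := chartAt E (B.plaqueMap t₀ z₀)
  have he : e ∈ atlas E M := chart_mem_atlas E _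
  have hP : ContinuousOn (fun p : B.T × ℂ => B.plaqueMap p.1 p.2) (univ ×ˢ ball 0 1) :=
    B.continuousOn_uncurry_plaqueMap.comp continuous_swap.continuousOn fun p hp => ⟨hp.2, hp.1⟩
  set W : Set (B.T × ℂ) := (univ ×ˢ ball (0 : ℂ) 1) ∩
    (fun p : B.T × ℂ => B.plaqueMap p.1 p.2) ⁻¹' e.source
  have hW : IsOpen W := hP.isOpen_inter_preimage (isOpen_univ.prod isOpen_ball) e.open_source
  have hmem : (t₀, z₀) ∈ W := ⟨⟨mem_univ _, hz₀⟩, mem_chart_source E _⟩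
  have hG : ContinuousOn (fun p : B.T × ℂ => e (B.plaqueMap p.1 p.2)) W :=
    e.continuousOn.comp (hP.mono inter_subset_left) fun p hp => hp.2
  have hD := continuousOn_deriv_family hW hG fun p hp =>
    differentiableAt_chart_comp he (B.mdifferentiableAt_plaqueMap p.1 hp.1.2) hp.2
  have h := (continuousOn_coeff11 he θ).comp (hG.prodMk hD)
    fun p hp => ⟨e.map_source hp.2, mem_univ _⟩
  refine ContinuousAt.continuousWithinAt ?_
  refine (h.continuousAt (hW.mem_nhds hmem)).congr ?_
  filter_upwards [hW.mem_nhds hmem] with p hp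
  exact (pullback_eq_coeff11 θ he (B.mdifferentiableAt_plaqueMap p.1 hp.1.2) hp.2).symm

lemma continuousOn_normSq_velocity_plaqueMap (g : HermitianMetric E M) :
    ContinuousOn (fun p : B.T × ℂ => g.normSq (velocity (B.plaqueMap p.1) p.2))
      (univ ×ˢ ball 0 1) :=
  Complex.continuous_re.comp_continuousOn (B.continuousOn_pullback_plaqueMap g.form)

end FlowBox

variable {L : SingularLamination E M} {B : FlowBox E L.Y} {φ : ℂ → M}

lemma isOpen_preimage_domain (hφ : ContinuousOn φ (ball 0 1))
    (hX : MapsTo φ (ball 0 1) L.X) : IsOpen (ball (0 : ℂ) 1 ∩ φ ⁻¹' B.domain) := by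
  obtain ⟨O, hO, hBO⟩ := B.exists_isOpen_domain
  have : ball (0 : ℂ) 1 ∩ φ ⁻¹' B.domain = ball (0 : ℂ) 1 ∩ φ ⁻¹' O := by
    ext ζ
    rw [hBO]
    exact ⟨fun h => ⟨h.1, h.2.2⟩, fun h => ⟨h.1, hX h.1, h.2⟩⟩
  rw [this]
  exact hφ.isOpen_inter_preimage isOpen_ball hO

variable [Nonempty B.T]

lemma continuousAt_coord_comp (hφ : ContinuousOn φ (ball 0 1)) (hX : MapsTo φ (ball 0 1) L.X)
    {ζ : ℂ} (hζ : ζ ∈ ball (0 : ℂ) 1 ∩ φ ⁻¹' B.domain) :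
    ContinuousAt (fun ξ => B.coord (φ ξ)) ζ :=
  (B.continuousOn_coord.comp (hφ.mono inter_subset_left) fun _ h => h.2).continuousAt
    ((isOpen_preimage_domain hφ hX).mem_nhds hζ)

/-- A directed map stays locally in one plaque. -/
lemma eventually_transversal_eq [TopologicalSpace.MetrizableSpace M] [SecondCountableTopology M]
    (hB : B ∈ L.boxes) (hφ : ContinuousOn φ (ball 0 1)) (hdir : L.IsDirectedMap φ) {ζ : ℂ}
    (hζ : ζ ∈ ball (0 : ℂ) 1 ∩ φ ⁻¹' B.domain) :
    ∀ᶠ ξ in 𝓝 ζ, ξ ∈ ball (0 : ℂ) 1 ∩ φ ⁻¹' B.domain ∧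
      (B.coord (φ ξ)).2 = (B.coord (φ ζ)).2 := by
  have : TopologicalSpace.MetrizableSpace B.T := B.metrizableSpace_transversal
  let : MetricSpace B.T := TopologicalSpace.metrizableSpaceMetric B.T
  have hU := isOpen_preimage_domain (B := B) hφ hdir.1
  have hY : φ ζ ∉ L.sing := by
    obtain ⟨y, -, hy⟩ := hζ.2
    rw [← hy]
    exact fun h => h.2 y.2
  obtain ⟨S, hS, hev⟩ := hdir.2 ζ hζ.1 hY
  obtain ⟨ε, hε, hball⟩ := Metric.mem_nhds_iff.1 (inter_mem (hU.mem_nhds hζ) hev)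
  -- The transversal coordinate of φ maps a small ball onto a connected subset of a countable set,
  -- by `IsLeaf.countable_plaques`. Countable subsets of a metric space are totally disconnected, so
  -- the coordinate is constant there.
  have hpre : IsPreconnected ((fun ξ => (B.coord (φ ξ)).2) '' ball ζ ε) :=
    (convex_ball ζ ε).isPreconnected.image _ fun ξ hξ =>
      (continuous_snd.continuousAt.comp
        (continuousAt_coord_comp hφ hdir.1 (hball hξ).1)).continuousWithinAt
  have hsub := (hS.countable_plaques L hB).isTotallyDisconnected _ (by
    rintro _ ⟨ξ, hξ, rfl⟩
    refine ⟨φ ξ, (hball hξ).2, (B.coord (φ ξ)).1, B.coord_fst_mem (hball hξ).1.2, ?_⟩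
    exact B.plaqueMap_coord (hball hξ).1.2) hpre
  filter_upwards [ball_mem_nhds ζ hε] with ξ hξ
  exact ⟨(hball hξ).1, hsub (mem_image_of_mem _ hξ) (mem_image_of_mem _ (mem_ball_self hε))⟩

variable [IsManifold 𝓘(ℂ, E) ω M]

/-- The holomorphy of a directed map in flow box coordinates, and its pullback of forms. -/
lemma directed_coord [TopologicalSpace.MetrizableSpace M] [SecondCountableTopology M]
    (hB : B ∈ L.boxes) (hφ : MDifferentiableOn 𝓘(ℂ) 𝓘(ℂ, E) φ (ball 0 1))
    (hdir : L.IsDirectedMap φ) {ζ : ℂ} (hζ : ζ ∈ ball (0 : ℂ) 1 ∩ φ ⁻¹' B.domain) :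
    DifferentiableAt ℂ (fun ξ => (B.coord (φ ξ)).1) ζ ∧ ∀ θ : Form11 E M,
      pullback φ θ ζ = (‖deriv (fun ξ => (B.coord (φ ξ)).1) ζ‖ ^ 2 : ℝ) *
        pullback (B.plaqueMap (B.coord (φ ζ)).2) θ (B.coord (φ ζ)).1 := by
  set f : ℂ → ℂ := fun ξ => (B.coord (φ ξ)).1 with hf
  set t := (B.coord (φ ζ)).2 with ht
  -- Near ζ the map φ factors through one fixed plaque. Since the plaque is immersed, f inherits
  -- holomorphy from φ, and the chain rule gives the factor |f'|².
  have hev : ∀ᶠ ξ in 𝓝 ζ, B.plaqueMap t (f ξ) = φ ξ := by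
    filter_upwards [eventually_transversal_eq hB hφ.continuousOn hdir hζ] with ξ hξ
    rw [ht, ← hξ.2]
    exact B.plaqueMap_coord hξ.1.2
  have hφζ : MDifferentiableAt 𝓘(ℂ) 𝓘(ℂ, E) φ ζ :=
    hφ.mdifferentiableAt (isOpen_ball.mem_nhds hζ.1)
  set e := chartAt E (φ ζ)
  have he : e ∈ atlas E M := chart_mem_atlas E _
  have hsrc : φ ζ ∈ e.source := mem_chart_source E _
  have hfζ : f ζ ∈ ball (0 : ℂ) 1 := B.coord_fst_mem hζ.2
  have hpt : B.plaqueMap t (f ζ) = φ ζ := hev.self_of_nhds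
  have hcont : ContinuousAt f ζ :=
    continuous_fst.continuousAt.comp (continuousAt_coord_comp hφ.continuousOn hdir.1 hζ)
  set G : ℂ → E := fun z => e (B.plaqueMap t z)
  have hG : ∀ᶠ z in 𝓝 (f ζ), DifferentiableAt ℂ G z := by
    filter_upwards [isOpen_ball.mem_nhds hfζ,
      (B.mdifferentiableAt_plaqueMap t hfζ).continuousAt.preimage_mem_nhds
        (e.open_source.mem_nhds (hpt.symm ▸ hsrc))] with z hz hz'
    exact differentiableAt_chart_comp he (B.mdifferentiableAt_plaqueMap t hz) hz'
  have hG' : deriv G (f ζ) ≠ 0 := by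
    intro h0
    have h1 := apply_velocity (fun _ v => v = 0) he (B.mdifferentiableAt_plaqueMap t hfζ)
      (hpt.symm ▸ hsrc)
    have h2 : coordVec (M := M) e (e (B.plaqueMap t (f ζ))) 0 = 0 :=
      map_zero (mfderiv 𝓘(ℂ, E) 𝓘(ℂ, E) e.symm _)
    exact B.immersive t _ hfζ (h1.mpr (by rw [show deriv _ (f ζ) = (0 : E) from h0]; exact h2))
  have heq : (fun ξ => G (f ξ)) =ᶠ[𝓝 ζ] fun ξ => e (φ ξ) := by
    filter_upwards [hev] with ξ hξ
    change e (B.plaqueMap t (f ξ)) = _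
    rw [hξ]
  have hfd : DifferentiableAt ℂ f ζ := differentiableAt_of_comp_immersion hG hG' hcont
    ((differentiableAt_chart_comp he hφζ hsrc).congr_of_eventuallyEq heq)
  refine ⟨hfd, fun θ => ?_⟩
  rw [pullback_eq_coeff11 θ he hφζ hsrc, pullback_eq_coeff11 θ he
    (B.mdifferentiableAt_plaqueMap t hfζ) (hpt.symm ▸ hsrc), ← coeff11_smul]
  have hder : deriv (fun ξ => e (φ ξ)) ζ = deriv f ζ • deriv G (f ζ) := by
    rw [← heq.deriv_eq]
    exact (hG.self_of_nhds.hasDerivAt.scomp ζ hfd.hasDerivAt).deriv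
  rw [hder, hpt]

end PlaqueCoordinates

/-! ### Limits of positive functionals and tests for vanishing. -/

section GeneralMeasures

open scoped CompactlySupported

/-- A limit of positive contractive functionals on a compact space is given by a finite measure. -/
lemma exists_measure_of_positive_functionals {K ι : Type*} [TopologicalSpace K] [T2Space K]
    [CompactSpace K] [MeasurableSpace K] [BorelSpace K] (l : Ultrafilter ι)
    (Φ : ι → C(K, ℝ) → ℝ) (hadd : ∀ᶠ i in l, ∀ a b, Φ i (a + b) = Φ i a + Φ i b)
    (hsmul : ∀ᶠ i in l, ∀ (c : ℝ) a, Φ i (c • a) = c * Φ i a)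
    (hpos : ∀ᶠ i in l, ∀ a, 0 ≤ a → 0 ≤ Φ i a) (hbd : ∀ᶠ i in l, ∀ a, |Φ i a| ≤ ‖a‖) :
    ∃ σ : Measure K, IsFiniteMeasure σ ∧
      ∀ a : C(K, ℝ), Tendsto (fun i => Φ i a) l (𝓝 (∫ x, a x ∂σ)) := by
  -- The values on `a` lie eventually in a compact interval, so the ultrafilter has a limit there;
  -- no separability or subsequence is needed.
  have hlim : ∀ a, ∃ y, Tendsto (fun i => Φ i a) l (𝓝 y) := fun a => by
    obtain ⟨y, -, hy⟩ := (isCompact_closedBall (0 : ℝ) ‖a‖).ultrafilter_le_nhds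
      (l.map fun i => Φ i a) (le_principal_iff.2 (hbd.mono fun i h => by simpa using h a))
    exact ⟨y, hy⟩
  choose Ψ hΨ using hlim
  have hΨadd : ∀ a b, Ψ (a + b) = Ψ a + Ψ b := fun a b =>
    tendsto_nhds_unique (hΨ (a + b))
      (((hΨ a).add (hΨ b)).congr' (hadd.mono fun i h => (h a b).symm))
  have hΨsmul : ∀ (c : ℝ) a, Ψ (c • a) = c * Ψ a := fun c a =>
    tendsto_nhds_unique (hΨ (c • a))
      (((hΨ a).const_mul c).congr' (hsmul.mono fun i h => (h c a).symm))
  have hΨpos : ∀ a, 0 ≤ a → 0 ≤ Ψ a := fun a ha =>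
    ge_of_tendsto (hΨ a) (hpos.mono fun i h => h a ha)
  let Ψc : C_c(K, ℝ) →ₗ[ℝ] ℝ :=
    { toFun := fun a => Ψ a
      map_add' := fun a b => hΨadd a b
      map_smul' := fun c a => hΨsmul c a }
  let P : C_c(K, ℝ) →ₚ[ℝ] ℝ := PositiveLinearMap.mk₀ Ψc fun a ha => hΨpos a ha
  refine ⟨RealRMK.rieszMeasure P, inferInstance, fun a => ?_⟩
  have := RealRMK.integral_rieszMeasure P (CompactlySupportedContinuousMap.continuousMapEquiv a)
  change ∫ x, a x ∂_ = Ψ a at this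
  rw [this]
  exact hΨ a

/-- A locally integrable function vanishes almost everywhere if its integrals against continuous
functions with compact support do. -/
lemma ae_eq_zero_of_integral_continuous_mul {T : Type*} [TopologicalSpace T]
    [TopologicalSpace.MetrizableSpace T] [LocallyCompactSpace T] [SecondCountableTopology T]
    [MeasurableSpace T] [BorelSpace T] {μ : Measure T} {H : T → ℝ} (hH : LocallyIntegrable H μ)
    (h : ∀ α : T → ℝ, Continuous α → HasCompactSupport α → ∫ t, α t * H t ∂μ = 0) :
    H =ᵐ[μ] 0 := by
  let : MetricSpace T := TopologicalSpace.metrizableSpaceMetric T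
  refine ae_eq_zero_of_forall_setIntegral_isCompact_eq_zero' hH fun s hs => ?_
  obtain ⟨β, hβ1, -, hβs, hβ⟩ := exists_continuous_one_zero_of_isCompact hs isClosed_empty
    (disjoint_empty s)
  -- Thickened indicators approximate the indicator of the compact set `s`. The factor β, equal to 1
  -- on `s`, gives compact support and hence an integrable dominating function.
  set δ : ℕ → ℝ := fun n => 1 / ((n : ℝ) + 1)
  have hδ : ∀ n, 0 < δ n := fun n => by positivity
  set α : ℕ → T → ℝ := fun n t => β t * (thickenedIndicator (hδ n) s t : ℝ)
  have hα : ∀ n, Continuous (α n) := fun n => by fun_prop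
  have hint : Integrable (fun t => β t * H t) μ :=
    hH.integrable_smul_left_of_hasCompactSupport β.continuous hβs
  have hlim := tendsto_integral_of_dominated_convergence (μ := μ)
    (F := fun n t => α n t * H t) (f := s.indicator H) (fun t => ‖β t * H t‖)
    (fun n => (hα n).aestronglyMeasurable.mul hH.aestronglyMeasurable) hint.norm
    (fun n => ae_of_all _ fun t => by
      have h1 : ‖(thickenedIndicator (hδ n) s t : ℝ)‖ ≤ 1 := by
        rw [Real.norm_of_nonneg NNReal.zero_le_coe]
        exact_mod_cast thickenedIndicator_le_one (hδ n) s t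
      calc ‖α n t * H t‖ = ‖(thickenedIndicator (hδ n) s t : ℝ)‖ * ‖β t * H t‖ := by
            simp only [α, norm_mul]; ring
        _ ≤ 1 * ‖β t * H t‖ := by gcongr
        _ = _ := one_mul _)
    (ae_of_all _ fun t => by
      have := tendsto_pi_nhds.1 (thickenedIndicator_tendsto_indicator_closure hδ
        tendsto_one_div_add_atTop_nhds_zero_nat s) t
      rw [hs.isClosed.closure_eq] at this
      have h2 := (((NNReal.continuous_coe.tendsto _).comp this).const_mul (β t)).mul_const (H t)
      have e : s.indicator H t =
          β t * ((s.indicator (fun _ => (1 : NNReal)) t : NNReal) : ℝ) * H t := by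
        by_cases ht : t ∈ s
        · simp [ht, hβ1 ht]
        · simp [ht]
      rw [e]
      exact h2)
  have h0 : ∀ n, ∫ t, α n t * H t ∂μ = 0 := fun n => h _ (hα n) hβs.mul_right
  simp only [h0] at hlim
  rw [← integral_indicator hs.measurableSet]
  exact (tendsto_nhds_unique hlim tendsto_const_nhds)

/-- Extension by zero of a continuous function whose support is closed. -/
lemma continuous_indicator_of_support {X F : Type*} [TopologicalSpace X] [TopologicalSpace F]
    [Zero F] {f : X → F} {U K : Set X} (hU : IsOpen U) (hK : IsClosed K) (hKU : K ⊆ U)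
    (hf : ContinuousOn f U) (h0 : ∀ x ∈ U, x ∉ K → f x = 0) : Continuous (U.indicator f) := by
  refine continuous_iff_continuousAt.2 fun x => ?_
  by_cases hx : x ∈ U
  · refine (hf.continuousAt (hU.mem_nhds hx)).congr ?_
    filter_upwards [hU.mem_nhds hx] with y hy
    rw [indicator_of_mem hy]
  · refine (continuousAt_const (y := (0 : F))).congr ?_
    filter_upwards [hK.isOpen_compl.mem_nhds fun h => hx (hKU h)] with y hy
    by_cases hyU : y ∈ U
    · rw [indicator_of_mem hyU, h0 y hyU hy]
    · rw [indicator_of_notMem hyU]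

lemma contDiff_lap {u : ℂ → ℝ} (hu : ContDiff ℝ ∞ u) : ContDiff ℝ ∞ (lap u) := by
  have h : ContDiff ℝ ∞ (fderiv ℝ (fderiv ℝ u)) :=
    (hu.fderiv_right (m := ∞) (by simp)).fderiv_right (by simp)
  exact ((h.clm_apply contDiff_const).clm_apply contDiff_const).add
    ((h.clm_apply contDiff_const).clm_apply contDiff_const)

lemma lap_clm_comp {F G : Type*} [NormedAddCommGroup F] [NormedSpace ℝ F] [NormedAddCommGroup G]
    [NormedSpace ℝ G] (A : F →L[ℝ] G) {u : ℂ → F} (hu : ContDiff ℝ 2 u) (z : ℂ) :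
    lap (fun y => A (u y)) z = A (lap u z) := by
  have h1 : fderiv ℝ (fun y => A (u y)) = fun y => A.comp (fderiv ℝ u y) := funext fun y =>
    (A.hasFDerivAt.comp y ((hu.differentiable (by norm_num)) y).hasFDerivAt).fderiv
  have hd : Differentiable ℝ (fderiv ℝ u) :=
    (hu.fderiv_right (m := 1) (by norm_num)).differentiable (by norm_num)
  have h2 : ∀ a b : ℂ, fderiv ℝ (fun y => A.comp (fderiv ℝ u y)) z a b =
      A (fderiv ℝ (fderiv ℝ u) z a b) := fun a b => by
    have := ((ContinuousLinearMap.compL ℝ ℂ F G A).hasFDerivAt.comp z (hd z).hasFDerivAt).fderiv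
    exact congrArg (fun B : ℂ →L[ℝ] ℂ →L[ℝ] G => B a b) this
  unfold lap
  rw [h1, h2, h2, map_add]

/-- The weak harmonicity of a measure has to be tested for a dense set of mollifiers only. -/
lemma integral_lap_moll_eq_zero_of_dense {ν : Measure ℂ}
    (hfin : ∀ s : ℝ, s < 1 → ν (closedBall 0 s) < ⊤) {ε : ℝ} (hε : 0 < ε) {q : ℕ → ℂ}
    (hq : DenseRange q) (h : ∀ k, ‖q k‖ + ε < 1 → ∫ w, lap (moll ε) (q k - w) ∂ν = 0) {z : ℂ}
    (hz : ‖z‖ + ε < 1) : ∫ w, lap (moll ε) (z - w) ∂ν = 0 := by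
  obtain ⟨s, hs1, hs2⟩ := exists_between hz
  have : IsFiniteMeasure (ν.restrict (closedBall 0 s)) := ⟨by simpa using hfin s hs2⟩
  have hO : IsOpen {y : ℂ | ‖y‖ + ε < s} := isOpen_lt (by fun_prop) continuous_const
  have heq : ∀ y ∈ {y : ℂ | ‖y‖ + ε < s}, ∫ w, lap (moll ε) (y - w) ∂ν =
      ∫ w, lap (moll ε) (y - w) ∂ν.restrict (closedBall 0 s) := fun y hy => by
    refine (setIntegral_eq_integral_of_forall_compl_eq_zero fun w hw => ?_).symm
    refine lap_moll_eq_zero hε ?_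
    have h1 : s < ‖w‖ := by simpa using hw
    have := norm_sub_norm_le w y
    rw [norm_sub_rev] at this
    have h2 : ‖y‖ + ε < s := hy
    linarith
  have hcs : HasCompactSupport (lap (moll ε)) :=
    HasCompactSupport.of_support_subset_isCompact (isCompact_closedBall 0 ε) fun w hw => by
      by_contra hw'
      exact hw (lap_moll_eq_zero hε (by simpa using hw'))
  -- The integral depends continuously on the centre y, so a nonzero value would persist at some `q
  -- k`. Countably many tests are what an almost everywhere statement can afford.
  have hc : Continuous fun y => ∫ w, lap (moll ε) (y - w) ∂ν.restrict (closedBall 0 s) :=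
    continuous_iff_continuousAt.2 fun y => (hasFDerivAt_integral_comp_sub _
      ((contDiff_lap (contDiff_moll ε)).of_le (by simp)) hcs y).continuousAt
  rw [heq z hs1]
  by_contra hne
  obtain ⟨k, hk1, hk2⟩ := hq.exists_mem_open (hO.inter (isOpen_ne_fun hc continuous_const))
    ⟨z, hs1, hne⟩
  exact hk2 (by rw [← heq _ hk1]; exact h k (lt_trans hk1 hs2))

end GeneralMeasures

/-! ### Disintegration of a weakly harmonic measure into positive harmonic functions. -/

section Disintegration

open InnerProductSpace

variable {T : Type u} [TopologicalSpace T]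

/-- A function on `T × ℂ` that is continuous on `T × Δ` with support compact in `T × Δ`. -/
structure IsTest {F : Type*} [TopologicalSpace F] [Zero F] (P : T × ℂ → F) (K : Set (T × ℂ)) :
    Prop where
  continuousOn : ContinuousOn P (univ ×ˢ ball (0 : ℂ) 1)
  isCompact : IsCompact K
  subset : K ⊆ univ ×ˢ ball (0 : ℂ) 1
  eq_zero : ∀ p ∈ (univ : Set T) ×ˢ ball (0 : ℂ) 1, p ∉ K → P p = 0

namespace IsTest

variable {F : Type*} [NormedAddCommGroup F] {P : T × ℂ → F} {K : Set (T × ℂ)} (hP : IsTest P K)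

include hP

lemma slice [T2Space T] (t : T) : ∃ s < (1 : ℝ), (∀ z ∈ ball (0 : ℂ) 1, s < ‖z‖ → P (t, z) = 0) ∧
    Continuous ((ball (0 : ℂ) 1).indicator fun z => P (t, z)) := by
  have hc : Continuous fun z : ℂ => (t, z) := by fun_prop
  have hcl : IsClosed ((fun z : ℂ => (t, z)) ⁻¹' K) := hP.isCompact.isClosed.preimage hc
  have hsub : (fun z : ℂ => (t, z)) ⁻¹' K ⊆ ball 0 1 := fun z hz => (hP.subset hz).2
  obtain ⟨s, hs, hKs⟩ := exists_lt_subset_ball hcl hsub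
  refine ⟨s, hs, fun z hz hsz => hP.eq_zero _ ⟨mem_univ _, hz⟩ fun h => ?_, ?_⟩
  · have : ‖z‖ < s := by simpa using hKs h
    linarith
  · exact continuous_indicator_of_support isOpen_ball hcl hsub
      (hP.continuousOn.comp hc.continuousOn fun z hz => ⟨mem_univ _, hz⟩)
      fun z hz hzK => hP.eq_zero _ ⟨mem_univ _, hz⟩ hzK

lemma exists_bound : ∃ C, ∀ p, ‖((univ : Set T) ×ˢ ball (0 : ℂ) 1).indicator P p‖ ≤ C := by
  obtain ⟨C, hC⟩ := hP.isCompact.exists_bound_of_continuousOn (hP.continuousOn.mono hP.subset)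
  refine ⟨max C 0, fun p => ?_⟩
  by_cases hp : p ∈ (univ : Set T) ×ˢ ball (0 : ℂ) 1
  · rw [indicator_of_mem hp]
    by_cases hK : p ∈ K
    · exact (hC p hK).trans (le_max_left _ _)
    · rw [hP.eq_zero p hp hK, norm_zero]
      exact le_max_right _ _
  · rw [indicator_of_notMem hp, norm_zero]
    exact le_max_right _ _

variable [MeasurableSpace T] [BorelSpace T] [MeasurableSpace F] [BorelSpace F]

lemma measurable : Measurable (((univ : Set T) ×ˢ ball (0 : ℂ) 1).indicator P) := by
  classical
  rw [← piecewise_eq_indicator]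
  exact hP.continuousOn.measurable_piecewise continuousOn_const
    (MeasurableSet.univ.prod measurableSet_ball)

lemma integrable [SecondCountableTopology F] (ρ : Measure (T × ℂ)) [IsFiniteMeasure ρ] :
    Integrable (((univ : Set T) ×ˢ ball (0 : ℂ) 1).indicator P) ρ := by
  obtain ⟨C, hC⟩ := hP.exists_bound
  exact Integrable.of_bound hP.measurable.aestronglyMeasurable C (ae_of_all _ hC)

end IsTest

variable [TopologicalSpace.MetrizableSpace T] [LocallyCompactSpace T] [SecondCountableTopology T]
  [MeasurableSpace T] [BorelSpace T]

/-- A finite measure on `T × Δ` that is, up to the density `v`, weakly harmonic along the discs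
`{t} × Δ` disintegrates into positive harmonic functions. -/
theorem exists_harmonic_disintegration (ρ : Measure (T × ℂ)) [IsFiniteMeasure ρ] {v : T × ℂ → ℝ}
    (hv : ContinuousOn v (univ ×ˢ ball (0 : ℂ) 1)) (hv0 : ∀ p, 0 ≤ v p)
    (hharm : ∀ (α : T → ℝ) (ε : ℝ) (q : ℂ), Continuous α → HasCompactSupport α → 0 < ε →
      ‖q‖ + ε < 1 → ∫ p, ((univ : Set T) ×ˢ ball (0 : ℂ) 1).indicator
        (fun p => α p.1 * (v p * lap (moll ε) (q - p.2))) p ∂ρ = 0) :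
    ∃ (μ : Measure T) (h : T → ℂ → ℝ), IsFiniteMeasure μ ∧
      (∀ t, HarmonicOnNhd (h t) (ball 0 1)) ∧ (∀ t, ∀ z ∈ ball (0 : ℂ) 1, 0 < h t z) ∧
      (∀ z ∈ ball (0 : ℂ) 1, Measurable fun t => h t z) ∧
      ∀ (P : T × ℂ → ℂ) (K : Set (T × ℂ)), IsTest P K →
        (∀ t, IntegrableOn (fun z => (h t z : ℂ) * P (t, z)) (ball 0 1)) ∧
        Integrable (fun t => ∫ z in ball (0 : ℂ) 1, (h t z : ℂ) * P (t, z)) μ ∧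
        ∫ p, ((univ : Set T) ×ˢ ball (0 : ℂ) 1).indicator (fun p => (v p : ℂ) * P p) p ∂ρ =
          ∫ t, ∫ z in ball (0 : ℂ) 1, (h t z : ℂ) * P (t, z) ∂volume ∂μ := by
  classical
  set D : Set (T × ℂ) := (univ : Set T) ×ˢ ball (0 : ℂ) 1 with hD
  have hDm : MeasurableSet D := MeasurableSet.univ.prod measurableSet_ball
  set v' : T × ℂ → ℝ := D.indicator v with hv'
  have hv'm : Measurable v' := by
    rw [hv', ← piecewise_eq_indicator]
    exact hv.measurable_piecewise continuousOn_const hDm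
  have hv'0 : ∀ p, 0 ≤ v' p := fun p => indicator_nonneg (fun p _ => hv0 p) p
  set κ := ρ.condKernel with hκ
  -- The conditional measure weighted by v is the candidate for h_t times Lebesgue measure. It may
  -- be infinite near the unit circle, where v is not assumed bounded.
  set lam : T → Measure ℂ := fun t => (κ t).withDensity fun z => ENNReal.ofReal (v' (t, z))
    with hlam
  have hslice : ∀ t, Measurable fun z : ℂ => v' (t, z) := fun t => hv'm.comp (by fun_prop)
  have hint : ∀ {F : Type} [NormedAddCommGroup F] [NormedSpace ℝ F] (t : T) (f : ℂ → F),
      ∫ z, f z ∂lam t = ∫ z, v' (t, z) • f z ∂κ t := by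
    intro F _ _ t f
    rw [hlam, integral_withDensity_eq_integral_toReal_smul (hslice t).ennreal_ofReal
      (ae_of_all _ fun z => ENNReal.ofReal_lt_top)]
    refine integral_congr_ae (ae_of_all _ fun z => ?_)
    simp only
    rw [ENNReal.toReal_ofReal (hv'0 _)]
  have hbd : ∀ K : Set T, IsCompact K → ∀ s : ℝ, s < 1 → ∃ C, ∀ t ∈ K, ∀ z ∈ closedBall (0 : ℂ) s,
      v' (t, z) ≤ C := by
    intro K hK s hs
    have hsub : K ×ˢ closedBall (0 : ℂ) s ⊆ D :=
      prod_mono (subset_univ _) (closedBall_subset_ball hs)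
    obtain ⟨C, hC⟩ := (hK.prod (isCompact_closedBall (0 : ℂ) s)).exists_bound_of_continuousOn
      (hv.mono hsub)
    refine ⟨C, fun t ht z hz => ?_⟩
    rw [hv', indicator_of_mem (hsub ⟨ht, hz⟩)]
    exact (le_abs_self _).trans (hC (t, z) ⟨ht, hz⟩)
  have hfin : ∀ t, ∀ s : ℝ, s < 1 → lam t (closedBall 0 s) < ⊤ := by
    intro t s hs
    obtain ⟨C, hC⟩ := hbd {t} isCompact_singleton s hs
    rw [hlam]
    simp only
    rw [withDensity_apply _ measurableSet_closedBall]
    calc _ ≤ ∫⁻ _ in closedBall (0 : ℂ) s, ENNReal.ofReal C ∂κ t :=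
          setLIntegral_mono' measurableSet_closedBall fun z hz =>
            ENNReal.ofReal_le_ofReal (hC t rfl z hz)
      _ < ⊤ := by
        rw [setLIntegral_const]
        exact ENNReal.mul_lt_top ENNReal.ofReal_lt_top (measure_lt_top _ _)
  set ε : ℕ → ℝ := fun n => 1 / ((n : ℝ) + 1) with hεdef
  have hε : ∀ n, 0 < ε n := fun n => by positivity
  have hε0 : Tendsto ε atTop (𝓝 0) := tendsto_one_div_add_atTop_nhds_zero_nat
  set q : ℕ → ℂ := TopologicalSpace.denseSeq ℂ
  have hmeas : ∀ {f : ℂ → ℝ}, Continuous f → Measurable fun t => ∫ z, f z ∂lam t := by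
    intro f hf
    simp only [hint]
    have : StronglyMeasurable fun p : T × ℂ => v' p • f p.2 :=
      (hv'm.mul (hf.measurable.comp measurable_snd)).stronglyMeasurable
    exact (StronglyMeasurable.integral_kernel_prod_right' (κ := κ) this).measurable
  have hlapc : ∀ n, ∀ z, Continuous fun w => lap (moll (ε n)) (z - w) := fun n z =>
    (contDiff_lap (contDiff_moll _)).continuous.comp (by fun_prop)
  -- weak harmonicity on almost every disc
  set A₁ : Set T := {t | ∀ n k, ‖q k‖ + ε n < 1 → ∫ w, lap (moll (ε n)) (q k - w) ∂lam t = 0}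
    with hA₁
  have hA₁m : MeasurableSet A₁ := by
    simp only [hA₁, ofPred_forall]
    exact MeasurableSet.iInter fun n => MeasurableSet.iInter fun k => MeasurableSet.iInter
      fun _ => measurableSet_eq_fun (hmeas (hlapc n _)) measurable_const
  have hA₁ae : ∀ᵐ t ∂ρ.fst, t ∈ A₁ := by
    simp only [hA₁, mem_ofPred_eq]
    rw [ae_all_iff]; intro n
    rw [ae_all_iff]; intro k
    rw [ae_all_iff]; intro hnk
    obtain ⟨s, hs1, hs2⟩ := exists_between hnk
    obtain ⟨Cl, hCl⟩ := (isCompact_closedBall (0 : ℂ) s).exists_bound_of_continuousOn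
      (hlapc n (q k)).continuousOn
    have hoff : ∀ w : ℂ, s < ‖w‖ → lap (moll (ε n)) (q k - w) = 0 := fun w hw => by
      refine lap_moll_eq_zero (hε n) ?_
      have := norm_sub_norm_le w (q k)
      rw [norm_sub_rev] at this
      linarith
    -- For t in a compact set only the values of v on a compact subset of T × Δ enter, which bounds
    -- the integrals. Testing against compactly supported α then gives vanishing for almost every t.
    have hloc : LocallyIntegrable (fun t => ∫ w, lap (moll (ε n)) (q k - w) ∂lam t) ρ.fst := by
      rw [locallyIntegrable_iff]
      intro K hK
      obtain ⟨C, hC⟩ := hbd K hK s hs2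
      refine Measure.integrableOn_of_bounded (M := |C| * |Cl|) (measure_ne_top _ _)
        (hmeas (hlapc n (q k))).aestronglyMeasurable ?_
      refine (ae_restrict_iff' hK.measurableSet).2 (ae_of_all _ fun t ht => ?_)
      rw [hint]
      have : ∀ w, ‖v' (t, w) • lap (moll (ε n)) (q k - w)‖ ≤ |C| * |Cl| := fun w => by
        by_cases hw : s < ‖w‖
        · rw [hoff w hw, smul_zero, norm_zero]
          positivity
        · have hw' : w ∈ closedBall (0 : ℂ) s := by simpa using hw
          rw [norm_smul, Real.norm_of_nonneg (hv'0 _)]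
          exact mul_le_mul ((hC t ht w hw').trans (le_abs_self _))
            ((hCl w hw').trans (le_abs_self _)) (norm_nonneg _) (abs_nonneg _)
      simpa using norm_integral_le_of_norm_le_const (μ := κ t) (ae_of_all _ this)
    refine ae_eq_zero_of_integral_continuous_mul hloc fun α hα hαs => ?_
    have hT : IsTest (fun p : T × ℂ => α p.1 * (v p * lap (moll (ε n)) (q k - p.2)))
        (tsupport α ×ˢ closedBall (0 : ℂ) s) := by
      refine ⟨?_, hαs.prod (isCompact_closedBall _ _),
        prod_mono (subset_univ _) (closedBall_subset_ball hs2), fun p hp hpK => ?_⟩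
      · exact (hα.comp continuous_fst).continuousOn.mul
          (hv.mul ((hlapc n (q k)).comp continuous_snd).continuousOn)
      · by_cases h1 : p.1 ∈ tsupport α
        · have : s < ‖p.2‖ := by
            by_contra h2
            exact hpK ⟨h1, by simpa using h2⟩
          rw [hoff _ this, mul_zero, mul_zero]
        · rw [image_eq_zero_of_notMem_tsupport h1, zero_mul]
    rw [← hharm α (ε n) (q k) hα hαs (hε n) hnk, ← Measure.integral_condKernel (hT.integrable ρ)]
    refine integral_congr_ae (ae_of_all _ fun t => ?_)
    simp only
    rw [hint, ← integral_const_mul]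
    refine integral_congr_ae (ae_of_all _ fun z => ?_)
    simp only [hv']
    by_cases hz : (t, z) ∈ D
    · rw [indicator_of_mem hz, indicator_of_mem hz]
      simp
    · rw [indicator_of_notMem hz, indicator_of_notMem hz]
      simp
  -- the harmonic densities
  have hN : ∀ z : ℂ, ∃ n, z ∈ ball (0 : ℂ) 1 → ‖z‖ + ε n < 1 := fun z => by
    by_cases hz : z ∈ ball (0 : ℂ) 1
    · obtain ⟨n, hn⟩ := exists_nat_one_div_lt (show 0 < 1 - ‖z‖ by
        have : ‖z‖ < 1 := by simpa using hz
        linarith)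
      exact ⟨n, fun _ => by simp only [hεdef]; linarith⟩
    · exact ⟨0, fun h => absurd h hz⟩
  choose N hN using hN
  -- The radius depends on z alone, so for fixed z this is a kernel integral of a continuous
  -- function and measurable in t. `weyl` allows a radius that varies with z.
  set h₀ : T → ℂ → ℝ := fun t z => smooth (ε (N z)) (lam t) z with hh₀
  have hh₀m : ∀ z, Measurable fun t => h₀ t z := fun z =>
    hmeas ((continuous_moll _).comp (by fun_prop))
  have hweyl : ∀ t ∈ A₁, _ := fun t ht =>
    weyl (hfin t) hε hε0 (fun n z hz => integral_lap_moll_eq_zero_of_dense (hfin t) (hε n)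
      (TopologicalSpace.denseRange_denseSeq ℂ) (ht n) hz) (h := h₀ t)
      fun z hz => ⟨N z, hN z hz, rfl⟩
  -- On `A₁` the density is a nonnegative harmonic function, and it vanishes identically if it is
  -- zero at the centre. Such discs contribute nothing, so μ is restricted to `A`; off `A` the
  -- density is replaced by 1 to be positive and harmonic for every t.
  set A : Set T := A₁ ∩ {t | 0 < h₀ t 0} with hA
  have hAm : MeasurableSet A := hA₁m.inter (measurableSet_lt measurable_const (hh₀m 0))
  set h : T → ℂ → ℝ := fun t z => if t ∈ A then h₀ t z else 1 with hh
  have hhA : ∀ t ∈ A, h t = h₀ t := fun t ht => by funext z; simp only [hh, if_pos ht]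
  have hhA' : ∀ t ∉ A, h t = fun _ => 1 := fun t ht => by funext z; simp only [hh, if_neg ht]
  have hharmonic : ∀ t, HarmonicOnNhd (h t) (ball 0 1) := fun t => by
    by_cases ht : t ∈ A
    · rw [hhA t ht]
      exact (hweyl t ht.1).1
    · rw [hhA' t ht]
      exact fun z _ => harmonicAt_const _
  refine ⟨ρ.fst.restrict A, h, inferInstance, hharmonic, fun t z hz => ?_, fun z _ => ?_,
    fun P K hP => ?_⟩
  · by_cases ht : t ∈ A
    · rw [hhA t ht]
      refine lt_of_le_of_ne ((hweyl t ht.1).2.1 z hz) fun h0 => ?_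
      have := eq_zero_of_harmonic_nonneg (hweyl t ht.1).1 (hweyl t ht.1).2.1 hz h0.symm 0 (by simp)
      exact ht.2.ne' this
    · rw [hhA' t ht]
      exact one_pos
  · exact Measurable.ite hAm (hh₀m z) measurable_const
  have hvP : IsTest (fun p => (v p : ℂ) * P p) K :=
    ⟨(Complex.continuous_ofReal.comp_continuousOn hv).mul hP.continuousOn, hP.isCompact, hP.subset,
      fun p hp hpK => by rw [hP.eq_zero p hp hpK, mul_zero]⟩
  have hI : ∀ t, ∫ z, D.indicator (fun p => (v p : ℂ) * P p) (t, z) ∂κ t =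
      ∫ z, (ball (0 : ℂ) 1).indicator (fun z => P (t, z)) z ∂lam t := fun t => by
    rw [hint]
    refine integral_congr_ae (ae_of_all _ fun z => ?_)
    simp only [hv']
    by_cases hz : z ∈ ball (0 : ℂ) 1
    · rw [indicator_of_mem hz, indicator_of_mem (show (t, z) ∈ D from ⟨mem_univ _, hz⟩),
        indicator_of_mem (show (t, z) ∈ D from ⟨mem_univ _, hz⟩), Complex.real_smul]
    · rw [indicator_of_notMem hz, indicator_of_notMem (show (t, z) ∉ D from fun h => hz h.2),
        indicator_of_notMem (show (t, z) ∉ D from fun h => hz h.2), smul_zero]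
  have hI₁ : ∀ t ∈ A₁, ∫ z, (ball (0 : ℂ) 1).indicator (fun z => P (t, z)) z ∂lam t =
      ∫ z in ball (0 : ℂ) 1, (h₀ t z : ℂ) * P (t, z) := fun t ht => by
    obtain ⟨s, hs, hs0, hc⟩ := hP.slice t
    rw [(hweyl t ht).2.2 _ s hc hs fun z hz => by
      by_cases hzb : z ∈ ball (0 : ℂ) 1
      · rw [indicator_of_mem hzb, hs0 z hzb hz]
      · rw [indicator_of_notMem hzb]]
    exact setIntegral_congr_fun measurableSet_ball fun z hz => by rw [indicator_of_mem hz]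
  have hIA : ∀ t ∈ A, ∫ z, D.indicator (fun p => (v p : ℂ) * P p) (t, z) ∂κ t =
      ∫ z in ball (0 : ℂ) 1, (h t z : ℂ) * P (t, z) := fun t ht => by
    rw [hI, hI₁ t ht.1, hhA t ht]
  have hIA' : ∀ t ∈ A₁, t ∉ A →
      ∫ z, D.indicator (fun p => (v p : ℂ) * P p) (t, z) ∂κ t = 0 := fun t ht htA => by
    rw [hI, hI₁ t ht]
    refine setIntegral_eq_zero_of_forall_eq_zero fun z hz => ?_
    have h00 : h₀ t 0 = 0 := le_antisymm (not_lt.1 fun h0 => htA ⟨ht, h0⟩)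
      ((hweyl t ht).2.1 0 (by simp))
    rw [eq_zero_of_harmonic_nonneg (hweyl t ht).1 (hweyl t ht).2.1 (by simp) h00 z hz]
    simp
  have hintκ : Integrable (fun t => ∫ z, D.indicator (fun p => (v p : ℂ) * P p) (t, z) ∂κ t)
      ρ.fst := by
    exact (hvP.integrable ρ).integral_condKernel
  refine ⟨fun t => ?_, ?_, ?_⟩
  · obtain ⟨s, hs, hs0, hc⟩ := hP.slice t
    have hcont : ContinuousOn (fun z => (h t z : ℂ) * P (t, z)) (ball 0 1) := by
      refine ContinuousOn.mul (Complex.continuous_ofReal.comp_continuousOn fun z hz => ?_) ?_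
      · exact (hharmonic t z hz).1.continuousAt.continuousWithinAt
      · exact hP.continuousOn.comp (by fun_prop) fun z hz => ⟨mem_univ _, hz⟩
    have h1 : IntegrableOn (fun z => (h t z : ℂ) * P (t, z)) (closedBall 0 s) :=
      (hcont.mono (closedBall_subset_ball hs)).integrableOn_compact (isCompact_closedBall _ _)
    refine h1.of_forall_sdiff_eq_zero measurableSet_ball fun z hz => ?_
    rw [hs0 z hz.1 (by simpa using hz.2), mul_zero]
  · exact (hintκ.restrict (s := A)).congr ((ae_restrict_iff' hAm).2 (ae_of_all _ hIA))
  · rw [← Measure.integral_condKernel (hvP.integrable ρ), ← setIntegral_congr_fun hAm hIA]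
    refine (setIntegral_eq_integral_of_ae_compl_eq_zero ?_).symm
    filter_upwards [hA₁ae] with t ht htA
    exact hIA' t ht htA

end Disintegration

/-! ### Limits of the trace measures. -/

section LimitMeasures

open Real (posLog)

variable {E : Type*} [NormedAddCommGroup E] [NormedSpace ℂ E]
variable {M : Type u} [TopologicalSpace M] [ChartedSpace E M]

/-- The domain of the box is locally closed in M, hence locally compact, and the transversal through
z = 0 is a retract of it, hence closed in it. -/
lemma FlowBox.locallyCompactSpace_transversal [LocallyCompactSpace M] [T2Space M]
    {L : SingularLamination E M} (B : FlowBox E L.Y) : LocallyCompactSpace B.T := by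
  by_cases hT : Nonempty B.T
  swap
  · rw [not_nonempty_iff] at hT
    infer_instance
  obtain ⟨O, hO, hBO⟩ := B.exists_isOpen_domain
  have hlc : LocallyCompactSpace B.domain := by
    rw [hBO]
    exact (isClosed_closure.isLocallyClosed.inter hO.isLocallyClosed).locallyCompactSpace
  set c : B.T → B.domain := fun t => ⟨B.plaqueMap t 0, B.plaqueMap_mem_domain t (by simp)⟩
  set r : B.domain → B.T := fun x => (B.coord x).2
  have hrc : Function.LeftInverse r c := fun t => by
    change (B.coord (B.plaqueMap t 0)).2 = t
    rw [B.coord_plaqueMap t (by simp)]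
  have hr : Continuous r :=
    continuous_snd.comp (continuousOn_iff_continuous_domRestrict.1 B.continuousOn_coord)
  have hc : Continuous c := by
    refine Continuous.subtype_mk ?_ _
    exact B.continuousOn_uncurry_plaqueMap.comp_continuous (f := fun t : B.T => ((0 : ℂ), t))
      (by fun_prop) fun t => ⟨by simp, mem_univ _⟩
  exact (hrc.isClosedEmbedding hr hc).locallyCompactSpace

variable [FiniteDimensional ℂ E] [IsManifold 𝓘(ℂ, E) ω M]

variable {g : HermitianMetric E M} {φ : ℂ → M} {l : Ultrafilter ℝ} {T : Form11 E M → ℂ}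
  (h : IsDiscLimit g φ l T)

include h

/-- The trace measures of the normalized disc currents converge, as measures on a compact set that
contains the disc. -/
lemma IsDiscLimit.exists_trace_measure {A : Set M} [CompactSpace A] [T2Space A] [MeasurableSpace A]
    [BorelSpace A] {Φ : ℂ → A} (hΦ : ContinuousOn Φ (ball 0 1)) :
    ∃ σ : Measure A, IsFiniteMeasure σ ∧ ∀ F : A → ℂ, Continuous F →
      Tendsto (fun r => (∫ ζ in ball (0 : ℂ) 1, (posLog (r / ‖ζ‖) : ℂ) *
        ((g.normSq (velocity φ ζ) : ℂ) * F (Φ ζ))) / (mass g (discCurrent φ r) : ℂ)) l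
        (𝓝 (∫ x, F x ∂σ)) := by
  have hint : ∀ {r : ℝ}, 0 < r ∧ r < 1 → ∀ a : C(A, ℝ), IntegrableOn (fun ζ : ℂ =>
      posLog (r / ‖ζ‖) * g.normSq (velocity φ ζ) * a (Φ ζ)) (ball 0 1) := by
    intro r hr a
    refine (integrableOn_mass g h.mdifferentiableOn hr.1 hr.2).mul_bdd (c := ‖a‖)
      ((a.continuous.comp_continuousOn hΦ).aestronglyMeasurable measurableSet_ball)
      (ae_of_all _ fun ζ => a.norm_coe_le_norm _)
  set Ψ : ℝ → C(A, ℝ) → ℝ := fun r a => (∫ ζ in ball (0 : ℂ) 1,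
    posLog (r / ‖ζ‖) * g.normSq (velocity φ ζ) * a (Φ ζ)) / mass g (discCurrent φ r) with hΨ
  obtain ⟨σ, hσ, hlim⟩ := exists_measure_of_positive_functionals l Ψ
    (by
      filter_upwards [h.eventually_mem] with r hr a b
      simp only [hΨ]
      rw [← add_div, ← integral_add (hint hr a) (hint hr b)]
      congr 1
      refine integral_congr_ae (ae_of_all _ fun ζ => ?_)
      simp only [ContinuousMap.add_apply]
      ring)
    (by
      filter_upwards [h.eventually_mem] with r hr c a
      simp only [hΨ]
      rw [← mul_div_assoc, ← integral_const_mul]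
      congr 1
      refine integral_congr_ae (ae_of_all _ fun ζ => ?_)
      simp only [ContinuousMap.smul_apply, smul_eq_mul]
      ring)
    (Eventually.of_forall fun r a ha => div_nonneg (integral_nonneg fun ζ =>
      mul_nonneg (mul_nonneg Real.posLog_nonneg (g.normSq_nonneg _)) (ha _))
      (mass_discCurrent_nonneg g r))
    (by
      filter_upwards [h.eventually_mem] with r hr a
      simp only [hΨ]
      rw [abs_div, abs_of_nonneg (mass_discCurrent_nonneg g r)]
      refine div_le_of_le_mul₀ (mass_discCurrent_nonneg g r) (norm_nonneg _) ?_
      rw [mass_discCurrent, ← integral_const_mul, ← Real.norm_eq_abs]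
      refine norm_integral_le_of_norm_le
        ((integrableOn_mass g h.mdifferentiableOn hr.1 hr.2).const_mul _) (ae_of_all _ fun ζ => ?_)
      rw [norm_mul, Real.norm_of_nonneg (mul_nonneg Real.posLog_nonneg (g.normSq_nonneg _)),
        mul_comm]
      exact mul_le_mul_of_nonneg_right (a.norm_coe_le_norm _)
        (mul_nonneg Real.posLog_nonneg (g.normSq_nonneg _)))
  refine ⟨σ, hσ, fun F hF => ?_⟩
  set a : C(A, ℝ) := ⟨fun x => (F x).re, Complex.continuous_re.comp hF⟩
  set b : C(A, ℝ) := ⟨fun x => (F x).im, Complex.continuous_im.comp hF⟩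
  obtain ⟨C, hC⟩ := isCompact_univ.exists_bound_of_continuousOn hF.continuousOn
  have hFi : Integrable F σ :=
    Integrable.of_bound hF.aestronglyMeasurable C (ae_of_all _ fun x => hC x (mem_univ x))
  have h1 := (((Complex.continuous_ofReal.tendsto _).comp (hlim a)).add
    (((Complex.continuous_ofReal.tendsto _).comp (hlim b)).mul_const Complex.I))
  have e : ∫ x, F x ∂σ = ((∫ x, a x ∂σ : ℝ) : ℂ) + ((∫ x, b x ∂σ : ℝ) : ℂ) * Complex.I :=
    (integral_re_add_im hFi).symm
  rw [e]
  refine h1.congr' ?_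
  filter_upwards [h.eventually_mem] with r hr
  simp only [Function.comp_apply, hΨ, Complex.ofReal_div]
  rw [div_mul_eq_mul_div, ← add_div]
  congr 1
  have hre : Integrable (fun ζ => ((posLog (r / ‖ζ‖) * g.normSq (velocity φ ζ) * a (Φ ζ) : ℝ) : ℂ))
      (volume.restrict (ball 0 1)) := (hint hr a).ofReal
  have him : Integrable (fun ζ => ((posLog (r / ‖ζ‖) * g.normSq (velocity φ ζ) * b (Φ ζ) : ℝ) : ℂ))
      (volume.restrict (ball 0 1)) := (hint hr b).ofReal
  rw [← integral_complex_ofReal, ← integral_complex_ofReal, ← integral_mul_const,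
    ← integral_add hre (him.mul_const _)]
  refine integral_congr_ae (ae_of_all _ fun ζ => ?_)
  simp only [a, b, ContinuousMap.coe_mk]
  conv_rhs => rw [← Complex.re_add_im (F (Φ ζ))]
  push_cast
  ring

variable [T2Space M] [CompactSpace M]

/-- The limit of the trace measures, read in a flow box. -/
lemma IsDiscLimit.exists_box_measure {L : SingularLamination E M} (B : FlowBox E L.Y)
    [Nonempty B.T] [SecondCountableTopology B.T] [MeasurableSpace B.T] [BorelSpace B.T]
    (hX : MapsTo φ (ball 0 1) L.X) :
    ∃ ρ : Measure (B.T × ℂ), IsFiniteMeasure ρ ∧ ∀ (P : B.T × ℂ → ℂ) (K : Set (B.T × ℂ)),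
      IsTest P K → Tendsto (fun r => (∫ ζ in ball (0 : ℂ) 1, (posLog (r / ‖ζ‖) : ℂ) *
        ((g.normSq (velocity φ ζ) : ℂ) *
          (φ ⁻¹' B.domain).indicator (fun ζ => P (B.coord (φ ζ)).swap) ζ)) /
        (mass g (discCurrent φ r) : ℂ)) l
        (𝓝 (∫ p, ((univ : Set B.T) ×ˢ ball (0 : ℂ) 1).indicator P p ∂ρ)) := by
  classical
  have : CompactSpace L.X := isCompact_iff_compactSpace.1 (isClosed_closure (s := L.Y)).isCompact
  let : MeasurableSpace L.X := borel L.X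
  have : BorelSpace L.X := ⟨rfl⟩
  have hne : φ 0 ∈ L.X := hX (by simp)
  -- Only points of the disc matter; the value φ 0 elsewhere merely makes the map total.
  set Φ : ℂ → L.X := fun ζ => if hζ : φ ζ ∈ L.X then ⟨φ ζ, hζ⟩ else ⟨φ 0, hne⟩ with hΦdef
  have hΦv : ∀ ζ ∈ ball (0 : ℂ) 1, (Φ ζ : M) = φ ζ := fun ζ hζ => by
    simp only [hΦdef, dif_pos (hX hζ)]
  have hΦ : ContinuousOn Φ (ball 0 1) := by
    rw [IsInducing.subtypeVal.continuousOn_iff]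
    exact h.mdifferentiableOn.continuousOn.congr hΦv
  obtain ⟨σ, hσ, hlim⟩ := h.exists_trace_measure hΦ
  obtain ⟨O, hO, hBO⟩ := B.exists_isOpen_domain
  set D : Set L.X := Subtype.val ⁻¹' B.domain with hD
  have hDo : IsOpen D := by
    have : D = Subtype.val ⁻¹' O := by
      ext x
      simp [hD, hBO]
    rw [this]
    exact hO.preimage continuous_subtype_val
  -- The transversal is put first because conditional kernels disintegrate over the first factor.
  set q : L.X → B.T × ℂ := fun x => (B.coord x).swap with hq
  have hqc : ContinuousOn q D := continuous_swap.comp_continuousOn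
    (B.continuousOn_coord.comp continuous_subtype_val.continuousOn fun x hx => hx)
  have hqm : ∀ x ∈ D, q x ∈ (univ : Set B.T) ×ˢ ball (0 : ℂ) 1 := fun x hx =>
    ⟨mem_univ _, B.coord_fst_mem hx⟩
  refine ⟨(σ.restrict D).map q, inferInstance, fun P K hP => ?_⟩
  have hPm : ContinuousOn (fun p : B.T × ℂ => B.plaqueMap p.1 p.2) (univ ×ˢ ball 0 1) :=
    B.continuousOn_uncurry_plaqueMap.comp continuous_swap.continuousOn fun p hp => ⟨hp.2, hp.1⟩
  have hK : IsClosed ((fun p : B.T × ℂ => B.plaqueMap p.1 p.2) '' K) :=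
    (hP.isCompact.image_of_continuousOn (hPm.mono hP.subset)).isClosed
  -- The support of the test function corresponds to a compact subset of the box, so extension by
  -- zero to X stays continuous and the weak limit on X applies.
  have hG : Continuous (D.indicator fun x => P (q x)) := by
    refine continuous_indicator_of_support hDo (hK.preimage continuous_subtype_val) ?_
      (hP.continuousOn.comp hqc hqm) fun x hx hxK => hP.eq_zero _ (hqm x hx) fun hqK => hxK ?_
    · rintro x ⟨p, hp, hpx⟩
      change (x : M) ∈ B.domain
      rw [← hpx]
      exact B.plaqueMap_mem_domain _ (hP.subset hp).2
    · exact ⟨q x, hqK, B.plaqueMap_coord hx⟩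
  have hl := hlim _ hG
  have e : ∫ x, D.indicator (fun x => P (q x)) x ∂σ =
      ∫ p, ((univ : Set B.T) ×ˢ ball (0 : ℂ) 1).indicator P p ∂(σ.restrict D).map q := by
    rw [integral_map (hqc.aemeasurable hDo.measurableSet) hP.measurable.aestronglyMeasurable,
      integral_indicator hDo.measurableSet]
    exact setIntegral_congr_fun hDo.measurableSet fun x hx => by
      rw [indicator_of_mem (hqm x hx)]
  rw [← e]
  refine hl.congr fun r => ?_
  congr 1
  refine setIntegral_congr_fun measurableSet_ball fun ζ hζ => ?_
  congr 2
  by_cases hd : φ ζ ∈ B.domain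
  · rw [indicator_of_mem (show Φ ζ ∈ D by rw [hD, mem_preimage, hΦv ζ hζ]; exact hd),
      indicator_of_mem (show ζ ∈ φ ⁻¹' B.domain from hd)]
    simp only [hq, hΦv ζ hζ]
  · rw [indicator_of_notMem (show Φ ζ ∉ D by rw [hD, mem_preimage, hΦv ζ hζ]; exact hd),
      indicator_of_notMem (show ζ ∉ φ ⁻¹' B.domain from hd)]

end LimitMeasures

/-! ### Laminar form of the limit current for a directed map. -/

section DirectedLimits

open Real (posLog)

variable {E : Type*} [NormedAddCommGroup E] [NormedSpace ℂ E] [FiniteDimensional ℂ E]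
variable {M : Type u} [TopologicalSpace M] [T2Space M] [ChartedSpace E M]
  [IsManifold 𝓘(ℂ, E) ω M]
variable {L : SingularLamination E M} {B : FlowBox E L.Y} [Nonempty B.T] {φ : ℂ → M}

omit [FiniteDimensional ℂ E] in
/-- Test functions in a flow box, pulled back by a directed map and extended by zero. -/
lemma directed_test_function [TopologicalSpace.MetrizableSpace M] [SecondCountableTopology M]
    (g : HermitianMetric E M) (hB : B ∈ L.boxes)
    (hφ : MDifferentiableOn 𝓘(ℂ) 𝓘(ℂ, E) φ (ball 0 1)) (hdir : L.IsDirectedMap φ)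
    {α : B.T → ℝ} (hα : HasCompactSupport α) {ε : ℝ} {q : ℂ} (hε : 0 < ε) (hq : ‖q‖ + ε < 1)
    {u : ℂ → ℂ} (hu : u = (ball (0 : ℂ) 1 ∩ φ ⁻¹' B.domain).indicator fun ζ =>
      ((α (B.coord (φ ζ)).2 * moll ε (q - (B.coord (φ ζ)).1) : ℝ) : ℂ)) :
    ContDiffOn ℝ 2 u (ball 0 1) ∧ ∀ ζ ∈ ball (0 : ℂ) 1, lap u ζ =
      (g.normSq (velocity φ ζ) : ℂ) * (φ ⁻¹' B.domain).indicator (fun ζ =>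
        ((α (B.coord (φ ζ)).2 * ((g.normSq (velocity (B.plaqueMap (B.coord (φ ζ)).2)
          (B.coord (φ ζ)).1))⁻¹ * lap (moll ε) (q - (B.coord (φ ζ)).1)) : ℝ) : ℂ)) ζ := by
  set U := ball (0 : ℂ) 1 ∩ φ ⁻¹' B.domain with hU
  have hUo : IsOpen U := isOpen_preimage_domain hφ.continuousOn hdir.1
  set f : ℂ → ℂ := fun ξ => (B.coord (φ ξ)).1
  have hf : DifferentiableOn ℂ (fun ξ => q - f ξ) U := fun ξ hξ =>
    ((directed_coord hB hφ hdir hξ).1.const_sub q).differentiableWithinAt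
  -- `K` is a compact subset of the box that carries the test function. Where φ leaves the box it
  -- avoids `K`, so u vanishes nearby.
  set K : Set M := (fun p : ℂ × B.T => B.plaqueMap p.2 p.1) '' (closedBall q ε ×ˢ tsupport α)
    with hK
  have hsub : closedBall q ε ⊆ ball (0 : ℂ) 1 := fun z hz => by
    have h1 : ‖z - q‖ ≤ ε := by simpa [dist_eq_norm] using hz
    have := norm_sub_norm_le z q
    simp only [mem_ball, dist_zero_right]
    linarith
  have hKc : IsClosed K := (((isCompact_closedBall q ε).prod hα).image_of_continuousOn
    (B.continuousOn_uncurry_plaqueMap.mono (prod_mono hsub (subset_univ _)))).isClosed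
  have hKd : K ⊆ B.domain := by
    rintro _ ⟨p, hp, rfl⟩
    exact B.plaqueMap_mem_domain _ (hsub hp.1)
  have hin : ∀ ζ ∈ U, ContDiffAt ℝ 2 u ζ ∧ lap u ζ = (‖deriv f ζ‖ ^ 2 : ℝ) *
      ((α (B.coord (φ ζ)).2 * lap (moll ε) (q - f ζ) : ℝ) : ℂ) := by
    intro ζ hζ
    set a := α (B.coord (φ ζ)).2 with ha
    set A : ℝ →L[ℝ] ℂ := a • Complex.ofRealCLM with hA
    have hm : ContDiff ℝ 2 (moll ε) := mod_cast contDiff_infty.1 (contDiff_moll ε) 2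
    have hw : ContDiff ℝ 2 fun y => A (moll ε y) := A.contDiff.comp hm
    -- Near ζ the factor α is frozen at one value, so u is C² although α is only continuous.
    have hev : u =ᶠ[𝓝 ζ] fun ξ => (fun y => A (moll ε y)) (q - f ξ) := by
      filter_upwards [eventually_transversal_eq hB hφ.continuousOn hdir hζ] with ξ hξ
      rw [hu, indicator_of_mem hξ.1, hξ.2]
      simp [hA, ha, f]
    constructor
    · refine ContDiffAt.congr_of_eventuallyEq ?_ hev
      exact hw.contDiffAt.comp ζ
        (((hf.contDiffOn hUo).contDiffAt (hUo.mem_nhds hζ)).restrict_scalars ℝ)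
    · rw [lap_congr hev, lap_comp_holomorphic_plane hUo hw hf hζ, lap_clm_comp A hm,
        deriv_const_sub, norm_neg]
      simp [hA]
  have hout : ∀ ζ ∈ ball (0 : ℂ) 1, ζ ∉ U → u =ᶠ[𝓝 ζ] 0 := by
    intro ζ hζ hζU
    have hζK : φ ζ ∉ K := fun h => hζU ⟨hζ, hKd h⟩
    have hc : ContinuousAt φ ζ := hφ.continuousOn.continuousAt (isOpen_ball.mem_nhds hζ)
    filter_upwards [hc.preimage_mem_nhds (hKc.isOpen_compl.mem_nhds hζK)] with ξ hξ
    rw [hu]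
    by_cases hξU : ξ ∈ U
    · rw [indicator_of_mem hξU]
      have : α (B.coord (φ ξ)).2 * moll ε (q - (B.coord (φ ξ)).1) = 0 := by
        by_contra hne
        refine hξ ⟨B.coord (φ ξ), ⟨?_, ?_⟩, B.plaqueMap_coord hξU.2⟩
        · by_contra h1
          have h2 : ε ≤ ‖q - (B.coord (φ ξ)).1‖ := by
            rw [norm_sub_rev, ← dist_eq_norm]
            exact (not_le.1 h1).le
          exact hne (by rw [moll_eq_zero hε h2, mul_zero])
        · by_contra h1
          exact hne (by rw [image_eq_zero_of_notMem_tsupport h1, zero_mul])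
      rw [this]
      rfl
    · rw [indicator_of_notMem hξU]
      rfl
  constructor
  · intro ζ hζ
    by_cases hζU : ζ ∈ U
    · exact (hin ζ hζU).1.contDiffWithinAt
    · exact (contDiffAt_const.congr_of_eventuallyEq (hout ζ hζ hζU)).contDiffWithinAt
  · intro ζ hζ
    by_cases hζU : ζ ∈ U
    · rw [(hin ζ hζU).2, indicator_of_mem hζU.2]
      -- This says |φ'|² = |f'|² times the squared speed of the plaque, which trades the conformal
      -- factor |f'|² of the Laplacian for the trace density.
      have h1 := (directed_coord hB hφ hdir hζU).2 g.form
      have hpos := B.normSq_velocity_plaqueMap_pos g (B.coord (φ ζ)).2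
        (B.coord_fst_mem hζU.2)
      rw [g.pullback_form, g.pullback_form] at h1
      rw [h1, ← Complex.ofReal_mul, ← Complex.ofReal_mul, ← Complex.ofReal_mul]
      congr 1
      change _ = ‖deriv f ζ‖ ^ 2 * _ * (_ * (_ * lap (moll ε) (q - f ζ)))
      field_simp
    · rw [lap_congr (hout ζ hζ hζU), indicator_of_notMem fun h => hζU ⟨hζ, h⟩]
      simp [lap]

variable [CompactSpace M] {g : HermitianMetric E M} {l : Ultrafilter ℝ} {T : Form11 E M → ℂ}

/-- The limit of the disc currents of a directed map is an integral of harmonic currents on the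
plaques. -/
theorem IsDiscLimit.hasLaminarForm_of_nonempty (h : IsDiscLimit g φ l T)
    (hdir : L.IsDirectedMap φ) (hB : B ∈ L.boxes) : L.HasLaminarForm T B := by
  have : ProperSpace E := FiniteDimensional.proper ℂ E
  have : SecondCountableTopology M := ChartedSpace.secondCountable_of_sigmaCompact E M
  have : TopologicalSpace.MetrizableSpace M :=
    TopologicalSpace.metrizableSpace_of_t3_secondCountable M
  have : TopologicalSpace.MetrizableSpace B.T := B.metrizableSpace_transversal
  have : SecondCountableTopology B.T := B.secondCountable_transversal
  have : LocallyCompactSpace B.T := B.locallyCompactSpace_transversal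
  let mT : MeasurableSpace B.T := borel B.T
  have bT : BorelSpace B.T := ⟨rfl⟩
  obtain ⟨ρ, hρ, hlim⟩ := h.exists_box_measure B hdir.1
  -- ρ is a limit of trace measures, weighted by |φ'|²; dividing by the squared plaque speed
  -- converts it into the current acting on pullbacks to plaques.
  set v : B.T × ℂ → ℝ := fun p => (g.normSq (velocity (B.plaqueMap p.1) p.2))⁻¹ with hv
  have hvc : ContinuousOn v (univ ×ˢ ball (0 : ℂ) 1) :=
    (B.continuousOn_normSq_velocity_plaqueMap g).inv₀ fun p hp =>
      (B.normSq_velocity_plaqueMap_pos g p.1 hp.2).ne'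
  have hv0 : ∀ p, 0 ≤ v p := fun p => inv_nonneg.2 (g.normSq_nonneg _)
  obtain ⟨μ, hd, hμ, hharm, hpos, hmeas, hrep⟩ := exists_harmonic_disintegration ρ hvc hv0
    fun α ε q hα hαs hε hq => by
      set P : B.T × ℂ → ℂ := fun p => ((α p.1 * (v p * lap (moll ε) (q - p.2)) : ℝ) : ℂ) with hP
      have hsub : closedBall q ε ⊆ ball (0 : ℂ) 1 := fun z hz => by
        have h1 : ‖z - q‖ ≤ ε := by simpa [dist_eq_norm] using hz
        have := norm_sub_norm_le z q
        simp only [mem_ball, dist_zero_right]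
        linarith
      have hPt : IsTest P (tsupport α ×ˢ closedBall q ε) := by
        refine ⟨?_, hαs.prod (isCompact_closedBall _ _), prod_mono (subset_univ _) hsub,
          fun p hp hpK => ?_⟩
        · refine Complex.continuous_ofReal.comp_continuousOn
            ((hα.comp continuous_fst).continuousOn.mul (hvc.mul ?_))
          exact ((contDiff_lap (contDiff_moll ε)).continuous.comp
            (by fun_prop : Continuous fun p : B.T × ℂ => q - p.2)).continuousOn
        · simp only [hP]
          by_cases h1 : p.1 ∈ tsupport α
          · rw [lap_moll_eq_zero hε, mul_zero, mul_zero, Complex.ofReal_zero]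
            rw [norm_sub_rev, ← dist_eq_norm]
            by_contra h2
            exact hpK ⟨h1, not_lt.1 h2⟩
          · rw [image_eq_zero_of_notMem_tsupport h1, zero_mul, Complex.ofReal_zero]
      obtain ⟨hu1, hu2⟩ := directed_test_function g hB h.mdifferentiableOn hdir hαs hε hq rfl
      obtain ⟨C₁, hC₁⟩ := hα.bounded_above_of_compact_support hαs
      obtain ⟨C₂, hC₂⟩ := (continuous_moll ε).bounded_above_of_compact_support
        (hasCompactSupport_moll hε)
      -- The test function is bounded on the disc, so Jensen's formula makes its normalized
      -- Laplacian integrals tend to zero. The same integrals tend to the integral of `P` against ρ.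
      have h0 := h.tendsto_integral_lap hu1 (C := |C₁| * |C₂|) fun z _ => by
        refine (norm_indicator_le_norm_self _ _).trans ?_
        rw [Complex.norm_real, norm_mul]
        exact mul_le_mul ((hC₁ _).trans (le_abs_self _)) ((hC₂ _).trans (le_abs_self _))
          (norm_nonneg _) (abs_nonneg _)
      have h1 : ∫ p, ((univ : Set B.T) ×ˢ ball (0 : ℂ) 1).indicator P p ∂ρ = 0 := by
        refine tendsto_nhds_unique (hlim P _ hPt) (h0.congr fun r => ?_)
        congr 1
        exact setIntegral_congr_fun measurableSet_ball fun ζ hζ => by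
          rw [hu2 ζ hζ]
          rfl
      have h2 : ∀ p, ((univ : Set B.T) ×ˢ ball (0 : ℂ) 1).indicator P p =
          ((((univ : Set B.T) ×ˢ ball (0 : ℂ) 1).indicator
            (fun p => α p.1 * (v p * lap (moll ε) (q - p.2))) p : ℝ) : ℂ) := fun p => by
        by_cases hp : p ∈ (univ : Set B.T) ×ˢ ball (0 : ℂ) 1
        · rw [indicator_of_mem hp, indicator_of_mem hp]
        · rw [indicator_of_notMem hp, indicator_of_notMem hp, Complex.ofReal_zero]
      simp only [h2] at h1
      rw [integral_complex_ofReal] at h1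
      exact_mod_cast h1
  refine ⟨mT, bT, μ, hd, inferInstance, hharm, hpos, hmeas, fun θ hθ => ?_⟩
  -- The support of θ meets the compact set X inside the box, so its image in coordinates is
  -- compact.
  set K : Set (B.T × ℂ) := (fun x => (B.coord x).swap) '' (closure {x | θ.1 x ≠ 0} ∩ L.X) with hK
  have hcomp : IsCompact (closure {x | θ.1 x ≠ 0} ∩ L.X) :=
    (isClosed_closure.inter isClosed_closure).isCompact
  have hzero : ∀ x, θ.1 x = 0 → ∀ v : TangentSpace 𝓘(ℂ, E) x, θ.1 x v v = 0 := fun x hx v => by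
    rw [hx]
    rfl
  have hYX : L.Y ⊆ L.X := subset_closure
  have hPt : IsTest (fun p : B.T × ℂ => pullback (B.plaqueMap p.1) θ p.2) K := by
    refine ⟨B.continuousOn_pullback_plaqueMap θ, hcomp.image_of_continuousOn
      (continuous_swap.comp_continuousOn (B.continuousOn_coord.mono hθ)), ?_, fun p hp hpK => ?_⟩
    · rintro _ ⟨x, hx, rfl⟩
      exact ⟨mem_univ _, B.coord_fst_mem (hθ hx)⟩
    · refine hzero _ ?_ _
      by_contra hne
      refine hpK ⟨B.plaqueMap p.1 p.2, ⟨subset_closure hne, hYX (Subtype.coe_prop _)⟩, ?_⟩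
      simp only [B.coord_plaqueMap _ hp.2, Prod.swap_prod_mk]
  obtain ⟨h1, h2, h3⟩ := hrep _ K hPt
  refine ⟨h1, h2, ?_⟩
  rw [← h3]
  have hvP : IsTest (fun p : B.T × ℂ => (v p : ℂ) * pullback (B.plaqueMap p.1) θ p.2) K :=
    ⟨(Complex.continuous_ofReal.comp_continuousOn hvc).mul hPt.continuousOn, hPt.isCompact,
      hPt.subset, fun p hp hpK => by rw [hPt.eq_zero p hp hpK, mul_zero]⟩
  refine tendsto_nhds_unique (h.tendsto θ) ((hlim _ K hvP).congr fun r => ?_)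
  unfold normalizedDiscCurrent discCurrent
  congr 1
  refine setIntegral_congr_fun measurableSet_ball fun ζ hζ => ?_
  congr 1
  by_cases hd : φ ζ ∈ B.domain
  · rw [indicator_of_mem (show ζ ∈ φ ⁻¹' B.domain from hd)]
    have hζU : ζ ∈ ball (0 : ℂ) 1 ∩ φ ⁻¹' B.domain := ⟨hζ, hd⟩
    have hc := (directed_coord hB h.mdifferentiableOn hdir hζU).2
    have hg := hc g.form
    rw [g.pullback_form, g.pullback_form] at hg
    have hne : (g.normSq (velocity (B.plaqueMap (B.coord (φ ζ)).2) (B.coord (φ ζ)).1) : ℂ) ≠ 0 :=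
      Complex.ofReal_ne_zero.2 (B.normSq_velocity_plaqueMap_pos g _ (B.coord_fst_mem hd)).ne'
    rw [hc θ, hg]
    simp only [hv, Prod.fst_swap, Prod.snd_swap, Complex.ofReal_inv]
    field_simp
  · rw [indicator_of_notMem (show ζ ∉ φ ⁻¹' B.domain from hd), mul_zero]
    refine (hzero _ ?_ _).symm
    by_contra hne
    exact hd (hθ ⟨subset_closure hne, hdir.1 hζ⟩)

end DirectedLimits

/-! ### Assembly, including boxes with empty transversal. -/

section MainTheorem

variable {E : Type*} [NormedAddCommGroup E] [NormedSpace ℂ E] [FiniteDimensional ℂ E]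
variable {M : Type u} [TopologicalSpace M] [T2Space M] [CompactSpace M] [ChartedSpace E M]
  [IsManifold 𝓘(ℂ, E) ω M]
variable {g : HermitianMetric E M} {φ : ℂ → M} {l : Ultrafilter ℝ} {T : Form11 E M → ℂ}

theorem IsDiscLimit.hasLaminarForm (h : IsDiscLimit g φ l T) {L : SingularLamination E M}
    (hdir : L.IsDirectedMap φ) {B : FlowBox E L.Y} (hB : B ∈ L.boxes) : L.HasLaminarForm T B := by
  by_cases hT : Nonempty B.T
  · exact h.hasLaminarForm_of_nonempty hdir hB
  rw [not_nonempty_iff] at hT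
  -- An empty transversal makes the box empty. The admissible forms then vanish on a neighbourhood
  -- of X, and the support statement gives T θ = 0, the integral for μ = 0.
  have hdom : B.domain = ∅ := by
    refine eq_empty_of_forall_notMem ?_
    rintro _ ⟨y, -, -⟩
    exact hT.elim (B.chart y).2
  let mT : MeasurableSpace B.T := borel B.T
  refine ⟨mT, ⟨rfl⟩, 0, fun _ _ => 1, inferInstance, fun t => hT.elim t, fun t => hT.elim t,
    fun z _ => measurable_const, fun θ hθ => ⟨fun t => hT.elim t, integrable_zero_measure, ?_⟩⟩
  rw [hdom, subset_empty_iff] at hθ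
  rw [integral_zero_measure]
  refine h.isSupportedOn hdir.1 θ (closure {x | θ.1 x ≠ 0})ᶜ isClosed_closure.isOpen_compl
    (fun x hx hx' => (hθ ▸ ⟨hx', hx⟩ : x ∈ (∅ : Set M))) fun x hx => ?_
  by_contra hne
  exact hx (subset_closure hne)

theorem IsDiscLimit.isDirected (h : IsDiscLimit g φ l T) {L : SingularLamination E M}
    (hdir : L.IsDirectedMap φ) : L.IsDirected T :=
  ⟨h.isPositiveHarmonicCurrent, h.isSupportedOn hdir.1, fun _ hB => h.hasLaminarForm hdir hB⟩

end MainTheorem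

end HarmonicCurrents

end

open HarmonicCurrents in
theorem theorem22 {E : Type*} [NormedAddCommGroup E] [NormedSpace ℂ E] [FiniteDimensional ℂ E]
    {M : Type*} [TopologicalSpace M] [T2Space M] [CompactSpace M] [ChartedSpace E M]
    [IsManifold 𝓘(ℂ, E) ω M] (g : HermitianMetric E M)
    (φ : ℂ → M) (hφ : MDifferentiableOn 𝓘(ℂ) 𝓘(ℂ, E) φ (ball 0 1))
    (hinf : ∫⁻ ζ in ball (0 : ℂ) 1,
      ENNReal.ofReal ((1 - ‖ζ‖) * g.normSq (velocity φ ζ)) = ⊤) :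
    ∀ T : Form11 E M → ℂ,
      MapClusterPt T (𝓝[<] (1 : ℝ)) (fun r => normalizedDiscCurrent g φ r) →
        (IsPositiveHarmonicCurrent T ∧ IsSupportedOn T (closure (φ '' ball 0 1))) ∧
        (∀ (L : SingularLamination E M) (ℓ : ℕ) (γ : Fin ℓ → ∀ x : M, Covector10 E M x),
          L.DefinedBy γ → L.IsWeaklyDirectedMap γ φ → L.IsWeaklyDirected g γ T) ∧
        (∀ L : SingularLamination E M, L.IsDirectedMap φ → L.IsDirected T) := by
  intro T hT
  obtain ⟨l, h⟩ := exists_isDiscLimit hφ hinf hT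
  refine ⟨⟨h.isPositiveHarmonicCurrent, h.isSupportedOn fun ζ hζ =>
    subset_closure (mem_image_of_mem φ hζ)⟩, fun L ℓ γ _ hdir => ?_, fun L hdir => h.isDirected hdir⟩
  exact ⟨h.isCurrent, h.isPositive, h.isSupportedOn hdir.1, fun j => h.wedgeEqZero (hdir.2 j)⟩
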